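/- **Setting.** For $L\in\mathbb N$ let $\mathcal H=\Gamma(\mathbb C^L)$ be the $2^L$-dimensional fermionic space with annihilation operators $c_1,\dots,c_L$ and number operator $N$. Let $\mathcal Y$ be the phase space with orthonormal basis $e_1,\dots,e_{2L}$, let $\varphi$ be linear on $\mathcal Y$ with $\varphi(e_i)=c_i^*$, $\varphi(e_{i+L})=c_i$, and let $\xi$ be the antilinear involution of $\mathcal Y$ exchanging $e_i$ and $e_{i+L}$; put $T^T=\xi T^*\xi$. For an operator $T$ on $\mathcal Y$ write $F^*TF=\sum_{k,l}T_{kl}\,\varphi(e_k)\varphi(e_l)^*$. The covariance of a state $\rho$ is $\mathrm{cov}(\rho)_{kl}=\mathrm{Tr}(\rho\,\varphi(e_k)^*\varphi(e_l))$. With the Majorana operators $\gamma_i=c_i+c_i^*$, $\gamma_{i+L}=-i(c_i-c_i^*)$ $(i\le L)$, a state $\rho$ is quasi-free if for all indices $\mathrm{Tr}(\rho\,\gamma_{i_1}\cdots\gamma_{i_m})$ is $0$ for $m$ odd and, for $m$ even, equals $\sum_{\sigma}\mathrm{sgn}(\sigma)\prod_{l=1}^{m/2}\mathrm{Tr}(\rho\,\gamma_{i_{\sigma(2l-1)}}\gamma_{i_{\sigma(2l)}})$,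 the sum being over the pairings of $\{1,\dots,m\}$, i.e. the permutations with $\sigma(2l-1)<\sigma(2l)$ and $\sigma(1)<\sigma(3)<\cdots$. Consider a system $S$ and baths $B_1,\dots,B_n$ of this type, with $\beta\in\mathbb R^n$, self-adjoint operators $T_S,\kappa_S$ on $\mathcal Y_S$ and $\kappa_i$ on $\mathcal Y_{B_i}$ that anticommute with $\xi$, and linear maps $\Theta_i:\mathcal Y_{B_i}\to\mathcal Y_S$ with $\xi\Theta_i\xi=-\Theta_i$, such that $[T_S,\kappa_S]=0$ and $\Theta_i\kappa_i=\kappa_S\Theta_i$ for all $i$. Put $H_S=\frac12F_S^*T_SF_S$, $K_S=\frac12F_S^*\kappa_SF_S$, $K_{B_i}=\frac12F_{B_i}^*\kappa_iF_{B_i}$, $\rho_{B_i}=e^{-\beta_iK_{B_i}}/\mathrm{Tr}(e^{-\beta_iK_{B_i}})$, let $H_{SB_i}=\sum_{k,l}(\Theta_i)_{kl}\,\varphi_S(e_k)\varphi_{B_i}(e_l)^*$ on $\mathcal H_S\otimes\mathcal H_{B_i}$, where $\varphi_S(x)$ acts as $\varphi_S(x)\otimes(-1)^{N_{B_i}}$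 and $\varphi_{B_i}(y)$ as $1\otimes\varphi_{B_i}(y)$, and let $$\Phi_i(A)=\mathrm{Tr}_{B_i}\big((1\otimes\rho_{B_i})H_{SB_i}(A\otimes 1)H_{SB_i}\big).$$ Assume that the semigroup generated by $\mathcal L(A)=i[H_S,A]+\sum_i\big(\Phi_i(A)-\frac12\{\Phi_i(1),A\}\big)$ is positivity improving: $e^{t\mathcal L}(A)>0$ for all $t>0$ and all $A\ge0$, $A\neq0$. For $\alpha\in\mathbb R^n$ let $$\mathcal L_\alpha(A)=D^*A+AD+\sum_{i}\Phi_i\big(Ae^{-\alpha_iK_S}\big)e^{\alpha_iK_S},\qquad D=-iH_S-\tfrac12\sum_i\Phi_i(1),$$ and let $\mathcal L_\alpha^*$ be its dual, $\mathrm{Tr}(\mathcal L_\alpha^*(\rho)A)=\mathrm{Tr}(\rho\,\mathcal L_\alpha(A))$. With $M_{\beta_i}=(1+e^{-\beta_i\kappa_S})^{-1}$ define operators on $\mathcal Y_S$ by $$Q_{\alpha,\beta}=\sum_i\Theta_i\Theta_i^*M_{\beta_i}(e^{\alpha_i\kappa_S}-1),\qquad B_{\alpha,\beta}=\sum_ie^{\alpha_i\kappa_S}M_{\beta_i}\Theta_i\Theta_i^*,$$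 $$G_{\alpha,\beta}=-iT_S-\tfrac12\sum_i\Theta_i\Theta_i^*-Q_{\alpha,\beta},\qquad C_{\alpha,\beta}=Q_{\alpha,\beta}-Q_{\alpha,\beta}^T.$$ **Proposition.** Let $\alpha\in\mathbb R^n$. 1. For every $t\ge0$, $e^{t\mathcal L_\alpha^*}$ preserves the complex vector space spanned by the quasi-free states; moreover it maps each quasi-free state to a positive multiple of a quasi-free state. 2. $\mathcal L_\alpha^*$ has a real eigenvalue $e(\alpha)$ such that every other eigenvalue has real part strictly smaller than $e(\alpha)$; its eigenspace is one-dimensional and is spanned by a quasi-free state. 3. A quasi-free state $\rho$ with covariance $M=\mathrm{cov}(\rho)$ is an eigenvector of $\mathcal L_\alpha^*$ if and only if $$G_{\alpha,\beta}M+MG_{\alpha,\beta}^*+MC_{\alpha,\beta}M+B_{\alpha,\beta}=0 .$$ In that case the corresponding eigenvalue is $$\lambda=\mathrm{tr}\big(Q_{\alpha,\beta}^TM\big)=-\tfrac12\mathrm{tr}\big(C_{\alpha,\beta}M\big)+\tfrac12\mathrm{tr}\big(Q_{\alpha,\beta}\big).$$ -/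

import Mathlib

open scoped Matrix Kronecker ComplexOrder

noncomputable section

namespace QuasiFree

/-! ### Fermionic Fock space over a one-particle space with orthonormal basis `|1⟩, …, |L⟩`

The basis vector `|u₁, …, u_L⟩` is indexed by the finite set of its occupied modes, and operators on
the Fock space are matrices in this orthonormal basis. -/

/-- Operators on the `2 ^ L`-dimensional fermionic space. -/
abbrev FockOp (L : ℕ) : Type := Matrix (Finset (Fin L)) (Finset (Fin L)) ℂ

/-- Linear maps on operators. -/
abbrev SuperOp (L : ℕ) : Type := FockOp L →ₗ[ℂ] FockOp L

/-- The annihilation operator `c_i`: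
`c_i |u⟩ = (-1) ^ (∑ j < i, u_j) |u - 1_i⟩` if the mode `i` is occupied in `u`, and `0` otherwise. -/
def annihilation {L : ℕ} (i : Fin L) : FockOp L :=
  Matrix.of fun s u => if i ∈ u ∧ s = u.erase i then (-1) ^ (u.filter (· < i)).card else 0

/-- The creation operator `c_i^*`. -/
def creation {L : ℕ} (i : Fin L) : FockOp L := (annihilation i)ᴴ

/-- The parity operator `(-1) ^ N`. -/
def parity (L : ℕ) : FockOp L := Matrix.diagonal fun u => (-1) ^ u.card

/-- The Majorana operators `γ_i = c_i + c_i^*` and `γ_{i+L} = -i (c_i - c_i^*)`. -/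
def majorana {L : ℕ} : Fin L ⊕ Fin L → FockOp L
  | Sum.inl i => annihilation i + creation i
  | Sum.inr i => (-Complex.I) • (annihilation i - creation i)

/-! ### The phase space

The phase space `𝒴 = ℋ₀ ⊕ conj ℋ₀` has the orthonormal basis `e_1, …, e_{2L}` (the
creation/annihilation basis), indexed by `Fin L ⊕ Fin L`; linear maps between phase spaces are
matrices in these bases, so that the Hilbert space adjoint is the conjugate transpose. -/

/-- Linear maps from the phase space over `L'` modes to the phase space over `L` modes. -/
abbrev PhaseMap (L L' : ℕ) : Type := Matrix (Fin L ⊕ Fin L) (Fin L' ⊕ Fin L') ℂ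

/-- The field operator on the basis vectors: `φ(e_i) = c_i^*` and `φ(e_{i+L}) = c_i`. -/
def field {L : ℕ} : Fin L ⊕ Fin L → FockOp L
  | Sum.inl i => creation i
  | Sum.inr i => annihilation i

/-- `ξ T ξ`, where `ξ` is the antilinear involution of the phase space that exchanges `e_i` and
`e_{i+L}`. -/
def xiConj {L L' : ℕ} (T : PhaseMap L L') : PhaseMap L L' :=
  (T.map (starRingEnd ℂ)).submatrix Sum.swap Sum.swap

/-- The transposition `T^T = ξ T^* ξ` of an operator on the phase space. -/
def xiTranspose {L : ℕ} (T : PhaseMap L L) : PhaseMap L L := xiConj Tᴴ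

/-- The quadratic operator `F^* T F = ∑ k l, T_{kl} φ(e_k) φ(e_l)^*`, where `F` is the column operator
`F |u⟩ = ∑ k, (φ(e_k)^* |u⟩) ⊗ e_k`. -/
def quadratic {L : ℕ} (T : PhaseMap L L) : FockOp L :=
  ∑ k, ∑ l, T k l • (field k * (field l)ᴴ)

/-- `dΓ(T) = (1/2) F^* T F`. -/
def dGamma {L : ℕ} (T : PhaseMap L L) : FockOp L := (1 / 2 : ℂ) • quadratic T

/-! ### States -/

/-- States (density matrices). -/
def IsState {L : ℕ} (ρ : FockOp L) : Prop := ρ.PosSemidef ∧ ρ.trace = 1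

/-- The covariance matrix `cov(ρ) = Tr_ℋ(ρ F F^*)`, that is `cov(ρ)_{kl} = Tr(ρ φ(e_k)^* φ(e_l))`. -/
def cov {L : ℕ} (ρ : FockOp L) : PhaseMap L L :=
  Matrix.of fun k l => (ρ * ((field k)ᴴ * field l)).trace

/-- The position of the first element of the `l`-th pair. -/
def fstPos {m : ℕ} (l : Fin m) : Fin (2 * m) := ⟨2 * l, by omega⟩

/-- The position of the second element of the `l`-th pair. -/
def sndPos {m : ℕ} (l : Fin m) : Fin (2 * m) := ⟨2 * l + 1, by omega⟩

/-- The pairings of a set of `2 m` ordered elements. The pairing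
`{{σ(0), σ(1)}, {σ(2), σ(3)}, …}` is encoded by the unique such permutation `σ` with increasing pairs
that are sorted by their first element. -/
def pairings (m : ℕ) : Finset (Equiv.Perm (Fin (2 * m))) :=
  open Classical in
  Finset.univ.filter fun σ =>
    (∀ l : Fin m, σ (fstPos l) < σ (sndPos l)) ∧
      ∀ l l' : Fin m, l < l' → σ (fstPos l) < σ (fstPos l')

/-- Quasi-free states: states that satisfy the Wick formula. -/
structure IsQuasiFree {L : ℕ} (ρ : FockOp L) : Prop where
  isState : IsState ρ
  wick_even : ∀ (m : ℕ) (i : Fin (2 * m) → Fin L ⊕ Fin L),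
    (ρ * (List.ofFn fun k => majorana (i k)).prod).trace =
      ∑ σ ∈ pairings m, ((Equiv.Perm.sign σ : ℤ) : ℂ) *
        ∏ l : Fin m, (ρ * (majorana (i (σ (fstPos l))) * majorana (i (σ (sndPos l))))).trace
  wick_odd : ∀ (m : ℕ) (i : Fin (2 * m + 1) → Fin L ⊕ Fin L),
    (ρ * (List.ofFn fun k => majorana (i k)).prod).trace = 0

/-- The Gibbs state `e^{-β K} / Tr(e^{-β K})`. -/
def gibbs {L : ℕ} (β : ℝ) (K : FockOp L) : FockOp L :=
  (NormedSpace.exp (-(β : ℂ) • K)).trace⁻¹ • NormedSpace.exp (-(β : ℂ) • K)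

/-! ### Super-operators -/

/-- The dual `Λ^*` of `Λ` with respect to the trace: `Tr(Λ^*(ρ) A) = Tr(ρ Λ(A))` for all `ρ, A`. -/
def traceDual {L : ℕ} (Λ : SuperOp L) : SuperOp L where
  toFun ρ := Matrix.of fun a b => (ρ * Λ (Matrix.single b a 1)).trace
  map_add' ρ σ := by
    ext a b
    simp [add_mul]
  map_smul' c ρ := by
    ext a b
    simp

theorem trace_traceDual_mul {L : ℕ} (Λ : SuperOp L) (ρ A : FockOp L) :
    (traceDual Λ ρ * A).trace = (ρ * Λ A).trace := by
  conv_rhs => rw [Matrix.matrix_eq_sum_single A]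
  have h : ∀ i j, Matrix.single i j (A i j) = A i j • Matrix.single i j (1 : ℂ) := by
    intro i j
    simp
  simp only [h, map_sum, map_smul, Matrix.mul_sum, Matrix.trace_sum, Matrix.mul_smul,
    Matrix.trace_smul, smul_eq_mul]
  rw [Finset.sum_comm]
  simp only [Matrix.trace, Matrix.diag, Matrix.mul_apply, traceDual, LinearMap.coe_mk,
    AddHom.coe_mk, Matrix.of_apply]
  exact Finset.sum_congr rfl fun i _ => Finset.sum_congr rfl fun j _ => mul_comm _ _

/-- The semigroup `e^{tΛ}`, `e^{tΛ}(A) = ∑ k, (t^k / k!) Λ^k(A)`. -/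
def expSemigroup {L : ℕ} (Λ : SuperOp L) (t : ℝ) (A : FockOp L) : FockOp L :=
  ∑' k : ℕ, ((t : ℂ) ^ k / (k.factorial : ℂ)) • (Λ ^ k) A

/-- The semigroup generated by `Λ` is positivity improving: `e^{tΛ}(A) > 0` for all `t > 0` and all
nonzero `A ≥ 0`. -/
def IsPositivityImproving {L : ℕ} (Λ : SuperOp L) : Prop :=
  ∀ t : ℝ, 0 < t → ∀ A : FockOp L, A.PosSemidef → A ≠ 0 → (expSemigroup Λ t A).PosDef

/-- The partial trace over the second factor of a tensor product. -/
def partialTraceRight {m n : Type*} [Fintype n] (X : Matrix (m × n) (m × n) ℂ) : Matrix m m ℂ :=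
  Matrix.of fun a b => ∑ j, X (a, j) (b, j)

/-! ### Thermal quasi-free fermionic semigroups -/

/-- The data of a thermal quasi-free repeated interaction model with `n` baths: mode numbers of the
system and of the baths, inverse temperatures, and operators on the phase spaces. -/
structure ThermalModel (n : ℕ) where
  /-- number of modes of the system -/
  LS : ℕ
  /-- numbers of modes of the baths -/
  LB : Fin n → ℕ
  /-- inverse temperatures of the baths -/
  β : Fin n → ℝ
  /-- the system Hamiltonian is `H_S = (1/2) F_S^* T_S F_S` -/
  TS : PhaseMap LS LS
  /-- the interaction with the `i`-th bath is `H_{SB_i} = F_S^* Θ_i F_{B_i}` -/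
  Θ : (i : Fin n) → PhaseMap LS (LB i)
  /-- the pseudo-energy of the system is `K_S = (1/2) F_S^* κ_S F_S` -/
  κS : PhaseMap LS LS
  /-- the pseudo-energy of the `i`-th bath is `K_{B_i} = (1/2) F_{B_i}^* κ_i F_{B_i}` -/
  κB : (i : Fin n) → PhaseMap (LB i) (LB i)
  TS_selfAdjoint : TSᴴ = TS
  TS_xi : xiConj TS = -TS
  Θ_xi : ∀ i, xiConj (Θ i) = -Θ i
  κS_selfAdjoint : κSᴴ = κS
  κS_xi : xiConj κS = -κS
  κB_selfAdjoint : ∀ i, (κB i)ᴴ = κB i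
  κB_xi : ∀ i, xiConj (κB i) = -κB i
  /-- conservation of the pseudo-energy by `H_S` -/
  commute_TS_κS : TS * κS = κS * TS
  /-- conservation of the pseudo-energy by `H_{SB_i}` -/
  Θ_mul_κB : ∀ i, Θ i * κB i = κS * Θ i

namespace ThermalModel

variable {n : ℕ} (m : ThermalModel n)

/-- The system Hamiltonian. -/
def HS : FockOp m.LS := dGamma m.TS

/-- The pseudo-energy of the system. -/
def KS : FockOp m.LS := dGamma m.κS

/-- The thermal state of the `i`-th bath. -/
def bathState (i : Fin n) : FockOp (m.LB i) := gibbs (m.β i) (dGamma (m.κB i))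

/-- The interaction Hamiltonian `H_{SB_i} = F_S^* Θ_i F_{B_i}` on `ℋ_S ⊗ ℋ_{B_i}`. In the
identification of this tensor product with the fermionic space of the joint system, the fields of the
system act as `φ_S(x) ⊗ (-1)^{N_B}` and those of the bath act as `1 ⊗ φ_B(y)`. -/
def HSB (i : Fin n) : Matrix (Finset (Fin m.LS) × Finset (Fin (m.LB i)))
    (Finset (Fin m.LS) × Finset (Fin (m.LB i))) ℂ :=
  ∑ k, ∑ l, m.Θ i k l •
    ((field k ⊗ₖ parity (m.LB i)) * ((1 : FockOp m.LS) ⊗ₖ (field l)ᴴ))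

/-- The completely positive map
`Φ_i(A) = Tr_{B_i}((1 ⊗ ρ_{B_i}) H_{SB_i} (A ⊗ 1) H_{SB_i})`. -/
def Φ (i : Fin n) : SuperOp m.LS where
  toFun A := partialTraceRight
    (((1 : FockOp m.LS) ⊗ₖ m.bathState i) * m.HSB i * (A ⊗ₖ (1 : FockOp (m.LB i))) * m.HSB i)
  map_add' A B := by
    ext a b
    simp [partialTraceRight, Matrix.add_kronecker, mul_add, add_mul, Finset.sum_add_distrib]
  map_smul' c A := by
    ext a b
    simp [partialTraceRight, Matrix.smul_kronecker, Finset.mul_sum]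

/-- The generator (in the Heisenberg picture)
`ℒ(A) = i[H_S, A] + ∑ i, (Φ_i(A) - (1/2){Φ_i(1), A})`. -/
def lindbladian : SuperOp m.LS :=
  Complex.I • (LinearMap.mulLeft ℂ m.HS - LinearMap.mulRight ℂ m.HS) +
    ∑ i, (m.Φ i - (1 / 2 : ℂ) •
      (LinearMap.mulLeft ℂ (m.Φ i 1) + LinearMap.mulRight ℂ (m.Φ i 1)))

/-- The operator `-i H_S - (1/2) ∑ i, Φ_i(1)` on the Fock space. -/
def driftOp : FockOp m.LS := (-Complex.I) • m.HS - (1 / 2 : ℂ) • ∑ i, m.Φ i 1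

/-- The deformed generator (in the Heisenberg picture)
`ℒ_α(A) = D^* A + A D + ∑ i, Φ_i(A e^{-α_i K_S}) e^{α_i K_S}` with `D = -i H_S - (1/2) ∑ i, Φ_i(1)`. -/
def deformed (α : Fin n → ℝ) : SuperOp m.LS :=
  LinearMap.mulLeft ℂ (m.driftOp)ᴴ + LinearMap.mulRight ℂ m.driftOp +
    ∑ i, LinearMap.mulRight ℂ (NormedSpace.exp ((α i : ℂ) • m.KS)) ∘ₗ m.Φ i ∘ₗ
      LinearMap.mulRight ℂ (NormedSpace.exp (-(α i : ℂ) • m.KS))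

/-- The deformed generator `ℒ_α^*` in the Schrödinger picture. -/
def deformedDual (α : Fin n → ℝ) : SuperOp m.LS := traceDual (m.deformed α)

/-- `Θ_i Θ_i^*` -/
def ΘΘ (i : Fin n) : PhaseMap m.LS m.LS := m.Θ i * (m.Θ i)ᴴ

/-- `M_{β_i} = (1 + e^{-β_i κ_S})⁻¹` -/
def Mβ (i : Fin n) : PhaseMap m.LS m.LS := (1 + NormedSpace.exp (-(m.β i : ℂ) • m.κS))⁻¹

/-- `e^{α_i κ_S}` -/
def expκ (α : Fin n → ℝ) (i : Fin n) : PhaseMap m.LS m.LS := NormedSpace.exp ((α i : ℂ) • m.κS)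

/-- `Q_{α,β} = ∑ i, Θ_i Θ_i^* M_{β_i} (e^{α_i κ_S} - 1)` -/
def Q (α : Fin n → ℝ) : PhaseMap m.LS m.LS := ∑ i, m.ΘΘ i * m.Mβ i * (m.expκ α i - 1)

/-- `B_{α,β} = ∑ i, e^{α_i κ_S} M_{β_i} Θ_i Θ_i^*` -/
def B (α : Fin n → ℝ) : PhaseMap m.LS m.LS := ∑ i, m.expκ α i * m.Mβ i * m.ΘΘ i

/-- `C_{α,β} = Q_{α,β} - Q_{α,β}^T` -/
def C (α : Fin n → ℝ) : PhaseMap m.LS m.LS := m.Q α - xiTranspose (m.Q α)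

/-- `G_{α,β} = -i T_S - (1/2) ∑ i, Θ_i Θ_i^* - Q_{α,β}` -/
def G (α : Fin n → ℝ) : PhaseMap m.LS m.LS :=
  (-Complex.I) • m.TS - (1 / 2 : ℂ) • ∑ i, m.ΘΘ i - m.Q α

/-- `M` solves the Riccati equation `G M + M G^* + M C M + B = 0`. -/
def SolvesRiccati (α : Fin n → ℝ) (M : PhaseMap m.LS m.LS) : Prop :=
  m.G α * M + M * (m.G α)ᴴ + M * m.C α * M + m.B α = 0

end ThermalModel

end QuasiFree

end

/-! The Wick formula is replaced by one quadratic identity. On two copies of the Fock space put Λ =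
∑ φ(e_k) ⊗ φ(e_k)^* (`ladder`). A state ρ is quasi-free exactly when it is even under parity and ρ ⊗
ρ commutes with Λ (`IsGaussian`). Indeed, pairing the commutator with x ⊗ y gives a bilinear defect;
for x a single generator and y a product of odd length, its vanishing is the expansion of a Pfaffian
along its first row. Conversely this expansion makes every defect vanish.

The KMS condition evaluates the bath trace, and conservation of the pseudo-energy expresses the
result through κ_S. Moving e^{α_i K_S} through a field then shows that ℒ_α^* is ρ ↦ D ρ + ρ D^* + ∑
B_{kl} φ(e_l)^* ρ φ(e_k), with D quadratic and B = B_{α,β} ≥ 0 (`deformedDual_eq`, `B_posSemidef`).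
For such a generator 𝒢, the commutator with Λ intertwines 𝒢 ⊗ 1 + 1 ⊗ 𝒢 with another linear map
(`ladderAd_gen`): doubled quadratic operators commute with Λ, and the jump part changes sign because
the inhomogeneous terms of the two copies cancel. Exponentials are therefore intertwined too, so the
semigroup preserves the identity; it preserves positivity because B ≥ 0. This is part 1.

For part 2, B_{α,β} dominates a positive multiple of B_{0,β}, so positivity improvement passes from
α = 0 to every α (`posDef_lexp_of_posDef_lexp`). The quasi-free states form a compact set, not a
convex one, that is invariant under the normalized flow. A Collatz-Wielandt maximization over this
set needs no convexity and yields a quasi-free Perron eigenvector (`exists_eigenvector_mem`).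
Simplicity and the spectral gap come from a contraction on the kernel of the dual eigenvector
(`eq_zero_of_eigenvector`).

For part 3, the four-point Wick formula computes Tr(𝒢(ρ) φ(e_a)^* φ(e_b)) as a scalar multiple of M
plus the left-hand side of the Riccati equation (`IsGaussian.two_point_gen`). An eigenvector hence
solves the equation. Conversely, if the equation holds, η = 𝒢(ρ) - λρ has vanishing moments of order
0 and 2, and the linearized identity for Λ propagates this to all even moments; parity kills the odd
ones, so η = 0 (`IsGaussian.gen_eq_smul`). -/

noncomputable section
namespace QuasiFree

/-! ### Canonical anticommutation relations and irreducibility of the fields. -/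

section Fock

variable {L : ℕ}

/-- The Jordan-Wigner sign of the mode `i` in the configuration `u`. -/
def jwSign (i : Fin L) (u : Finset (Fin L)) : ℂ := (-1) ^ (u.filter (· < i)).card

theorem jwSign_mul_self (i : Fin L) (u : Finset (Fin L)) : jwSign i u * jwSign i u = 1 := by
  rw [jwSign, ← mul_pow]; simp

theorem jwSign_insert {i j : Fin L} {u : Finset (Fin L)} (hj : j ∉ u) :
    jwSign i (insert j u) = if j < i then -jwSign i u else jwSign i u := by
  unfold jwSign
  rw [Finset.filter_insert]
  split_ifs with h
  · rw [Finset.card_insert_of_notMem (by simp [hj]), pow_succ]; ring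
  · rfl

theorem jwSign_erase {i j : Fin L} {u : Finset (Fin L)} (hj : j ∈ u) :
    jwSign i (u.erase j) = if j < i then -jwSign i u else jwSign i u := by
  have h := jwSign_insert (i := i) (j := j) (u := u.erase j) (by simp)
  rw [Finset.insert_erase hj] at h
  rw [h]
  split_ifs <;> simp

theorem annihilation_mul_apply (i : Fin L) (X : FockOp L) (s u : Finset (Fin L)) :
    (annihilation i * X) s u = if i ∈ s then 0 else jwSign i s * X (insert i s) u := by
  rw [Matrix.mul_apply]
  by_cases h : i ∈ s
  · rw [if_pos h]
    refine Finset.sum_eq_zero fun t _ => ?_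
    have : ¬(i ∈ t ∧ s = t.erase i) := by
      rintro ⟨-, rfl⟩
      simp at h
    simp [annihilation, this]
  · rw [if_neg h, Finset.sum_eq_single (insert i s)]
    · simp [annihilation, h, Finset.filter_insert, jwSign]
    · intro t _ ht
      have : ¬(i ∈ t ∧ s = t.erase i) := by
        rintro ⟨h1, rfl⟩
        exact ht (Finset.insert_erase h1).symm
      simp [annihilation, this]
    · simp

theorem creation_mul_apply (i : Fin L) (X : FockOp L) (s u : Finset (Fin L)) :
    (creation i * X) s u = if i ∈ s then jwSign i s * X (s.erase i) u else 0 := by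
  rw [Matrix.mul_apply]
  by_cases h : i ∈ s
  · rw [if_pos h, Finset.sum_eq_single (s.erase i)]
    · simp [creation, annihilation, h, jwSign]
    · intro t _ ht
      simp [creation, annihilation, ht]
    · simp
  · rw [if_neg h]
    exact Finset.sum_eq_zero fun t _ => by simp [creation, annihilation, h]

theorem annihilation_mul_annihilation (i j : Fin L) :
    (annihilation i * annihilation j + annihilation j * annihilation i : FockOp L) = 0 := by
  have h : ∀ i j : Fin L, i < j →
      (annihilation i * annihilation j + annihilation j * annihilation i : FockOp L) = 0 := by
    intro i j hij
    rw [← mul_one (annihilation j), ← mul_one (annihilation i)]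
    simp only [mul_assoc, one_mul]
    ext s u
    simp only [Matrix.add_apply, annihilation_mul_apply, Matrix.zero_apply, Finset.mem_insert,
      hij.ne, hij.ne', false_or]
    by_cases hi : i ∈ s <;> by_cases hj : j ∈ s <;> simp [hi, hj]
    rw [jwSign_insert hi, jwSign_insert hj, if_pos hij, if_neg hij.not_gt, Finset.insert_comm]
    ring
  rcases lt_trichotomy i j with hij | rfl | hij
  · exact h i j hij
  · rw [← mul_one (annihilation i)]
    simp only [mul_assoc, one_mul]
    ext s u
    simp only [Matrix.add_apply, annihilation_mul_apply, Matrix.zero_apply]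
    simp
  · rw [add_comm]; exact h j i hij

theorem creation_mul_creation (i j : Fin L) :
    (creation i * creation j + creation j * creation i : FockOp L) = 0 := by
  have h := congrArg Matrix.conjTranspose (annihilation_mul_annihilation j i)
  simpa [creation] using h

theorem annihilation_mul_creation (i j : Fin L) :
    (annihilation i * creation j + creation j * annihilation i : FockOp L) =
      if i = j then 1 else 0 := by
  rw [← mul_one (annihilation i), ← mul_one (creation j)]
  simp only [mul_assoc, one_mul]
  ext s u
  simp only [Matrix.add_apply, annihilation_mul_apply, creation_mul_apply]
  by_cases hij : i = j
  · subst hij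
    by_cases hi : i ∈ s
    · simp only [hi, if_true, zero_add, Finset.mem_erase, ne_eq, not_true, false_and, if_false]
      rw [← mul_assoc, jwSign_erase hi, if_neg (lt_irrefl i), jwSign_mul_self, one_mul,
        Finset.insert_erase hi]
    · simp only [hi, if_false, if_true, add_zero, Finset.mem_insert, true_or]
      rw [← mul_assoc, jwSign_insert hi, if_neg (lt_irrefl i), jwSign_mul_self, one_mul,
        Finset.erase_insert hi]
  · have hji : ¬ j = i := fun h => hij h.symm
    by_cases hi : i ∈ s <;> by_cases hj : j ∈ s <;> simp [hi, hj, hij, hji]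
    rw [jwSign_insert hi, jwSign_erase hj, Finset.erase_insert_of_ne hij]
    rcases lt_or_gt_of_ne hij with h | h
    · rw [if_pos h, if_neg h.not_gt]; ring
    · rw [if_pos h, if_neg h.not_gt]; ring

theorem field_conjTranspose (k : Fin L ⊕ Fin L) : (field k : FockOp L)ᴴ = field k.swap := by
  cases k <;> simp [field, creation]

theorem field_anticomm (k l : Fin L ⊕ Fin L) :
    (field k * field l + field l * field k : FockOp L) = if k = l.swap then 1 else 0 := by
  rcases k with i | i <;> rcases l with j | j
  · simpa [field] using creation_mul_creation i j
  · rw [add_comm]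
    simpa [field, eq_comm] using annihilation_mul_creation j i
  · simpa [field] using annihilation_mul_creation i j
  · simpa [field] using annihilation_mul_annihilation i j

theorem parity_mul_self : (parity L * parity L : FockOp L) = 1 := by
  rw [parity, Matrix.diagonal_mul_diagonal, ← Matrix.diagonal_one]
  congr 1; ext u
  rw [← mul_pow]; simp

theorem parity_conjTranspose : (parity L)ᴴ = parity L := by
  rw [parity, Matrix.diagonal_conjTranspose]
  congr 1; ext u
  simp

theorem parity_mul_annihilation (i : Fin L) :
    parity L * annihilation i = -(annihilation i * parity L) := by
  ext s u
  rw [parity, Matrix.diagonal_mul, Matrix.neg_apply, Matrix.mul_diagonal]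
  by_cases h : i ∈ u ∧ s = u.erase i
  · obtain ⟨h1, rfl⟩ := h
    have h2 := Finset.card_erase_add_one h1
    rw [← h2, pow_succ]; ring
  · simp [annihilation, h]

theorem parity_mul_field (k : Fin L ⊕ Fin L) :
    parity L * field k = -(field k * parity L) := by
  rcases k with i | i
  · have h := congrArg Matrix.conjTranspose (parity_mul_annihilation i)
    rw [Matrix.conjTranspose_mul, Matrix.conjTranspose_neg, Matrix.conjTranspose_mul,
      parity_conjTranspose] at h
    rw [field, creation, h, neg_neg]
  · exact parity_mul_annihilation i

/-- The matrix units lie in the algebra generated by the fields. -/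
theorem single_mem_adjoin (s t : Finset (Fin L)) :
    (Matrix.single s t 1 : FockOp L) ∈ Algebra.adjoin ℂ (Set.range (field (L := L))) := by
  set S := Algebra.adjoin ℂ (Set.range (field (L := L)))
  have hf : ∀ k, field k ∈ S := fun k => Algebra.subset_adjoin ⟨k, rfl⟩
  -- The projection onto |t⟩ is a product over the modes of the number operator c_i^* c_i or its
  -- complement; the induction multiplies these factors one mode at a time.
  have hdiag : (Matrix.single t t 1 : FockOp L) ∈ S := by
    have key : ∀ w : Finset (Fin L),
        (Matrix.diagonal fun u => if ∀ i ∈ w, (i ∈ u ↔ i ∈ t) then 1 else 0 : FockOp L) ∈ S := by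
      intro w
      induction w using Finset.induction_on with
      | empty => simp [S.one_mem]
      | insert i w hi ih =>
        have hn : (Matrix.diagonal fun u => if i ∈ u then 1 else 0 : FockOp L) ∈ S := by
          have : (Matrix.diagonal fun u => if i ∈ u then 1 else 0 : FockOp L) =
              creation i * annihilation i := by
            rw [← mul_one (annihilation i)]
            ext s u
            rw [creation_mul_apply, annihilation_mul_apply]
            by_cases h : i ∈ s
            · simp only [h, if_true, Finset.mem_erase, ne_eq, not_true, false_and, if_false]
              rw [← mul_assoc, jwSign_erase h, if_neg (lt_irrefl i), jwSign_mul_self, one_mul,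
                Finset.insert_erase h]
              by_cases hu : s = u
              · subst hu; simp [h]
              · simp [hu]
            · by_cases hu : s = u
              · subst hu; simp [h]
              · simp [hu, h]
          rw [this]
          exact S.mul_mem (hf (Sum.inl i)) (hf (Sum.inr i))
        have hi' : (Matrix.diagonal fun u => if i ∈ u ↔ i ∈ t then 1 else 0 : FockOp L) ∈ S := by
          by_cases h : i ∈ t
          · simpa [h] using hn
          · have := S.sub_mem S.one_mem hn
            convert this using 1
            rw [← Matrix.diagonal_one, Matrix.diagonal_sub]
            congr 1; ext u
            by_cases hu : i ∈ u <;> simp [h, hu]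
        convert S.mul_mem hi' ih using 1
        rw [Matrix.diagonal_mul_diagonal]
        congr 1; ext u
        simp only [Finset.forall_mem_insert, ite_and, mul_ite, mul_one, mul_zero]
        by_cases h1 : (i ∈ u ↔ i ∈ t) <;> simp [h1]
    convert key Finset.univ using 1
    ext s u
    by_cases hsu : s = u
    · subst hsu
      by_cases hst : s = t
      · subst hst; simp
      · have : ¬ ∀ i, (i ∈ s ↔ i ∈ t) := fun h => hst (Finset.ext h)
        simp [this, Ne.symm hst]
    · rw [Matrix.diagonal_apply_ne _ hsu, Matrix.single_apply, if_neg]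
      rintro ⟨rfl, rfl⟩; exact hsu rfl
  have hins : ∀ (s : Finset (Fin L)) (i : Fin L), i ∉ s →
      (creation i * Matrix.single s t 1 : FockOp L) =
        jwSign i s • Matrix.single (insert i s) t 1 := by
    intro s i his
    ext a b
    rw [creation_mul_apply]
    by_cases hia : i ∈ a
    · by_cases h : a = insert i s
      · subst h
        simp [Finset.erase_insert his, jwSign_insert his, Matrix.single_apply]
      · have h2 : ¬ s = a.erase i := by
          rintro rfl; exact h (Finset.insert_erase hia).symm
        simp [hia, h2, Ne.symm h]
    · have h2 : ¬ insert i s = a := by rintro rfl; simp at hia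
      simp [hia, h2]
  have herase : ∀ (s : Finset (Fin L)) (i : Fin L), i ∈ s →
      (annihilation i * Matrix.single s t 1 : FockOp L) =
        jwSign i s • Matrix.single (s.erase i) t 1 := by
    intro s i his
    ext a b
    rw [annihilation_mul_apply]
    by_cases hia : i ∈ a
    · have h2 : ¬ s.erase i = a := by rintro rfl; simp at hia
      simp [hia, h2]
    · by_cases h : s = insert i a
      · subst h
        simp [hia, Finset.erase_insert hia, jwSign_insert hia, Matrix.single_apply]
      · have h2 : ¬ s.erase i = a := by
          rintro rfl; exact h (Finset.insert_erase his).symm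
        simp [hia, h2, h]
  have cancel : ∀ (c : ℂ) (X : FockOp L), c * c = 1 → c • X ∈ S → X ∈ S := by
    intro c X hc hX
    have := S.smul_mem hX c
    rwa [smul_smul, hc, one_smul] at this
  -- Annihilation operators first empty the configuration t down to the vacuum; creation operators
  -- then fill it up to s.
  have hempty : ∀ u ⊆ t, (Matrix.single (t \ u) t 1 : FockOp L) ∈ S := by
    intro u
    induction u using Finset.induction_on with
    | empty => intro _; simpa using hdiag
    | insert i u hi ih =>
      intro hu
      have h1 := ih ((Finset.subset_insert i u).trans hu)
      have h2 : i ∈ t \ u := by simp [hi, hu (Finset.mem_insert_self i u)]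
      have h3 := S.mul_mem (hf (Sum.inr i)) h1
      rw [field, herase _ _ h2] at h3
      have := cancel _ _ (jwSign_mul_self _ _) h3
      rwa [← Finset.sdiff_insert] at this
  induction s using Finset.induction_on with
  | empty => simpa using hempty t subset_rfl
  | insert i s hi ih =>
    have h3 := S.mul_mem (hf (Sum.inl i)) ih
    rw [field, hins _ _ hi] at h3
    exact cancel _ _ (jwSign_mul_self _ _) h3

theorem adjoin_field_eq_top : Algebra.adjoin ℂ (Set.range (field (L := L))) = ⊤ := by
  rw [eq_top_iff]
  intro X _
  rw [Matrix.matrix_eq_sum_single X]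
  refine Subalgebra.sum_mem _ fun i _ => Subalgebra.sum_mem _ fun j _ => ?_
  have : Matrix.single i j (X i j) = X i j • (Matrix.single i j 1 : FockOp L) := by simp
  rw [this]
  exact Subalgebra.smul_mem _ (single_mem_adjoin i j) _

end Fock

end QuasiFree
end

noncomputable section
namespace QuasiFree

/-! ### Pairings and the expansion of a Pfaffian along its first row. -/

section Pairings

open Equiv

theorem fstPos_zero (m : ℕ) : fstPos (0 : Fin (m + 1)) = 0 := rfl

theorem sndPos_zero (m : ℕ) : sndPos (0 : Fin (m + 1)) = Fin.succ 0 := rfl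

theorem fstPos_succ {m : ℕ} (l : Fin m) : fstPos l.succ = (fstPos l).succ.succ := rfl

theorem sndPos_succ {m : ℕ} (l : Fin m) : sndPos l.succ = (sndPos l).succ.succ := rfl

/-- The permutation that pairs `0` with `k + 1` and the other points as `σ` does. -/
def extendPairing {m : ℕ} (k : Fin (2 * m + 1)) (σ : Perm (Fin (2 * m))) :
    Perm (Fin (2 * (m + 1))) :=
  Perm.decomposeFin.symm
    ((0 : Fin (2 * m + 2)), (k.cycleRange.symm * Perm.decomposeFin.symm (0, σ) : Perm (Fin (2 * m + 1))))

variable {m : ℕ} (k : Fin (2 * m + 1)) (σ : Perm (Fin (2 * m)))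

theorem extendPairing_zero : extendPairing k σ (0 : Fin (2 * m + 2)) = (0 : Fin (2 * m + 2)) := by
  simp [extendPairing]

theorem extendPairing_one :
    extendPairing k σ (Fin.succ (0 : Fin (2 * m + 1))) = (Fin.succ k : Fin (2 * m + 2)) := by
  refine (Perm.decomposeFin_symm_apply_succ _ _ _).trans ?_
  rw [Equiv.swap_self, Equiv.refl_apply, Perm.mul_apply, Perm.decomposeFin_symm_apply_zero,
    Fin.cycleRange_symm_zero]

theorem extendPairing_succ_succ (j : Fin (2 * m)) :
    extendPairing k σ (j.succ.succ : Fin (2 * m + 2)) =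
      (Fin.succ (k.succAbove (σ j)) : Fin (2 * m + 2)) := by
  refine (Perm.decomposeFin_symm_apply_succ _ _ _).trans ?_
  rw [Equiv.swap_self, Equiv.refl_apply, Perm.mul_apply, Perm.decomposeFin_symm_apply_succ,
    Equiv.swap_self, Equiv.refl_apply, Fin.cycleRange_symm_succ]

/-- Adjoining a fixed point does not change the sign, and the cycle on {0, …, k} has length k + 1,
hence sign (-1)^k. -/
theorem sign_extendPairing :
    ((Perm.sign (extendPairing k σ) : ℤ) : ℂ) = (-1) ^ (k : ℕ) * ((Perm.sign σ : ℤ) : ℂ) := by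
  have h : Perm.sign (extendPairing k σ) = (-1) ^ (k : ℕ) * Perm.sign σ := by
    refine (Perm.decomposeFin.symm_sign _ _).trans ?_
    rw [if_pos rfl, one_mul, Perm.sign_mul, Perm.decomposeFin.symm_sign, if_pos rfl, one_mul,
      Perm.sign_symm, Fin.sign_cycleRange]
  rw [h]
  push_cast
  ring

/-- The old points are relabelled by the increasing map `Fin.succ ∘ k.succAbove`, which respects
both order conditions, and the new pair starts with the smallest point. -/
theorem extendPairing_mem_iff : extendPairing k σ ∈ pairings (m + 1) ↔ σ ∈ pairings m := by
  classical
  simp only [pairings, Finset.mem_filter, Finset.mem_univ, true_and]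
  have hlt : ∀ a b : Fin (2 * m),
      (Fin.succ (k.succAbove a) : Fin (2 * m + 2)) < Fin.succ (k.succAbove b) ↔ a < b := by
    intro a b
    rw [Fin.succ_lt_succ_iff, (Fin.strictMono_succAbove k).lt_iff_lt]
  constructor
  · rintro ⟨h1, h2⟩
    refine ⟨fun l => ?_, fun l l' hl => ?_⟩
    · have := h1 l.succ
      rw [fstPos_succ, sndPos_succ, extendPairing_succ_succ, extendPairing_succ_succ] at this
      exact (hlt _ _).1 this
    · have := h2 l.succ l'.succ (Fin.succ_lt_succ_iff.2 hl)
      rw [fstPos_succ, fstPos_succ, extendPairing_succ_succ, extendPairing_succ_succ] at this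
      exact (hlt _ _).1 this
  · rintro ⟨h1, h2⟩
    refine ⟨fun l => ?_, fun l l' hl => ?_⟩
    · refine Fin.cases ?_ (fun l => ?_) l
      · rw [fstPos_zero, sndPos_zero]
        refine lt_of_eq_of_lt (extendPairing_zero k σ) (lt_of_lt_of_eq ?_ (extendPairing_one k σ).symm)
        exact Fin.succ_pos k
      · rw [fstPos_succ, sndPos_succ, extendPairing_succ_succ, extendPairing_succ_succ]
        exact (hlt _ _).2 (h1 l)
    · obtain ⟨l', rfl⟩ := Fin.exists_succ_eq.2 (Fin.ne_zero_of_lt hl)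
      revert hl
      refine Fin.cases (fun _ => ?_) (fun l hl => ?_) l
      · rw [fstPos_zero, fstPos_succ, extendPairing_succ_succ]
        exact lt_of_eq_of_lt (extendPairing_zero k σ) (Fin.succ_pos _)
      · rw [fstPos_succ, fstPos_succ, extendPairing_succ_succ, extendPairing_succ_succ]
        exact (hlt _ _).2 (h2 l l' (Fin.succ_lt_succ_iff.1 hl))

theorem extendPairing_injective :
    Function.Injective fun p : Fin (2 * m + 1) × Perm (Fin (2 * m)) => extendPairing p.1 p.2 := by
  rintro ⟨k, σ⟩ ⟨k', σ'⟩ h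
  replace h : extendPairing k σ = extendPairing k' σ' := h
  have hk : k = k' := by
    have := congrArg (fun τ : Perm (Fin (2 * m + 2)) => τ (Fin.succ 0)) h
    exact Fin.succ_injective _
      ((extendPairing_one k σ).symm.trans (this.trans (extendPairing_one k' σ')))
  subst hk
  have h1 := Perm.decomposeFin.symm.injective h
  rw [Prod.mk.injEq, mul_right_inj] at h1
  have h2 := Perm.decomposeFin.symm.injective h1.2
  rw [Prod.mk.injEq] at h2
  rw [h2.2]

theorem exists_extendPairing_eq {τ : Perm (Fin (2 * (m + 1)))} (hτ : τ ∈ pairings (m + 1)) :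
    ∃ k σ, extendPairing k σ = τ := by
  classical
  simp only [pairings, Finset.mem_filter, Finset.mem_univ, true_and] at hτ
  obtain ⟨h1, h2⟩ := hτ
  -- The value 0 can sit neither in the second place of a pair nor at the head of a later pair,
  -- since each of these is preceded by a strictly smaller value.
  have h0 : τ (0 : Fin (2 * m + 2)) = (0 : Fin (2 * m + 2)) := by
    obtain ⟨x, hx⟩ := τ.surjective (0 : Fin (2 * m + 2))
    have hlt : (x : ℕ) / 2 < m + 1 := by omega
    rcases Nat.even_or_odd' (x : ℕ) with ⟨c, hc | hc⟩
    · have hxe : x = fstPos (⟨x / 2, hlt⟩ : Fin (m + 1)) := by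
        ext; simp only [fstPos]; omega
      by_cases hz : (⟨x / 2, hlt⟩ : Fin (m + 1)) = 0
      · rw [hz, fstPos_zero] at hxe
        rw [hxe] at hx
        exact hx
      · have := h2 0 _ (Fin.pos_of_ne_zero hz)
        rw [← hxe, hx] at this
        exact absurd this (Fin.not_lt_zero _)
    · have hxe : x = sndPos (⟨x / 2, hlt⟩ : Fin (m + 1)) := by
        ext; simp only [sndPos]; omega
      have := h1 ⟨x / 2, hlt⟩
      rw [← hxe, hx] at this
      exact absurd this (Fin.not_lt_zero _)
  obtain ⟨⟨p, r⟩, hr⟩ := (Perm.decomposeFin (n := 2 * m + 1)).symm.surjective τ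
  have hp : p = 0 := by
    have := Perm.decomposeFin_symm_apply_zero p r
    rw [hr] at this
    exact this.symm.trans h0
  subst hp
  -- The partner of 0 is encoded by r 0; undoing its cycle leaves a permutation that fixes 0 and so
  -- descends to the remaining points.
  obtain ⟨⟨q, σ⟩, hσ⟩ := (Perm.decomposeFin (n := 2 * m)).symm.surjective ((r 0).cycleRange * r)
  have hq : q = 0 := by
    have := Perm.decomposeFin_symm_apply_zero q σ
    rw [hσ, Perm.mul_apply, Fin.cycleRange_self] at this
    exact this.symm
  subst hq
  refine ⟨r 0, σ, ?_⟩
  rw [extendPairing, hσ, ← mul_assoc]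
  have : ((r 0).cycleRange.symm * (r 0).cycleRange : Perm (Fin (2 * m + 1))) = 1 :=
    inv_mul_cancel (r 0).cycleRange
  rw [this, one_mul, hr]

/-- The signed sum over pairings (Pfaffian) of a scheme of coefficients. -/
def pairingSum (m : ℕ) (A : Fin (2 * m) → Fin (2 * m) → ℂ) : ℂ :=
  ∑ σ ∈ pairings m, ((Perm.sign σ : ℤ) : ℂ) * ∏ l : Fin m, A (σ (fstPos l)) (σ (sndPos l))

theorem pairingSum_zero (A : Fin (2 * 0) → Fin (2 * 0) → ℂ) : pairingSum 0 A = 1 := by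
  classical
  have : pairings 0 = {1} := by
    ext σ
    simp only [pairings, Finset.mem_filter, Finset.mem_univ, true_and, IsEmpty.forall_iff,
      Finset.mem_singleton, true_iff]
    ext x
    exact x.elim0
  simp [pairingSum, this]

/-- Expansion of a signed sum over pairings with respect to the partner of the first point. -/
theorem pairingSum_succ (A : Fin (2 * (m + 1)) → Fin (2 * (m + 1)) → ℂ) :
    pairingSum (m + 1) A = ∑ k : Fin (2 * m + 1), (-1) ^ (k : ℕ) *
      A (0 : Fin (2 * m + 2)) (Fin.succ k : Fin (2 * m + 2)) *
        pairingSum m fun a b =>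
          A (Fin.succ (k.succAbove a) : Fin (2 * m + 2)) (Fin.succ (k.succAbove b) : Fin (2 * m + 2)) := by
  unfold pairingSum
  simp only [Finset.mul_sum]
  rw [← Finset.sum_product']
  symm
  refine Finset.sum_bij (fun p _ => extendPairing p.1 p.2) ?_ ?_ ?_ ?_
  · rintro ⟨k, σ⟩ h
    rw [Finset.mem_product] at h
    exact (extendPairing_mem_iff k σ).2 h.2
  · intro p _ q _ h
    exact extendPairing_injective h
  · intro τ hτ
    obtain ⟨k, σ, rfl⟩ := exists_extendPairing_eq hτ
    exact ⟨(k, σ), Finset.mem_product.2 ⟨Finset.mem_univ _, (extendPairing_mem_iff k σ).1 hτ⟩, rfl⟩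
  · rintro ⟨k, σ⟩ -
    rw [sign_extendPairing, Fin.prod_univ_succ]
    have h0 : A (extendPairing k σ (fstPos 0)) (extendPairing k σ (sndPos 0)) =
        A (0 : Fin (2 * m + 2)) (Fin.succ k : Fin (2 * m + 2)) :=
      congrArg₂ A (extendPairing_zero k σ) (extendPairing_one k σ)
    rw [h0]
    simp only [fstPos_succ, sndPos_succ, extendPairing_succ_succ]
    ring

end Pairings

end QuasiFree
end

/-! ### Wick recursion for functionals on an algebra with anticommutation relations. -/

noncomputable section
namespace QuasiFree

/-- The ordered product `g (y 0) * ⋯ * g (y (n - 1))`. -/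
def orderedProd {R ι : Type*} [Monoid R] (g : ι → R) {n : ℕ} (y : Fin n → ι) : R :=
  (List.ofFn fun k => g (y k)).prod

theorem orderedProd_zero {R ι : Type*} [Monoid R] (g : ι → R) (y : Fin 0 → ι) :
    orderedProd g y = 1 := by
  simp [orderedProd]

theorem orderedProd_succ {R ι : Type*} [Monoid R] (g : ι → R) {n : ℕ} (y : Fin (n + 1) → ι) :
    orderedProd g y = g (y 0) * orderedProd g (fun k => y k.succ) := by
  simp [orderedProd, List.ofFn_succ]

theorem orderedProd_one {R ι : Type*} [Monoid R] (g : ι → R) (y : Fin 1 → ι) :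
    orderedProd g y = g (y 0) := by
  rw [orderedProd_succ, orderedProd_zero, mul_one]

theorem span_range_orderedProd {R ι : Type*} [Ring R] [Algebra ℂ R] (g : ι → R)
    (hg : Algebra.adjoin ℂ (Set.range g) = ⊤) :
    Submodule.span ℂ {x : R | ∃ (n : ℕ) (y : Fin n → ι), x = orderedProd g y} = ⊤ := by
  rw [eq_top_iff, ← Algebra.top_toSubmodule, ← hg, Algebra.adjoin_eq_span]
  refine Submodule.span_mono fun x hx => ?_
  obtain ⟨l, hl, rfl⟩ := Submonoid.exists_list_of_mem_closure hx
  choose f hf using fun k => hl (l.get k) (List.get_mem l k)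
  refine ⟨l.length, f, ?_⟩
  rw [orderedProd]
  congr 1
  conv_lhs => rw [← List.ofFn_get l]
  congr 1
  ext k
  exact (hf k).symm

/-- The families `g` that satisfy anticommutation relations `{g k, g l} = c δ_{k, bar l}`. -/
structure IsAnticommFamily {R ι : Type*} [Ring R] [Algebra ℂ R] [DecidableEq ι] (g : ι → R)
    (bar : ι → ι) (c : ℂ) : Prop where
  bar_bar : ∀ i, bar (bar i) = i
  anticomm : ∀ k l, g k * g l + g l * g k = (if k = bar l then c else 0) • (1 : R)

namespace IsAnticommFamily

variable {R ι : Type*} [Ring R] [Algebra ℂ R] [DecidableEq ι] {g : ι → R} {bar : ι → ι} {c : ℂ}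

theorem eq_bar_iff (h : IsAnticommFamily g bar c) {i j : ι} : i = bar j ↔ j = bar i :=
  ⟨fun e => by rw [e, h.bar_bar], fun e => by rw [e, h.bar_bar]⟩

theorem mul_comm_sub (h : IsAnticommFamily g bar c) (k l : ι) :
    g k * g l = (if k = bar l then c else 0) • (1 : R) - g l * g k :=
  eq_sub_of_add_eq (h.anticomm k l)

/-- Moving a generator through an ordered product. -/
theorem mul_orderedProd (h : IsAnticommFamily g bar c) (i : ι) {n : ℕ} (y : Fin (n + 1) → ι) :
    g i * orderedProd g y = (-1 : ℂ) ^ (n + 1) • (orderedProd g y * g i) +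
      ∑ k : Fin (n + 1), ((-1) ^ (k : ℕ) * if i = bar (y k) then c else 0) •
        orderedProd g (fun j => y (k.succAbove j)) := by
  induction n with
  | zero =>
    rw [orderedProd_one, h.mul_comm_sub i]
    simp [orderedProd_zero]
    abel
  | succ n ih =>
    rw [orderedProd_succ, ← mul_assoc, h.mul_comm_sub, sub_mul, mul_assoc, ih]
    conv_rhs => rw [Fin.sum_univ_succ]
    simp only [Fin.succAbove_zero, Fin.val_zero, pow_zero, one_mul, smul_mul_assoc]
    have : ∀ k : Fin (n + 1), orderedProd g (fun j => y (k.succ.succAbove j)) =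
        g (y 0) * orderedProd g (fun j => y (k.succAbove j).succ) := by
      intro k
      rw [orderedProd_succ]
      simp only [Fin.succ_succAbove_zero, Fin.succ_succAbove_succ]
    simp only [this]
    rw [mul_add, Finset.mul_sum]
    simp only [mul_smul_comm, Fin.val_succ, pow_succ, mul_assoc, neg_mul, mul_neg, neg_smul,
      Finset.sum_neg_distrib, mul_one]
    abel

variable [Fintype ι]

/-- The bilinear defect `∑ i, f(g_i x) h(g_ī y) - f(x g_i) h(y g_ī)`. -/
def defect (g : ι → R) (bar : ι → ι) (f h : R →ₗ[ℂ] ℂ) (x y : R) : ℂ :=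
  ∑ i, (f (g i * x) * h (g (bar i) * y) - f (x * g i) * h (y * g (bar i)))

/-- Moving g_i past g_j and past the product of odd length n + 1 produces two reordered terms that
cancel; what is left carries Kronecker deltas that collapse the sum over i. The functionals f and h
are kept distinct so that the identity can also be used in linearized form. -/
theorem defect_gen_orderedProd (hg : IsAnticommFamily g bar c) (f h : R →ₗ[ℂ] ℂ) (j : ι) {n : ℕ}
    (hn : Even n) (y : Fin (n + 1) → ι) :
    defect g bar f h (g j) (orderedProd g y) = c * (f 1 * h (g j * orderedProd g y) -
      ∑ k : Fin (n + 1), (-1) ^ (k : ℕ) * f (g j * g (y k)) *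
        h (orderedProd g fun l => y (k.succAbove l))) := by
  have hodd : (-1 : ℂ) ^ (n + 1) = -1 := (hn.add_one).neg_one_pow
  have h1 : ∀ i, f (g i * g j) * h (g (bar i) * orderedProd g y) -
      f (g j * g i) * h (orderedProd g y * g (bar i)) =
      (if i = bar j then c * f 1 * h (g (bar i) * orderedProd g y) else 0) -
      ∑ k : Fin (n + 1), if i = y k then c * ((-1) ^ (k : ℕ) * f (g j * g i) *
        h (orderedProd g fun l => y (k.succAbove l))) else 0 := by
    intro i
    have h2 : f (g i * g j) = (if i = bar j then c else 0) * f 1 - f (g j * g i) := by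
      rw [hg.mul_comm_sub i j, map_sub, map_smul, smul_eq_mul]
    have h3 : h (orderedProd g y * g (bar i)) = -h (g (bar i) * orderedProd g y) +
        ∑ k : Fin (n + 1), ((-1) ^ (k : ℕ) * if i = y k then c else 0) *
          h (orderedProd g fun l => y (k.succAbove l)) := by
      rw [hg.mul_orderedProd (bar i) y, hodd]
      have : ∀ k, (bar i = bar (y k)) = (i = y k) := fun k =>
        propext ⟨fun e => by rw [← hg.bar_bar i, e, hg.bar_bar], fun e => by rw [e]⟩
      simp only [this, map_add, map_smul, map_sum, smul_eq_mul]
      ring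
    rw [h2, h3, mul_add, Finset.mul_sum]
    have h4 : ∀ k : Fin (n + 1), f (g j * g i) * (((-1) ^ (k : ℕ) * if i = y k then c else 0) *
        h (orderedProd g fun l => y (k.succAbove l))) =
        if i = y k then c * ((-1) ^ (k : ℕ) * f (g j * g i) *
        h (orderedProd g fun l => y (k.succAbove l))) else 0 := by
      intro k
      split_ifs <;> ring
    rw [Finset.sum_congr rfl fun k _ => h4 k]
    split_ifs <;> ring
  rw [defect, Finset.sum_congr rfl fun i _ => h1 i, Finset.sum_sub_distrib, Finset.sum_comm]
  simp only [Finset.sum_ite_eq', Finset.mem_univ, if_true, hg.bar_bar]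
  rw [← Finset.mul_sum]
  ring

/-- The recursion for the moments of a functional that follows from the vanishing of its defect. -/
theorem wick_recursion (hg : IsAnticommFamily g bar c) (hc : c ≠ 0) {f : R →ₗ[ℂ] ℂ} (hf : f 1 = 1)
    (hd : ∀ x y, defect g bar f f x y = 0) (j : ι) {n : ℕ} (hn : Even n) (y : Fin (n + 1) → ι) :
    f (g j * orderedProd g y) = ∑ k : Fin (n + 1), (-1) ^ (k : ℕ) * f (g j * g (y k)) *
      f (orderedProd g fun l => y (k.succAbove l)) := by
  have h := hd (g j) (orderedProd g y)
  rw [hg.defect_gen_orderedProd f f j hn y, mul_eq_zero, or_iff_right hc, hf, one_mul] at h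
  exact sub_eq_zero.1 h

/-- Functionals that satisfy the Wick recursion have vanishing defect on ordered products. -/
theorem defect_orderedProd (hg : IsAnticommFamily g bar c) {f : R →ₗ[ℂ] ℂ} (hf : f 1 = 1)
    (hodd : ∀ (n : ℕ) (y : Fin n → ι), Odd n → f (orderedProd g y) = 0)
    (hrec : ∀ (j : ι) (n : ℕ) (y : Fin (n + 1) → ι), Even n →
      f (g j * orderedProd g y) = ∑ k : Fin (n + 1), (-1) ^ (k : ℕ) * f (g j * g (y k)) *
        f (orderedProd g fun l => y (k.succAbove l)))
    {n m : ℕ} (x : Fin n → ι) (y : Fin m → ι) :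
    defect g bar f f (orderedProd g x) (orderedProd g y) = 0 := by
  have hswap : ∀ (i : ι) {n : ℕ} (y : Fin (n + 1) → ι),
      f (orderedProd g y * g i) = (-1) ^ (n + 1) * (f (g i * orderedProd g y) -
        ∑ k : Fin (n + 1), ((-1) ^ (k : ℕ) * if i = bar (y k) then c else 0) *
          f (orderedProd g fun l => y (k.succAbove l))) := by
    intro i n y
    rw [hg.mul_orderedProd i y]
    simp only [map_add, map_smul, map_sum, smul_eq_mul]
    rw [add_sub_cancel_right, ← mul_assoc, ← pow_add, Even.neg_one_pow ⟨n + 1, rfl⟩, one_mul]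
  have hleft : ∀ (i : ι) {n : ℕ} (y : Fin n → ι), Even n → f (g i * orderedProd g y) = 0 := by
    intro i n y hn
    have := hodd (n + 1) (Fin.cons i y) hn.add_one
    rw [orderedProd_succ] at this
    simpa using this
  have hright : ∀ (i : ι) {n : ℕ} (y : Fin n → ι), Even n → f (orderedProd g y * g i) = 0 := by
    intro i n y hn
    cases n with
    | zero => rw [orderedProd_zero, one_mul]; simpa [orderedProd_zero] using hleft i y hn
    | succ n =>
      rw [hswap, hleft i y hn, Finset.sum_eq_zero, sub_zero, mul_zero]
      intro k _
      rw [hodd n _ (by rwa [← Nat.not_even_iff_odd, ← Nat.even_add_one]), mul_zero]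
  -- If one of the two words has even length, adding a generator makes it odd and every summand
  -- contains a vanishing odd moment. Only two odd words remain.
  rcases Nat.even_or_odd n with hn | hn
  · exact Finset.sum_eq_zero fun i _ => by rw [hleft i x hn, hright i x hn]; ring
  rcases Nat.even_or_odd m with hm | hm
  · exact Finset.sum_eq_zero fun i _ => by rw [hleft _ y hm, hright _ y hm]; ring
  obtain ⟨n, rfl⟩ : ∃ p, n = p + 1 := ⟨n - 1, by have := hn.pos; omega⟩
  obtain ⟨m, rfl⟩ : ∃ p, m = p + 1 := ⟨m - 1, by have := hm.pos; omega⟩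
  have hn' : Even n := by rwa [← Nat.not_even_iff_odd, Nat.even_add_one, not_not] at hn
  have hm' : Even m := by rwa [← Nat.not_even_iff_odd, Nat.even_add_one, not_not] at hm
  have hcar : ∀ a b, f (g a * g b) = (if a = bar b then c else 0) - f (g b * g a) := by
    intro a b
    rw [hg.mul_comm_sub a b, map_sub, map_smul, hf, smul_eq_mul, mul_one]
  have hR : ∀ (i : ι) {n : ℕ} (y : Fin (n + 1) → ι), Even n → f (orderedProd g y * g i) =
      ∑ k : Fin (n + 1), (-1) ^ (k : ℕ) * f (g (y k) * g i) *
        f (orderedProd g fun l => y (k.succAbove l)) := by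
    intro i n y hn
    rw [hswap, hrec i n y hn, hn.add_one.neg_one_pow, ← Finset.sum_sub_distrib, Finset.mul_sum]
    refine Finset.sum_congr rfl fun k _ => ?_
    rw [hcar i (y k)]
    ring
  -- The defect of two single generators vanishes by the anticommutation relations alone. Expanding
  -- both odd words by the recursion reduces the general defect to a combination of these.
  have key : ∀ a b, ∑ i, f (g i * g a) * f (g (bar i) * g b) =
      ∑ i, f (g a * g i) * f (g b * g (bar i)) := by
    intro a b
    have h1 : ∀ i, f (g i * g a) * f (g (bar i) * g b) = f (g a * g i) * f (g b * g (bar i)) +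
        ((if i = bar a then c * ((if b = bar a then c else 0) - f (g b * g (bar i))) else 0) -
          if i = b then c * f (g a * g i) else 0) := by
      intro i
      have e : (bar i = bar b) = (i = b) :=
        propext ⟨fun e => by rw [← hg.bar_bar i, e, hg.bar_bar], fun e => by rw [e]⟩
      rw [hcar i a, hcar (bar i) b]
      simp only [e]
      by_cases h1 : i = bar a
      · by_cases h2 : i = b
        · subst h2
          simp only [h1, if_true]
          ring
        · have h3 : ¬ b = bar a := fun h => h2 (h1.trans h.symm)
          simp only [h1, if_true, if_false, h3, show ¬ bar a = b from fun h => h3 h.symm]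
          ring
      · by_cases h2 : i = b
        · simp only [h2, if_true, if_false, show ¬ b = bar a from fun h => h1 (h2.trans h)]
          ring
        · simp only [h1, h2, if_false]
          ring
    rw [Finset.sum_congr rfl fun i _ => h1 i, Finset.sum_add_distrib, Finset.sum_sub_distrib]
    simp only [Finset.sum_ite_eq', Finset.mem_univ, if_true, hg.bar_bar]
    rw [hcar b a, hcar a b]
    by_cases h : b = bar a
    · rw [if_pos h, if_pos (hg.eq_bar_iff.1 h)]; ring
    · rw [if_neg h, if_neg (fun e => h (hg.eq_bar_iff.1 e))]; ring
  have hexp : ∀ (a : Fin (n + 1) → ι → ℂ) (b : Fin (m + 1) → ι → ℂ),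
      ∑ i, (∑ k, a k i) * ∑ l, b l i = ∑ k, ∑ l, ∑ i, a k i * b l i := by
    intro a b
    simp only [Finset.sum_mul_sum]
    rw [Finset.sum_comm]
    exact Finset.sum_congr rfl fun k _ => Finset.sum_comm
  rw [defect, Finset.sum_sub_distrib, sub_eq_zero]
  simp only [hrec _ _ _ hn', hrec _ _ _ hm', hR _ _ hn', hR _ _ hm']
  rw [hexp, hexp]
  refine Finset.sum_congr rfl fun k _ => Finset.sum_congr rfl fun l _ => ?_
  have := congrArg (fun z => (-1) ^ (k : ℕ) * (-1) ^ (l : ℕ) *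
    f (orderedProd g fun p => x (k.succAbove p)) *
    f (orderedProd g fun p => y (l.succAbove p)) * z) (key (x k) (y l))
  simp only [Finset.mul_sum] at this
  refine Eq.trans ?_ (this.trans ?_) <;> exact Finset.sum_congr rfl fun i _ => by ring

end IsAnticommFamily

end QuasiFree
end

noncomputable section
namespace QuasiFree

/-! ### Quasi-free states as the Gaussian states. -/

section Gaussian

variable {L : ℕ}

/-- The functional `x ↦ Tr(ρ x)`. -/
def expect (ρ : FockOp L) : FockOp L →ₗ[ℂ] ℂ :=
  (Matrix.traceLinearMap (Finset (Fin L)) ℂ ℂ) ∘ₗ LinearMap.mulLeft ℂ ρ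

theorem expect_apply (ρ x : FockOp L) : expect ρ x = (ρ * x).trace := rfl

theorem isAnticommFamily_field : IsAnticommFamily (field (L := L)) Sum.swap 1 where
  bar_bar := Sum.swap_swap
  anticomm k l := by rw [field_anticomm]; split_ifs <;> simp

theorem isAnticommFamily_majorana : IsAnticommFamily (majorana (L := L)) id 2 where
  bar_bar _ := rfl
  anticomm k l := by
    have hAA := fun i j : Fin L => annihilation_mul_annihilation i j
    have hCC := fun i j : Fin L => creation_mul_creation i j
    have hAC := fun i j : Fin L => annihilation_mul_creation i j
    rcases k with i | i <;> rcases l with j | j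
    · have : (majorana (Sum.inl i) * majorana (Sum.inl j) +
          majorana (Sum.inl j) * majorana (Sum.inl i) : FockOp L) =
          (annihilation i * annihilation j + annihilation j * annihilation i) +
          (creation i * creation j + creation j * creation i) +
          (annihilation i * creation j + creation j * annihilation i) +
          (annihilation j * creation i + creation i * annihilation j) := by
        simp only [majorana]; noncomm_ring
      rw [this, hAA, hCC, hAC, hAC]
      by_cases h : i = j
      · subst h; simp [two_smul]
      · simp [h, Ne.symm h]
    · have : (majorana (Sum.inl i) * majorana (Sum.inr j) +
          majorana (Sum.inr j) * majorana (Sum.inl i) : FockOp L) = (-Complex.I) • (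
          (annihilation i * annihilation j + annihilation j * annihilation i) -
          (creation i * creation j + creation j * creation i) -
          (annihilation i * creation j + creation j * annihilation i) +
          (annihilation j * creation i + creation i * annihilation j)) := by
        simp only [majorana, smul_mul_assoc, mul_smul_comm, ← smul_add]
        congr 1
        noncomm_ring
      rw [this, hAA, hCC, hAC, hAC]
      by_cases h : i = j
      · subst h; simp
      · simp [h, Ne.symm h]
    · have : (majorana (Sum.inr i) * majorana (Sum.inl j) +
          majorana (Sum.inl j) * majorana (Sum.inr i) : FockOp L) = (-Complex.I) • (
          (annihilation i * annihilation j + annihilation j * annihilation i) -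
          (creation i * creation j + creation j * creation i) +
          (annihilation i * creation j + creation j * annihilation i) -
          (annihilation j * creation i + creation i * annihilation j)) := by
        simp only [majorana, smul_mul_assoc, mul_smul_comm, ← smul_add]
        congr 1
        noncomm_ring
      rw [this, hAA, hCC, hAC, hAC]
      by_cases h : i = j
      · subst h; simp
      · simp [h, Ne.symm h]
    · have : (majorana (Sum.inr i) * majorana (Sum.inr j) +
          majorana (Sum.inr j) * majorana (Sum.inr i) : FockOp L) =
          ((-Complex.I) * (-Complex.I)) • (
          (annihilation i * annihilation j + annihilation j * annihilation i) +
          (creation i * creation j + creation j * creation i) -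
          (annihilation i * creation j + creation j * annihilation i) -
          (annihilation j * creation i + creation i * annihilation j)) := by
        simp only [majorana, smul_mul_assoc, mul_smul_comm, smul_smul, ← smul_add]
        congr 1
        noncomm_ring
      rw [this, hAA, hCC, hAC, hAC]
      by_cases h : i = j
      · subst h; simp [two_smul, sub_eq_add_neg]
      · simp [h, Ne.symm h]

theorem adjoin_majorana_eq_top : Algebra.adjoin ℂ (Set.range (majorana (L := L))) = ⊤ := by
  rw [eq_top_iff, ← adjoin_field_eq_top]
  refine Algebra.adjoin_le ?_
  rintro _ ⟨k, rfl⟩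
  set S := Algebra.adjoin ℂ (Set.range (majorana (L := L)))
  have hm : ∀ k, majorana k ∈ S := fun k => Algebra.subset_adjoin ⟨k, rfl⟩
  have hI : ∀ i : Fin L, Complex.I • majorana (Sum.inr i) = annihilation i - creation i := by
    intro i
    rw [majorana, smul_smul]; simp
  have h2 : ∀ X : FockOp L, (1 / 2 : ℂ) • (X + X) = X := by
    intro X
    rw [← two_smul ℂ X, smul_smul]; norm_num
  rcases k with i | i
  · have := S.smul_mem (S.sub_mem (hm (Sum.inl i)) (S.smul_mem (hm (Sum.inr i)) Complex.I))
      (1 / 2 : ℂ)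
    rw [hI, majorana, show annihilation i + creation i - (annihilation i - creation i) =
      creation i + creation i by abel, h2] at this
    exact this
  · have := S.smul_mem (S.add_mem (hm (Sum.inl i)) (S.smul_mem (hm (Sum.inr i)) Complex.I))
      (1 / 2 : ℂ)
    rw [hI, majorana, show annihilation i + creation i + (annihilation i - creation i) =
      annihilation i + annihilation i by abel, h2] at this
    exact this

theorem linearMap_ext_orderedProd {V : Type*} [AddCommMonoid V] [Module ℂ V]
    {f h : FockOp L →ₗ[ℂ] V}
    (H : ∀ (n : ℕ) (y : Fin n → Fin L ⊕ Fin L), f (orderedProd majorana y) =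
      h (orderedProd majorana y)) : f = h := by
  refine LinearMap.ext_on (span_range_orderedProd _ adjoin_majorana_eq_top) ?_
  rintro _ ⟨n, y, rfl⟩
  exact H n y

theorem expect_injective : Function.Injective (expect (L := L)) := by
  intro ρ σ h
  ext a b
  have := LinearMap.congr_fun h (Matrix.single b a 1)
  simpa [expect_apply, Matrix.trace_mul_single] using this

theorem parity_mul_majorana (k : Fin L ⊕ Fin L) :
    parity L * majorana k = -(majorana k * parity L) := by
  have hA := fun i : Fin L => parity_mul_field (Sum.inr i)
  have hC := fun i : Fin L => parity_mul_field (Sum.inl i)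
  simp only [field] at hA hC
  rcases k with i | i
  · rw [majorana, mul_add, add_mul, hA, hC]; abel
  · rw [majorana, mul_smul_comm, smul_mul_assoc, mul_sub, sub_mul, hA, hC, ← smul_neg]
    congr 1; abel

theorem parity_mul_orderedProd {ι : Type*} {g : ι → FockOp L}
    (hg : ∀ k, parity L * g k = -(g k * parity L)) {n : ℕ} (y : Fin n → ι) :
    parity L * orderedProd g y * parity L = (-1 : ℂ) ^ n • orderedProd g y := by
  induction n with
  | zero => simp [orderedProd_zero, parity_mul_self]
  | succ n ih =>
    rw [orderedProd_succ, ← mul_assoc, hg, neg_mul, neg_mul, mul_assoc (g _),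
      mul_assoc (g _), ih, pow_succ, mul_smul_comm]
    simp

/-- The ladder operator `∑ k, φ(e_k) ⊗ φ(e_k)^*` on two copies of the Fock space. -/
def ladder (L : ℕ) : Matrix (Finset (Fin L) × Finset (Fin L)) (Finset (Fin L) × Finset (Fin L)) ℂ :=
  ∑ k, (field k ⊗ₖ field k.swap)

/-- The Wick formula is stated for Majorana operators and the dynamics for fields; this identity
lets a single ladder operator serve both. -/
theorem sum_majorana_kronecker :
    ∑ k, (majorana k ⊗ₖ majorana k) = (2 : ℂ) • ladder L := by
  rw [ladder, Fintype.sum_sum_type, Fintype.sum_sum_type, smul_add, Finset.smul_sum,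
    Finset.smul_sum, ← Finset.sum_add_distrib, ← Finset.sum_add_distrib]
  refine Finset.sum_congr rfl fun i _ => ?_
  ext ⟨a, b⟩ ⟨c, d⟩
  simp only [majorana, field, Sum.swap_inl, Sum.swap_inr, Matrix.add_apply, Matrix.smul_apply,
    Matrix.kroneckerMap_apply, Matrix.sub_apply, smul_eq_mul]
  linear_combination (annihilation i a c - creation i a c) * (annihilation i b d - creation i b d) *
    Complex.I_sq

/-- Operators that commute with the parity and whose tensor square commutes with the ladder
operator. -/
structure IsGaussian (ρ : FockOp L) : Prop where
  even : parity L * ρ * parity L = ρ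
  ladder_comm : ladder L * (ρ ⊗ₖ ρ) = (ρ ⊗ₖ ρ) * ladder L

/-- The trace of a tensor product factorizes, so cyclicity turns commutation with the ladder
operator into the vanishing of the defect. -/
theorem trace_kronecker_comm {ι : Type*} [Fintype ι] (g : ι → FockOp L) (bar : ι → ι)
    (ρ σ x y : FockOp L) :
    (((ρ ⊗ₖ σ) * (∑ k, (g k ⊗ₖ g (bar k))) - (∑ k, (g k ⊗ₖ g (bar k))) * (ρ ⊗ₖ σ)) *
      (x ⊗ₖ y)).trace = IsAnticommFamily.defect g bar (expect ρ) (expect σ) x y := by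
  rw [IsAnticommFamily.defect, Finset.mul_sum, Finset.sum_mul, ← Finset.sum_sub_distrib,
    Finset.sum_mul, Matrix.trace_sum]
  refine Finset.sum_congr rfl fun k _ => ?_
  rw [sub_mul, Matrix.trace_sub]
  simp only [← Matrix.mul_kronecker_mul, Matrix.trace_kronecker, expect_apply]
  congr 1
  · simp only [mul_assoc]
  · rw [Matrix.trace_mul_cycle, Matrix.trace_mul_cycle (g (bar k))]
    rw [Matrix.trace_mul_comm, Matrix.trace_mul_comm (y * _)]

theorem defect_field_eq_zero {ρ σ : FockOp L}
    (h : ladder L * (ρ ⊗ₖ σ) = (ρ ⊗ₖ σ) * ladder L) (x y : FockOp L) :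
    IsAnticommFamily.defect field Sum.swap (expect ρ) (expect σ) x y = 0 := by
  rw [← trace_kronecker_comm, ← ladder, h, sub_self, zero_mul, Matrix.trace_zero]

theorem defect_majorana_eq_zero {ρ σ : FockOp L}
    (h : ladder L * (ρ ⊗ₖ σ) = (ρ ⊗ₖ σ) * ladder L) (x y : FockOp L) :
    IsAnticommFamily.defect majorana id (expect ρ) (expect σ) x y = 0 := by
  rw [← trace_kronecker_comm]
  simp only [id, sum_majorana_kronecker]
  rw [smul_mul_assoc, h, mul_smul_comm, sub_self, zero_mul, Matrix.trace_zero]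

/-- The trace pairing of the commutator with x ⊗ y is bilinear, ordered products span in each
variable, and tensor products of matrix units detect every entry. -/
theorem ladder_comm_of_defect {ρ : FockOp L}
    (h : ∀ (n m : ℕ) (x : Fin n → Fin L ⊕ Fin L) (y : Fin m → Fin L ⊕ Fin L),
      IsAnticommFamily.defect majorana id (expect ρ) (expect ρ) (orderedProd majorana x)
        (orderedProd majorana y) = 0) :
    ladder L * (ρ ⊗ₖ ρ) = (ρ ⊗ₖ ρ) * ladder L := by
  let Z := (ρ ⊗ₖ ρ) * ladder L - ladder L * (ρ ⊗ₖ ρ)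
  let F : FockOp L →ₗ[ℂ] FockOp L →ₗ[ℂ] ℂ :=
    LinearMap.mk₂ ℂ (fun x y => (Z * (x ⊗ₖ y)).trace)
      (by intros; simp [Matrix.add_kronecker, mul_add])
      (by intros; simp [Matrix.smul_kronecker])
      (by intros; simp [Matrix.kronecker_add, mul_add])
      (by intros; simp [Matrix.kronecker_smul])
  have hF : F = 0 := by
    refine linearMap_ext_orderedProd fun n x => linearMap_ext_orderedProd fun m y => ?_
    have h1 := h n m x y
    rw [← trace_kronecker_comm] at h1
    simp only [id, sum_majorana_kronecker] at h1
    rw [smul_mul_assoc, mul_smul_comm, ← smul_sub, smul_mul_assoc, Matrix.trace_smul,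
      smul_eq_zero, or_iff_right two_ne_zero] at h1
    exact h1
  have hZ : Z = 0 := by
    ext ⟨a, b⟩ ⟨c, d⟩
    have h1 : F (Matrix.single c a 1) (Matrix.single d b 1) = 0 := by rw [hF]; rfl
    change (Z * ((Matrix.single c a 1 : FockOp L) ⊗ₖ (Matrix.single d b 1 : FockOp L))).trace = 0
      at h1
    rw [Matrix.single_kronecker_single, Matrix.trace_mul_single] at h1
    simpa using h1
  exact (sub_eq_zero.1 hZ).symm

theorem orderedProd_cons {R ι : Type*} [Monoid R] (g : ι → R) {n : ℕ} (j : ι) (y : Fin n → ι) :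
    orderedProd g (Fin.cons j y : Fin (n + 1) → ι) = g j * orderedProd g y := by
  rw [orderedProd_succ]; simp

/-- Parity-even operators have vanishing odd moments. -/
theorem expect_orderedProd_odd {ι : Type*} {g : ι → FockOp L}
    (hg : ∀ k, parity L * g k = -(g k * parity L)) {ρ : FockOp L}
    (hρ : parity L * ρ * parity L = ρ) {n : ℕ} (hn : Odd n) (y : Fin n → ι) :
    expect ρ (orderedProd g y) = 0 := by
  have h1 : expect ρ (orderedProd g y) = -expect ρ (orderedProd g y) := by
    have := congrArg (expect ρ) (parity_mul_orderedProd hg y)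
    rw [map_smul, smul_eq_mul, hn.neg_one_pow, neg_one_mul] at this
    rw [← this]
    conv_lhs => rw [← hρ]
    rw [expect_apply, expect_apply, mul_assoc, mul_assoc, Matrix.trace_mul_comm]
    simp only [mul_assoc]
  linear_combination (1 / 2 : ℂ) * h1

/-- Vanishing odd moments give evenness. The row expansion of the pairing sum is the recursion that
makes every defect vanish. -/
theorem IsQuasiFree.isGaussian {ρ : FockOp L} (h : IsQuasiFree ρ) : IsGaussian ρ := by
  have hone : expect ρ 1 = 1 := by rw [expect_apply, mul_one]; exact h.isState.2
  have hodd : ∀ (n : ℕ) (y : Fin n → Fin L ⊕ Fin L), Odd n →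
      expect ρ (orderedProd majorana y) = 0 := by
    rintro n y ⟨m, rfl⟩
    exact h.wick_odd m y
  have heven : ∀ (m : ℕ) (y : Fin (2 * m) → Fin L ⊕ Fin L), expect ρ (orderedProd majorana y) =
      pairingSum m fun a b => expect ρ (majorana (y a) * majorana (y b)) := fun m y =>
    h.wick_even m y
  constructor
  · refine expect_injective (linearMap_ext_orderedProd fun n y => ?_)
    have h1 : expect (parity L * ρ * parity L) (orderedProd majorana y) =
        (-1) ^ n * expect ρ (orderedProd majorana y) := by
      have := congrArg (expect ρ) (parity_mul_orderedProd parity_mul_majorana y)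
      rw [map_smul, smul_eq_mul] at this
      rw [← this, expect_apply, expect_apply, mul_assoc, mul_assoc, Matrix.trace_mul_comm]
      simp only [mul_assoc]
    rw [h1]
    rcases Nat.even_or_odd n with hn | hn
    · rw [hn.neg_one_pow, one_mul]
    · rw [hodd n y hn, mul_zero]
  · refine ladder_comm_of_defect fun n m x y =>
      isAnticommFamily_majorana.defect_orderedProd hone hodd ?_ x y
    intro j n y hn
    obtain ⟨m, rfl⟩ := (even_iff_exists_two_mul).1 hn
    have h1 := heven (m + 1) (Fin.cons j y : Fin (2 * m + 2) → Fin L ⊕ Fin L)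
    rw [pairingSum_succ] at h1
    refine Eq.trans ?_ (h1.trans ?_)
    · exact congrArg _ (orderedProd_cons majorana j y).symm
    · refine Finset.sum_congr rfl fun k _ => ?_
      rw [heven m]
      simp only [Fin.cons_succ, Fin.cons_zero]

/-- The recursion extracted from the defect and the row expansion of the pairing sum agree, so
induction on the number of pairs gives the Wick formula. -/
theorem IsGaussian.isQuasiFree {ρ : FockOp L} (hs : IsState ρ) (h : IsGaussian ρ) :
    IsQuasiFree ρ := by
  have hone : expect ρ 1 = 1 := by rw [expect_apply, mul_one]; exact hs.2
  refine ⟨hs, ?_, ?_⟩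
  · have key : ∀ (m : ℕ) (y : Fin (2 * m) → Fin L ⊕ Fin L), expect ρ (orderedProd majorana y) =
        pairingSum m fun a b => expect ρ (majorana (y a) * majorana (y b)) := by
      intro m
      induction m with
      | zero => intro y; rw [pairingSum_zero, orderedProd_zero, hone]
      | succ m ih =>
        intro y
        rw [pairingSum_succ]
        have h1 := isAnticommFamily_majorana.wick_recursion two_ne_zero hone
          (defect_majorana_eq_zero h.ladder_comm) (y (0 : Fin (2 * m + 2))) (even_two_mul m)
          (fun k => y (Fin.succ k : Fin (2 * m + 2)))
        refine Eq.trans ?_ (h1.trans ?_)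
        · exact congrArg _ (orderedProd_succ majorana y)
        · refine Finset.sum_congr rfl fun k _ => ?_
          rw [ih]
    exact key
  · intro m y
    exact expect_orderedProd_odd parity_mul_majorana h.even ⟨m, rfl⟩ y

end Gaussian

end QuasiFree
end

noncomputable section
namespace QuasiFree

open Filter Topology

/-! ### The Lie-Trotter product formula. -/

section Trotter

/-- Only ‖1‖ ≤ 1 is required, because in the operator algebra of a trivial space ‖1‖ = 0. -/
theorem norm_exp_le {𝔸 : Type*} [NormedRing 𝔸] [NormedAlgebra ℂ 𝔸] [CompleteSpace 𝔸]
    (h1 : ‖(1 : 𝔸)‖ ≤ 1) (x : 𝔸) : ‖NormedSpace.exp x‖ ≤ Real.exp ‖x‖ := by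
  have hs := NormedSpace.exp_series_hasSum_exp' (𝕂 := ℂ) x
  have hr : HasSum (fun n : ℕ => ‖x‖ ^ n / (n.factorial : ℝ)) (Real.exp ‖x‖) := by
    rw [Real.exp_eq_exp_ℝ]
    exact NormedSpace.expSeries_div_hasSum_exp ‖x‖
  refine hs.norm_le_of_bounded hr fun n => ?_
  rw [norm_smul, norm_inv, Complex.norm_natCast, inv_mul_eq_div]
  gcongr
  rcases n with _ | n
  · simpa using h1
  · exact norm_pow_le' x n.succ_pos

theorem norm_pow_sub_pow_le {𝔸 : Type*} [NormedRing 𝔸] (h1 : ‖(1 : 𝔸)‖ ≤ 1) {X Y : 𝔸} {K : ℝ}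
    (hK : 1 ≤ K) (hX : ‖X‖ ≤ K) (hY : ‖Y‖ ≤ K) (n : ℕ) :
    ‖X ^ n - Y ^ n‖ ≤ n * K ^ n * ‖X - Y‖ := by
  have hK0 : 0 ≤ K := zero_le_one.trans hK
  have hpow : ∀ n : ℕ, ‖Y ^ n‖ ≤ K ^ n := by
    intro n
    rcases n with _ | n
    · simpa using h1
    · exact (norm_pow_le' Y n.succ_pos).trans (pow_le_pow_left₀ (norm_nonneg _) hY _)
  induction n with
  | zero => simp
  | succ n ih =>
    have : X ^ (n + 1) - Y ^ (n + 1) = X * (X ^ n - Y ^ n) + (X - Y) * Y ^ n := by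
      rw [pow_succ', pow_succ']; noncomm_ring
    rw [this]
    calc ‖X * (X ^ n - Y ^ n) + (X - Y) * Y ^ n‖
        ≤ ‖X‖ * ‖X ^ n - Y ^ n‖ + ‖X - Y‖ * ‖Y ^ n‖ :=
          (norm_add_le _ _).trans (add_le_add (norm_mul_le _ _) (norm_mul_le _ _))
      _ ≤ K * (n * K ^ n * ‖X - Y‖) + ‖X - Y‖ * K ^ (n + 1) := by
          gcongr
          exact (hpow n).trans (pow_le_pow_right₀ hK n.le_succ)
      _ = (n + 1 : ℕ) * K ^ (n + 1) * ‖X - Y‖ := by push_cast; ring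

/-- The Lie-Trotter product formula. -/
theorem tendsto_trotter {𝔸 : Type*} [NormedRing 𝔸] [NormedAlgebra ℂ 𝔸] [CompleteSpace 𝔸]
    (h1 : ‖(1 : 𝔸)‖ ≤ 1) (x y : 𝔸) :
    Tendsto (fun n : ℕ => (NormedSpace.exp (((n : ℝ)⁻¹ : ℂ) • x) *
      NormedSpace.exp (((n : ℝ)⁻¹ : ℂ) • y)) ^ n) atTop (𝓝 (NormedSpace.exp (x + y))) := by
  let _ : NormedAlgebra ℚ 𝔸 := NormedAlgebra.restrictScalars ℚ ℂ 𝔸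
  let F : ℂ → 𝔸 := fun s => NormedSpace.exp (s • x) * NormedSpace.exp (s • y)
  let H : ℂ → 𝔸 := fun s => NormedSpace.exp (s • (x + y))
  -- Both curves have derivative x + y at 0, so they differ by o(1/n) at s = 1/n. Telescoping the
  -- n-th powers costs a factor n and a bounded constant.
  have hder : HasDerivAt (fun s => F s - H s) 0 0 := by
    have hx := hasDerivAt_exp_smul_const (𝕂 := ℂ) x (0 : ℂ)
    have hy := hasDerivAt_exp_smul_const (𝕂 := ℂ) y (0 : ℂ)
    have hxy := hasDerivAt_exp_smul_const (𝕂 := ℂ) (x + y) (0 : ℂ)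
    have h := (hx.mul hy).sub hxy
    simp only [zero_smul, NormedSpace.exp_zero, one_mul, mul_one, sub_self] at h
    exact h
  have hlim : Tendsto (fun n : ℕ => (n : ℝ) *
      ‖F ((n : ℝ)⁻¹ : ℂ) - H ((n : ℝ)⁻¹ : ℂ)‖) atTop (𝓝 0) := by
    have h0 : F 0 - H 0 = 0 := by simp [F, H]
    have h2 : (fun s => F s - H s) =o[𝓝 0] fun s : ℂ => s := by
      simpa only [h0, sub_zero, smul_zero] using hder.isLittleO
    have h3 : Tendsto (fun n : ℕ => ((n : ℝ)⁻¹ : ℂ)) atTop (𝓝 0) := by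
      have := (Complex.continuous_ofReal.tendsto 0).comp
        (tendsto_inv_atTop_zero.comp (tendsto_natCast_atTop_atTop (R := ℝ)))
      simpa [Function.comp_def] using this
    refine ((h2.comp_tendsto h3).norm_norm.tendsto_div_nhds_zero).congr fun n => ?_
    simp [div_eq_mul_inv, mul_comm]
  have hb : ∀ n : ℕ, ‖F ((n : ℝ)⁻¹ : ℂ) ^ n - H ((n : ℝ)⁻¹ : ℂ) ^ n‖ ≤
      Real.exp (‖x‖ + ‖y‖) * (n * ‖F ((n : ℝ)⁻¹ : ℂ) - H ((n : ℝ)⁻¹ : ℂ)‖) := by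
    intro n
    have hn : ‖((n : ℝ)⁻¹ : ℂ)‖ = (n : ℝ)⁻¹ := by simp
    have hF : ‖F ((n : ℝ)⁻¹ : ℂ)‖ ≤ Real.exp ((n : ℝ)⁻¹ * (‖x‖ + ‖y‖)) := by
      refine (norm_mul_le _ _).trans ?_
      have hs : ∀ z : 𝔸, (n : ℝ)⁻¹ * ‖z‖ = ‖((n : ℝ)⁻¹ : ℂ) • z‖ := fun z => by
        rw [norm_smul, hn]
      rw [mul_add, Real.exp_add, hs, hs]
      exact mul_le_mul (norm_exp_le h1 _) (norm_exp_le h1 _) (norm_nonneg _) (Real.exp_nonneg _)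
    have hH : ‖H ((n : ℝ)⁻¹ : ℂ)‖ ≤ Real.exp ((n : ℝ)⁻¹ * (‖x‖ + ‖y‖)) := by
      refine (norm_exp_le h1 _).trans (Real.exp_le_exp.2 ?_)
      rw [norm_smul, hn]
      exact mul_le_mul_of_nonneg_left (norm_add_le _ _) (by positivity)
    refine (norm_pow_sub_pow_le h1 (Real.one_le_exp (by positivity)) hF hH n).trans ?_
    rw [← Real.exp_nat_mul]
    rcases Nat.eq_zero_or_pos n with rfl | hpos
    · simp
    · have hne : (n : ℝ) ≠ 0 := by positivity
      rw [← mul_assoc (n : ℝ), mul_inv_cancel₀ hne, one_mul]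
      exact le_of_eq (by ring)
  have hHn : ∀ᶠ n : ℕ in atTop, H ((n : ℝ)⁻¹ : ℂ) ^ n = NormedSpace.exp (x + y) := by
    filter_upwards [eventually_gt_atTop 0] with n hn
    have hne : (n : ℂ) ≠ 0 := by exact_mod_cast hn.ne'
    simp only [H]
    rw [← NormedSpace.exp_nsmul, ← Nat.cast_smul_eq_nsmul ℂ, smul_smul]
    push_cast
    rw [mul_inv_cancel₀ hne, one_smul]
  have hdiff : Tendsto (fun n : ℕ => F ((n : ℝ)⁻¹ : ℂ) ^ n - H ((n : ℝ)⁻¹ : ℂ) ^ n)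
      atTop (𝓝 0) := by
    refine squeeze_zero_norm hb ?_
    simpa using hlim.const_mul (Real.exp (‖x‖ + ‖y‖))
  have h6 := hdiff.add (tendsto_const_nhds.congr' (hHn.mono fun n hn => hn.symm))
  rw [zero_add] at h6
  refine h6.congr fun n => ?_
  rw [sub_add_cancel]

end Trotter

/-! ### Exponentials of linear maps on finite-dimensional spaces. -/

section Lexp

variable {V W : Type*} [NormedAddCommGroup V] [NormedSpace ℂ V] [FiniteDimensional ℂ V]
  [NormedAddCommGroup W] [NormedSpace ℂ W] [FiniteDimensional ℂ W]

/-- The exponential of a linear map on a finite-dimensional space. -/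
def lexp (Λ : V →ₗ[ℂ] V) : V →L[ℂ] V := NormedSpace.exp (LinearMap.toContinuousLinearMap Λ)

theorem toContinuousLinearMap_pow_apply (Λ : V →ₗ[ℂ] V) (n : ℕ) (x : V) :
    ((LinearMap.toContinuousLinearMap Λ) ^ n) x = (Λ ^ n) x := by
  induction n generalizing x with
  | zero => simp
  | succ n ih => rw [pow_succ, pow_succ]; exact ih (Λ x)

theorem hasSum_lexp (Λ : V →ₗ[ℂ] V) (x : V) :
    HasSum (fun n : ℕ => ((n.factorial : ℂ)⁻¹) • (Λ ^ n) x) (lexp Λ x) := by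
  have := FiniteDimensional.complete ℂ V
  have h := (NormedSpace.exp_series_hasSum_exp' (𝕂 := ℂ)
    (LinearMap.toContinuousLinearMap Λ)).mapL (ContinuousLinearMap.apply ℂ V x)
  refine h.congr_fun fun n => ?_
  rw [← toContinuousLinearMap_pow_apply]
  rfl

/-- Exponentials of intertwined linear maps are intertwined. -/
theorem lexp_intertwine {Λ : V →ₗ[ℂ] V} {Λ' : W →ₗ[ℂ] W} (ι : V →ₗ[ℂ] W)
    (h : ∀ x, Λ' (ι x) = ι (Λ x)) (x : V) : lexp Λ' (ι x) = ι (lexp Λ x) := by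
  have hpow : ∀ (n : ℕ) (x : V), (Λ' ^ n) (ι x) = ι ((Λ ^ n) x) := by
    intro n
    induction n with
    | zero => simp
    | succ n ih => intro x; rw [pow_succ, pow_succ, Module.End.mul_apply, h, ih,
        Module.End.mul_apply]
  have h1 := (hasSum_lexp Λ x).mapL (LinearMap.toContinuousLinearMap ι)
  simp only [LinearMap.coe_toContinuousLinearMap', map_smul, ← hpow] at h1
  exact (hasSum_lexp Λ' (ι x)).unique h1

theorem lexp_zero_apply (x : V) : lexp (0 : V →ₗ[ℂ] V) x = x := by
  simp [lexp]

theorem lexp_add_apply {Λ Λ' : V →ₗ[ℂ] V} (h : Commute Λ Λ') (x : V) :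
    lexp (Λ + Λ') x = lexp Λ (lexp Λ' x) := by
  have := FiniteDimensional.complete ℂ V
  let _ : NormedAlgebra ℚ (V →L[ℂ] V) := NormedAlgebra.restrictScalars ℚ ℂ _
  have hc : Commute (LinearMap.toContinuousLinearMap Λ) (LinearMap.toContinuousLinearMap Λ') := by
    ext x
    exact LinearMap.congr_fun h x
  rw [lexp, map_add, NormedSpace.exp_add_of_commute hc]
  rfl

theorem lexp_neg_lexp (Λ : V →ₗ[ℂ] V) (x : V) : lexp (-Λ) (lexp Λ x) = x := by
  rw [← lexp_add_apply ((Commute.refl Λ).neg_left), neg_add_cancel, lexp_zero_apply]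

theorem lexp_eigenvector {Λ : V →ₗ[ℂ] V} {μ : ℂ} {x : V} (h : Λ x = μ • x) :
    lexp Λ x = Complex.exp μ • x := by
  have hpow : ∀ n : ℕ, (Λ ^ n) x = μ ^ n • x := by
    intro n
    induction n with
    | zero => simp
    | succ n ih => rw [pow_succ', Module.End.mul_apply, ih, map_smul, h, smul_smul, pow_succ]
  have h1 := hasSum_lexp Λ x
  have h2 : HasSum (fun n : ℕ => ((n.factorial : ℂ)⁻¹ • μ ^ n) • x) (NormedSpace.exp μ • x) :=
    (NormedSpace.exp_series_hasSum_exp' (𝕂 := ℂ) μ).smul_const x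
  rw [← Complex.exp_eq_exp_ℂ] at h2
  refine h1.unique (h2.congr_fun ?_)
  intro n
  rw [hpow, smul_assoc]

theorem lexp_comm (Λ : V →ₗ[ℂ] V) (x : V) : Λ (lexp Λ x) = lexp Λ (Λ x) :=
  (lexp_intertwine Λ (fun _ => rfl) x).symm

/-- The product formula for exponentials of linear maps. -/
theorem tendsto_lexp_trotter (Λ Λ' : V →ₗ[ℂ] V) (x : V) :
    Tendsto (fun n : ℕ => ((lexp (((n : ℝ)⁻¹ : ℂ) • Λ) * lexp (((n : ℝ)⁻¹ : ℂ) • Λ')) ^ n) x)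
      atTop (𝓝 (lexp (Λ + Λ') x)) := by
  have := FiniteDimensional.complete ℂ V
  have h := tendsto_trotter (𝔸 := V →L[ℂ] V) ContinuousLinearMap.norm_id_le
    (LinearMap.toContinuousLinearMap Λ) (LinearMap.toContinuousLinearMap Λ')
  have h2 := ((ContinuousLinearMap.apply ℂ V x).continuous.tendsto _).comp h
  simpa only [lexp, map_add, map_smul, Function.comp_def, ContinuousLinearMap.apply_apply] using h2

theorem differentiable_lexp_affine (Λ Λ' : V →ₗ[ℂ] V) (x : V) :
    Differentiable ℂ fun z : ℂ => lexp (Λ + z • Λ') x := by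
  have := FiniteDimensional.complete ℂ V
  intro z
  have h1 : DifferentiableAt ℂ (NormedSpace.exp : (V →L[ℂ] V) → (V →L[ℂ] V))
      (LinearMap.toContinuousLinearMap (Λ + z • Λ')) :=
    (NormedSpace.exp_analytic _).differentiableAt
  have h2 : DifferentiableAt ℂ (fun z : ℂ => LinearMap.toContinuousLinearMap (Λ + z • Λ')) z := by
    simp only [map_add, map_smul]
    fun_prop
  exact (ContinuousLinearMap.apply ℂ V x).differentiableAt.comp z (h1.comp z h2)

end Lexp

end QuasiFree
end

noncomputable section
namespace QuasiFree

open Filter Topology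

/-! ### Semigroups preserving the cone of positive semidefinite matrices. -/

section Cone

open scoped Matrix.Norms.Operator

variable {n : Type*}

/-- Maps that preserve positive semidefiniteness. -/
def IsPSDMap (T : Matrix n n ℂ → Matrix n n ℂ) : Prop := ∀ A, A.PosSemidef → (T A).PosSemidef

theorem IsPSDMap.pow {T : Matrix n n ℂ →ₗ[ℂ] Matrix n n ℂ} (hT : IsPSDMap T) (k : ℕ) :
    IsPSDMap ⇑(T ^ k) := by
  intro A hA
  induction k with
  | zero => simpa using hA
  | succ k ih => rw [pow_succ', Module.End.mul_apply]; exact hT _ ih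

theorem IsPSDMap.smul {J : Matrix n n ℂ →ₗ[ℂ] Matrix n n ℂ} (hJ : IsPSDMap J) {c : ℝ}
    (hc : 0 ≤ c) : IsPSDMap ⇑((c : ℂ) • J) := fun A hA =>
  (hJ A hA).smul (by exact_mod_cast hc)

variable [Fintype n]

theorem isClosed_posSemidef : IsClosed {A : Matrix n n ℂ | A.PosSemidef} := by
  have : {A : Matrix n n ℂ | A.PosSemidef} =
      {A | Aᴴ = A} ∩ ⋂ v : n → ℂ, {A | 0 ≤ star v ⬝ᵥ (A *ᵥ v)} := by
    ext A
    simp [Matrix.posSemidef_iff_dotProduct_mulVec, Matrix.IsHermitian]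
  rw [this]
  refine (isClosed_eq (by fun_prop) continuous_id).inter (isClosed_iInter fun v => ?_)
  exact isClosed_le continuous_const (by fun_prop)

theorem posSemidef_of_hasSum {f : ℕ → Matrix n n ℂ} {A : Matrix n n ℂ} (h : HasSum f A)
    (hf : ∀ k, (f k).PosSemidef) : A.PosSemidef :=
  isClosed_posSemidef.mem_of_tendsto h
    (Eventually.of_forall fun s => Matrix.posSemidef_sum s fun k _ => hf k)

/-- The exponential series without its constant term is a sum of positive terms, and the cone is
closed. -/
theorem IsPSDMap.lexp_sub {J : Matrix n n ℂ →ₗ[ℂ] Matrix n n ℂ} (hJ : IsPSDMap J) :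
    IsPSDMap fun A => lexp J A - A := by
  intro A hA
  have h := (hasSum_nat_add_iff' 1).2 (hasSum_lexp J A)
  simp only [Finset.sum_range_one, Nat.factorial_zero, Nat.cast_one, inv_one, pow_zero, one_smul,
    Module.End.one_apply] at h
  refine posSemidef_of_hasSum h fun k => ?_
  exact (hJ.pow _ A hA).smul (by positivity)

/-- Adding a positive map to the generator of a positive semigroup increases the semigroup. -/
theorem IsPSDMap.lexp_add_sub {G J : Matrix n n ℂ →ₗ[ℂ] Matrix n n ℂ}
    (hG : ∀ t : ℝ, 0 ≤ t → IsPSDMap (lexp ((t : ℂ) • G))) (hJ : IsPSDMap J) :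
    IsPSDMap fun A => lexp (G + J) A - lexp G A := by
  intro A hA
  -- The second product formula uses J = 0, so both exponentials are limits of powers with the same
  -- factor X and can be compared before passing to the limit.
  have h1 := (tendsto_lexp_trotter G J A).sub (tendsto_lexp_trotter G 0 A)
  rw [add_zero] at h1
  refine isClosed_posSemidef.mem_of_tendsto h1 (Eventually.of_forall fun k => ?_)
  have hX := hG ((k : ℝ)⁻¹) (by positivity)
  have hY := (hJ.smul (c := (k : ℝ)⁻¹) (by positivity)).lexp_sub
  push_cast at hX hY
  simp only [Complex.ofReal_natCast]
  generalize lexp (((k : ℂ)⁻¹) • G) = X at hX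
  generalize lexp (((k : ℂ)⁻¹) • J) = Y at hY
  have hone : lexp (((k : ℂ)⁻¹) • (0 : Matrix n n ℂ →ₗ[ℂ] Matrix n n ℂ)) = 1 := by
    rw [smul_zero]; ext1 x; exact lexp_zero_apply x
  rw [hone, mul_one]
  -- On the cone Y dominates the identity and X preserves the order, so the inequality survives each
  -- further factor.
  have key : ∀ j : ℕ, ((X ^ j) A).PosSemidef ∧ (((X * Y) ^ j) A - (X ^ j) A).PosSemidef := by
    intro j
    induction j with
    | zero => simpa using ⟨hA, Matrix.PosSemidef.zero⟩
    | succ j ih =>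
      have hXA : (X ^ (j + 1)) A = X ((X ^ j) A) := by rw [pow_succ']; rfl
      have hXYA : ((X * Y) ^ (j + 1)) A = X (Y (((X * Y) ^ j) A)) := by rw [pow_succ']; rfl
      refine ⟨by rw [hXA]; exact hX _ ih.1, ?_⟩
      have hsum : ((X * Y) ^ (j + 1)) A - (X ^ (j + 1)) A =
          X ((Y (((X * Y) ^ j) A) - ((X * Y) ^ j) A) + (((X * Y) ^ j) A - (X ^ j) A)) := by
        rw [hXYA, hXA, sub_add_sub_cancel, map_sub]
      rw [hsum]
      refine hX _ (Matrix.PosSemidef.add (hY _ ?_) ih.2)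
      have := ih.2.add ih.1
      rwa [sub_add_cancel] at this
  exact (key k).2

theorem IsPSDMap.lexp_add {G J : Matrix n n ℂ →ₗ[ℂ] Matrix n n ℂ}
    (hG : ∀ t : ℝ, 0 ≤ t → IsPSDMap (lexp ((t : ℂ) • G))) (hJ : IsPSDMap J)
    (t : ℝ) (ht : 0 ≤ t) : IsPSDMap (lexp ((t : ℂ) • (G + J))) := by
  intro A hA
  have h1 := IsPSDMap.lexp_add_sub (G := (t : ℂ) • G) (J := (t : ℂ) • J)
    (fun s hs => by
      have := hG (s * t) (mul_nonneg hs ht)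
      rwa [Complex.ofReal_mul, mul_smul] at this) (hJ.smul ht) A hA
  have := h1.add (hG t ht A hA)
  rwa [sub_add_cancel, ← smul_add] at this

/-- The positivity improving property is inherited by generators with a larger positive part. -/
theorem posDef_lexp_of_posDef_lexp {G J₀ J₁ : Matrix n n ℂ →ₗ[ℂ] Matrix n n ℂ}
    (hG : ∀ t : ℝ, 0 ≤ t → IsPSDMap (lexp ((t : ℂ) • G))) (h₀ : IsPSDMap J₀) {c : ℝ} (hc : 0 < c)
    (h₁ : IsPSDMap ⇑(J₁ - (c : ℂ) • J₀)) {A : Matrix n n ℂ} (hA : A.PosSemidef)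
    (h : (lexp (G + J₀) A).PosDef) : (lexp (G + J₁) A).PosDef := by
  have hpos : ∀ r : ℝ, 0 ≤ r → ∀ t : ℝ, 0 ≤ t → IsPSDMap (lexp ((t : ℂ) • (G + (r : ℂ) • J₀))) :=
    fun r hr t ht => IsPSDMap.lexp_add hG (h₀.smul hr) t ht
  have hposr : ∀ r : ℝ, 0 ≤ r → (lexp (G + (r : ℂ) • J₀) A).PosSemidef := by
    intro r hr
    simpa using hpos r hr 1 zero_le_one A hA
  have hmono : ∀ r : ℝ, 0 ≤ r → r ≤ c →
      (lexp (G + J₁) A - lexp (G + (r : ℂ) • J₀) A).PosSemidef := by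
    intro r hr hrc
    have hJ : IsPSDMap ⇑(J₁ - (r : ℂ) • J₀) := by
      intro B hB
      have := (h₁ B hB).add (h₀.smul (sub_nonneg.2 hrc) B hB)
      convert this using 1
      simp only [LinearMap.sub_apply, LinearMap.smul_apply]
      push_cast
      module
    have := IsPSDMap.lexp_add_sub (hpos r hr) hJ A hA
    rwa [add_assoc, add_sub_cancel] at this
  have hPSD : (lexp (G + J₁) A).PosSemidef := by
    have := (hmono 0 le_rfl hc.le).add (hposr 0 le_rfl)
    rwa [sub_add_cancel] at this
  refine Matrix.PosDef.of_dotProduct_mulVec_pos hPSD.1 fun v hv => ?_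
  refine lt_of_le_of_ne (hPSD.dotProduct_mulVec_nonneg v) fun h0 => ?_
  -- If v were a null vector for J₁, then for r in [0, c] monotonicity squeezes f(r) between 0 and
  -- 0. As f is entire it vanishes identically, which contradicts strict positivity at z = 1.
  -- Analyticity is what allows c < 1.
  let f : ℂ → ℂ := fun z => star v ⬝ᵥ ((lexp (G + z • J₀) A) *ᵥ v)
  have hfd : Differentiable ℂ f := by
    let φ : Matrix n n ℂ →ₗ[ℂ] ℂ :=
      { toFun := fun B => star v ⬝ᵥ (B *ᵥ v)
        map_add' := by intros; simp [Matrix.add_mulVec]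
        map_smul' := by intros; simp [Matrix.smul_mulVec] }
    exact (LinearMap.toContinuousLinearMap φ).differentiable.comp (differentiable_lexp_affine G J₀ A)
  have hfr : ∀ r : ℝ, 0 ≤ r → r ≤ c → f r = 0 := by
    intro r hr hrc
    have h2 := (hmono r hr hrc).dotProduct_mulVec_nonneg v
    rw [Matrix.sub_mulVec, dotProduct_sub, ← h0, zero_sub] at h2
    exact le_antisymm (neg_nonneg.1 h2) ((hposr r hr).dotProduct_mulVec_nonneg v)
  have hfan : AnalyticOnNhd ℂ f Set.univ := fun z _ => hfd.analyticAt z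
  have hfreq : ∃ᶠ z in 𝓝[≠] (0 : ℂ), f z = 0 := by
    have hlim : Tendsto (fun k : ℕ => ((c / (k + 1) : ℝ) : ℂ)) atTop (𝓝[≠] 0) := by
      rw [tendsto_nhdsWithin_iff]
      constructor
      · have h3 : Tendsto (fun k : ℕ => c / ((k : ℝ) + 1)) atTop (𝓝 0) := by
          simpa [div_eq_mul_inv] using (tendsto_one_div_add_atTop_nhds_zero_nat (𝕜 := ℝ)).const_mul c
        exact_mod_cast (Complex.continuous_ofReal.tendsto 0).comp h3
      · refine Eventually.of_forall fun k => ?_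
        have : c / ((k : ℝ) + 1) ≠ 0 := by positivity
        simpa only [Set.mem_compl_iff, Set.mem_singleton_iff, Complex.ofReal_eq_zero] using this
    refine hlim.frequently (Frequently.of_forall fun k => hfr _ (by positivity) ?_)
    exact div_le_self hc.le (by linarith [(Nat.cast_nonneg k : (0 : ℝ) ≤ k)])
  have hf1 : f 1 = 0 :=
    hfan.eqOn_zero_of_preconnected_of_frequently_eq_zero isPreconnected_univ (Set.mem_univ 0) hfreq
      (Set.mem_univ 1)
  have h4 := h.dotProduct_mulVec_pos hv
  simp only [f, one_smul] at hf1
  rw [hf1] at h4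
  exact lt_irrefl _ h4

variable [DecidableEq n]

theorem lexp_mulLeft (D A : Matrix n n ℂ) :
    lexp (LinearMap.mulLeft ℂ D) A = NormedSpace.exp D * A := by
  have h1 := hasSum_lexp (LinearMap.mulLeft ℂ D) A
  have h2 := (NormedSpace.exp_series_hasSum_exp' (𝕂 := ℂ) D).mul_right A
  refine h1.unique (h2.congr_fun fun k => ?_)
  simp [LinearMap.pow_mulLeft]

theorem lexp_mulRight (D A : Matrix n n ℂ) :
    lexp (LinearMap.mulRight ℂ D) A = A * NormedSpace.exp D := by
  have h1 := hasSum_lexp (LinearMap.mulRight ℂ D) A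
  have h2 := (NormedSpace.exp_series_hasSum_exp' (𝕂 := ℂ) D).mul_left A
  refine h1.unique (h2.congr_fun fun k => ?_)
  simp [LinearMap.pow_mulRight]

/-- Left and right multiplications commute, so the exponential is the conjugation A ↦ e^{tD} A
(e^{tD})^*. -/
theorem isPSDMap_lexp_mulLeft_add_mulRight (D : Matrix n n ℂ) (t : ℝ) :
    IsPSDMap (lexp ((t : ℂ) • (LinearMap.mulLeft ℂ D + LinearMap.mulRight ℂ Dᴴ))) := by
  intro A hA
  have hl : (t : ℂ) • LinearMap.mulLeft ℂ D = LinearMap.mulLeft ℂ ((t : ℂ) • D) := by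
    ext1 x; simp
  have hr : (t : ℂ) • LinearMap.mulRight ℂ Dᴴ = LinearMap.mulRight ℂ ((t : ℂ) • D)ᴴ := by
    ext1 x; simp
  rw [smul_add, hl, hr, lexp_add_apply (LinearMap.commute_mulLeft_right _ _), lexp_mulLeft,
    lexp_mulRight, Matrix.exp_conjTranspose, ← mul_assoc]
  exact hA.mul_mul_conjTranspose_same _

end Cone

end QuasiFree
end

noncomputable section
namespace QuasiFree

open Filter Topology

/-! ### Existence of a Perron eigenvector in an invariant compact set of states. -/

section PerronFrobenius

open scoped Matrix.Norms.Operator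

variable {n : Type*} [Fintype n]

/-- The set of density matrices. -/
def stateSet (n : Type*) [Fintype n] : Set (Matrix n n ℂ) := {ρ | ρ.PosSemidef ∧ ρ.trace = 1}

theorem exists_eq_conjTranspose_mul_self {A : Matrix n n ℂ} (hA : A.PosSemidef) :
    ∃ R : Matrix n n ℂ, A = Rᴴ * R := by
  classical
  open scoped MatrixOrder in
  obtain ⟨B, hB⟩ := CStarAlgebra.nonneg_iff_eq_star_mul_self.mp hA.nonneg
  exact ⟨B, hB⟩

/-- The density matrices are the image under R ↦ R^* R of the Hilbert-Schmidt unit sphere, whose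
entries are bounded by 1. -/
theorem isCompact_stateSet : IsCompact (stateSet n) := by
  let S : Set (Matrix n n ℂ) := {R | (Rᴴ * R).trace = 1}
  have hS : IsCompact S := by
    have hK : IsCompact (Set.univ.pi fun _ : n => Set.univ.pi fun _ : n =>
        Metric.closedBall (0 : ℂ) 1) :=
      isCompact_univ_pi fun _ => isCompact_univ_pi fun _ => isCompact_closedBall _ _
    refine IsCompact.of_isClosed_subset (X := Matrix n n ℂ) hK
      (isClosed_eq (by fun_prop) continuous_const) fun R hR => ?_
    refine fun i _ j _ => mem_closedBall_zero_iff.2 ?_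
    have h1 : ∑ j, ∑ i, ‖R i j‖ ^ 2 = 1 := by
      have hR' : (Rᴴ * R).trace = 1 := hR
      simp only [Matrix.trace, Matrix.diag_apply, Matrix.mul_apply, Matrix.conjTranspose_apply] at hR'
      have h2 : ∀ z : ℂ, star z * z = ((‖z‖ ^ 2 : ℝ) : ℂ) := fun z => by
        rw [Complex.star_def, Complex.conj_mul']; push_cast; rfl
      simp only [h2] at hR'
      exact_mod_cast hR'
    have h3 : ‖R i j‖ ^ 2 ≤ 1 := by
      rw [← h1]
      refine le_trans ?_ (Finset.single_le_sum (f := fun j => ∑ i, ‖R i j‖ ^ 2)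
        (fun j _ => Finset.sum_nonneg fun i _ => by positivity) (Finset.mem_univ j))
      exact Finset.single_le_sum (f := fun i => ‖R i j‖ ^ 2) (fun i _ => by positivity)
        (Finset.mem_univ i)
    exact (sq_le_one_iff₀ (norm_nonneg _)).1 h3
  have himg : stateSet n = (fun R : Matrix n n ℂ => Rᴴ * R) '' S := by
    ext ρ
    constructor
    · rintro ⟨h1, h2⟩
      obtain ⟨R, rfl⟩ := exists_eq_conjTranspose_mul_self h1
      exact ⟨R, h2, rfl⟩
    · rintro ⟨R, h, rfl⟩
      exact ⟨Matrix.posSemidef_conjTranspose_mul_self R, h⟩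
  rw [himg]
  exact hS.image (by fun_prop)

theorem re_dotProduct_smul (A : Matrix n n ℂ) (c : ℂ) (v : n → ℂ) :
    (star (c • v) ⬝ᵥ (A *ᵥ (c • v))).re = ‖c‖ ^ 2 * (star v ⬝ᵥ (A *ᵥ v)).re := by
  rw [star_smul, Matrix.mulVec_smul, smul_dotProduct, dotProduct_smul, smul_smul, smul_eq_mul,
    Complex.star_def, Complex.conj_mul']
  norm_cast
  rw [Complex.re_ofReal_mul]

theorem im_dotProduct_eq_zero {A : Matrix n n ℂ} (hA : A.IsHermitian) (v : n → ℂ) :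
    (star v ⬝ᵥ (A *ᵥ v)).im = 0 := by
  rw [← Complex.conj_eq_iff_im, ← Complex.star_def, ← Matrix.star_dotProduct_star, star_star,
    Matrix.star_mulVec, hA.eq, Matrix.dotProduct_mulVec, dotProduct_comm]

theorem posSemidef_of_re_nonneg {A : Matrix n n ℂ} (hA : A.IsHermitian)
    (h : ∀ v : n → ℂ, ‖v‖ = 1 → 0 ≤ (star v ⬝ᵥ (A *ᵥ v)).re) : A.PosSemidef := by
  refine Matrix.PosSemidef.of_dotProduct_mulVec_nonneg hA fun v => ?_
  rw [Complex.nonneg_iff]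
  refine ⟨?_, (im_dotProduct_eq_zero hA v).symm⟩
  by_cases hv : v = 0
  · simp [hv]
  · have hn : ‖v‖ ≠ 0 := norm_ne_zero_iff.2 hv
    have h1 := h (((‖v‖⁻¹ : ℝ) : ℂ) • v) (by
      rw [norm_smul, Complex.norm_real, norm_inv, norm_norm, inv_mul_cancel₀ hn])
    rw [re_dotProduct_smul] at h1
    refine nonneg_of_mul_nonneg_right h1 (pow_pos ?_ 2)
    rw [Complex.norm_real, norm_inv, norm_norm]
    exact inv_pos.2 (norm_pos_iff.2 hv)

/-- A compact set of positive definite matrices dominates every compact set of Hermitian matrices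
up to a constant. -/
theorem exists_posSemidef_sub_smul {K K' : Set (Matrix n n ℂ)} (hK : IsCompact K)
    (hK' : IsCompact K') (hpos : ∀ P ∈ K, P.PosDef) (hher : ∀ H ∈ K', H.IsHermitian) :
    ∃ ε : ℝ, 0 < ε ∧ ∀ P ∈ K, ∀ H ∈ K', (P - (ε : ℂ) • H).PosSemidef := by
  let q : Matrix n n ℂ × (n → ℂ) → ℝ := fun p => (star p.2 ⬝ᵥ (p.1 *ᵥ p.2)).re
  have hq : Continuous q := Complex.continuous_re.comp (by fun_prop)
  have hsph : IsCompact (Metric.sphere (0 : n → ℂ) 1) := isCompact_sphere _ _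
  obtain ⟨m, hm, hmb⟩ : ∃ m : ℝ, 0 < m ∧ ∀ P ∈ K, ∀ v : n → ℂ, ‖v‖ = 1 → m ≤ q (P, v) := by
    rcases (K ×ˢ Metric.sphere (0 : n → ℂ) 1).eq_empty_or_nonempty with he | hne
    · refine ⟨1, one_pos, fun P hP v hv => ?_⟩
      have : (P, v) ∈ K ×ˢ Metric.sphere (0 : n → ℂ) 1 := ⟨hP, by simpa using hv⟩
      rw [he] at this
      exact this.elim
    · obtain ⟨⟨P, v⟩, ⟨hP, hv⟩, hmin⟩ := (hK.prod hsph).exists_isMinOn hne hq.continuousOn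
      refine ⟨q (P, v), ?_, fun P' hP' v' hv' => hmin ⟨hP', by simpa using hv'⟩⟩
      have hv0 : v ≠ 0 := by
        rintro rfl
        simp at hv
      exact (Complex.pos_iff.1 ((hpos P hP).dotProduct_mulVec_pos hv0)).1
  obtain ⟨M, hM⟩ := ((hK'.prod hsph).image hq).bddAbove
  have hMb : ∀ H ∈ K', ∀ v : n → ℂ, ‖v‖ = 1 → q (H, v) ≤ |M| + 1 := fun H hH v hv =>
    (hM ⟨(H, v), ⟨hH, by simpa using hv⟩, rfl⟩).trans ((le_abs_self M).trans (by linarith))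
  -- Here m is a positive lower bound for the forms of K on the unit sphere and |M| + 1 an upper
  -- bound for those of K', enlarged to be positive.
  refine ⟨m / (|M| + 1), by positivity, fun P hP H hH => ?_⟩
  refine posSemidef_of_re_nonneg ?_ fun v hv => ?_
  · refine (hpos P hP).1.sub ?_
    rw [Matrix.IsHermitian, Matrix.conjTranspose_smul, (hher H hH).eq, Complex.star_def,
      Complex.conj_ofReal]
  · have h1 := hmb P hP v hv
    have h2 := hMb H hH v hv
    rw [Matrix.sub_mulVec, dotProduct_sub, Matrix.smul_mulVec, dotProduct_smul, Complex.sub_re,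
      smul_eq_mul, Complex.re_ofReal_mul]
    have h3 : m / (|M| + 1) * q (H, v) ≤ m / (|M| + 1) * (|M| + 1) := by gcongr
    rw [div_mul_cancel₀ _ (by positivity)] at h3
    simp only [q] at h1 h3
    linarith

/-- Positivity improving maps. -/
def IsImproving (T : Matrix n n ℂ → Matrix n n ℂ) : Prop :=
  ∀ A, A.PosSemidef → A ≠ 0 → (T A).PosDef

/-- A compact set of states that is invariant under the normalized action of a positivity improving
map contains an eigenvector. -/
theorem exists_eigenvector_mem [Nonempty n] {T : Matrix n n ℂ →ₗ[ℂ] Matrix n n ℂ}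
    (hT : IsImproving T) {K : Set (Matrix n n ℂ)} (hKs : K ⊆ stateSet n) (hK : IsCompact K)
    (hne : K.Nonempty) (hinv : ∀ ρ ∈ K, ((T ρ).trace)⁻¹ • T ρ ∈ K) :
    ∃ ρ ∈ K, ∃ l : ℝ, 0 < l ∧ T ρ = (l : ℂ) • ρ := by
  have hTc : Continuous T := T.continuous_of_finiteDimensional
  have hne0 : ∀ ρ ∈ K, ρ ≠ 0 := by
    rintro ρ hρ rfl
    have := (hKs hρ).2
    simp at this
  obtain ⟨M, hM⟩ := (hK.image (f := fun ρ => (T ρ).trace.re) (by fun_prop)).bddAbove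
  -- Collatz-Wielandt: maximize l subject to Tρ ≥ lρ with ρ in K. Taking traces bounds l, so the
  -- constraint set is compact; no convexity of K is used.
  let C : Set (ℝ × Matrix n n ℂ) :=
    {p | p.2 ∈ K ∧ 0 ≤ p.1 ∧ (T p.2 - (p.1 : ℂ) • p.2).PosSemidef}
  have hC : IsCompact C := by
    refine IsCompact.of_isClosed_subset ((isCompact_Icc (a := (0 : ℝ)) (b := M)).prod hK) ?_ ?_
    · have h1 : IsClosed {p : ℝ × Matrix n n ℂ | p.2 ∈ K} := hK.isClosed.preimage continuous_snd
      have h2 : IsClosed {p : ℝ × Matrix n n ℂ | 0 ≤ p.1} := isClosed_le continuous_const continuous_fst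
      have h3 : IsClosed {p : ℝ × Matrix n n ℂ | (T p.2 - (p.1 : ℂ) • p.2).PosSemidef} :=
        isClosed_posSemidef.preimage (by fun_prop)
      exact h1.inter (h2.inter h3)
    · rintro ⟨l, ρ⟩ ⟨h1, h2, h3⟩
      refine ⟨⟨h2, ?_⟩, h1⟩
      have h4 := h3.trace_nonneg
      rw [Matrix.trace_sub, Matrix.trace_smul, (hKs h1).2, smul_eq_mul, mul_one] at h4
      have h5 := (Complex.nonneg_iff.1 h4).1
      rw [Complex.sub_re, Complex.ofReal_re] at h5
      have h6 : (T ρ).trace.re ≤ M := hM ⟨ρ, h1, rfl⟩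
      show l ≤ M
      linarith
  obtain ⟨ρ₀, hρ₀⟩ := hne
  have hCne : C.Nonempty := ⟨(0, ρ₀), hρ₀, le_rfl, by
    simpa using (hT ρ₀ (hKs hρ₀).1 (hne0 _ hρ₀)).posSemidef⟩
  obtain ⟨⟨l, ρ⟩, ⟨hρ, hl, hle⟩, hmax⟩ := hC.exists_isMaxOn hCne continuous_fst.continuousOn
  simp only at hρ hl hle
  have hTρ := hT ρ (hKs hρ).1 (hne0 ρ hρ)
  -- If Tρ - lρ were nonzero, T would make it positive definite. The normalized Tρ, which lies in K,
  -- would then satisfy the constraint with a larger l.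
  have heq : T ρ = (l : ℂ) • ρ := by
    by_contra hcon
    have hP := hT _ hle (sub_ne_zero.2 hcon)
    have htr : 0 < (T ρ).trace := hTρ.trace_pos
    set c := (T ρ).trace
    set ρ' := c⁻¹ • T ρ
    have hρ' : ρ' ∈ K := hinv ρ hρ
    have hP' : (T ρ' - (l : ℂ) • ρ').PosDef := by
      have : T ρ' - (l : ℂ) • ρ' = c⁻¹ • T (T ρ - (l : ℂ) • ρ) := by
        simp only [ρ', map_smul, map_sub, smul_sub]
        rw [smul_comm]
      rw [this]
      exact hP.smul (inv_pos.2 htr)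
    obtain ⟨ε, hε, h⟩ := exists_posSemidef_sub_smul (isCompact_singleton (x := T ρ' - (l : ℂ) • ρ'))
      (isCompact_singleton (x := ρ')) (by rintro _ rfl; exact hP')
      (by rintro _ rfl; exact (hKs hρ').1.1)
    have h1 := h _ rfl _ rfl
    have h2 : (l + ε, ρ') ∈ C := by
      refine ⟨hρ', by positivity, ?_⟩
      convert h1 using 1
      push_cast
      rw [add_smul, sub_sub]
    have h3 : l + ε ≤ l := hmax h2
    linarith
  refine ⟨ρ, hρ, l, lt_of_le_of_ne hl ?_, heq⟩
  rintro rfl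
  rw [heq] at hTρ
  have := hTρ.trace_pos
  simp at this

theorem trace_mul_nonneg {A B : Matrix n n ℂ} (hA : A.PosSemidef) (hB : B.PosSemidef) :
    0 ≤ (A * B).trace := by
  obtain ⟨R, rfl⟩ := exists_eq_conjTranspose_mul_self hA
  rw [mul_assoc, Matrix.trace_mul_comm]
  exact (hB.mul_mul_conjTranspose_same R).trace_nonneg

/-- A positive definite B dominates some ε · 1, so the trace is at least ε Tr A. -/
theorem trace_mul_pos {A B : Matrix n n ℂ} (hA : A.PosSemidef) (hA0 : A ≠ 0) (hB : B.PosDef) :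
    0 < (A * B).trace := by
  classical
  obtain ⟨ε, hε, h⟩ := exists_posSemidef_sub_smul (isCompact_singleton (x := B))
    (isCompact_singleton (x := (1 : Matrix n n ℂ))) (by rintro _ rfl; exact hB)
    (by rintro _ rfl; exact Matrix.isHermitian_one)
  have h1 := trace_mul_nonneg hA (h _ rfl _ rfl)
  rw [mul_sub, Matrix.trace_sub, mul_smul_comm, mul_one, Matrix.trace_smul, smul_eq_mul,
    sub_nonneg] at h1
  refine lt_of_lt_of_le (mul_pos (by exact_mod_cast hε) ?_) h1
  exact lt_of_le_of_ne hA.trace_nonneg fun h => hA0 (hA.trace_eq_zero_iff.1 h.symm)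

end PerronFrobenius

end QuasiFree
end

noncomputable section
namespace QuasiFree

open Filter Topology

/-! ### Simplicity and strict dominance of the Perron eigenvalue. -/

section Dominance

open scoped Matrix.Norms.Operator

variable {n : Type*}

/-- The Hermitian part `u x + (u x)^*`. -/
def hermPart (x : Matrix n n ℂ) (u : ℂ) : Matrix n n ℂ := u • x + (u • x)ᴴ

theorem isHermitian_hermPart (x : Matrix n n ℂ) (u : ℂ) : (hermPart x u).IsHermitian := by
  rw [Matrix.IsHermitian, hermPart, Matrix.conjTranspose_add, Matrix.conjTranspose_conjTranspose,
    add_comm]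

variable [Fintype n]

theorem trace_mul_conjTranspose_eq {A : Matrix n n ℂ} (hA : A.IsHermitian) (y : Matrix n n ℂ) :
    (A * yᴴ).trace = star (A * y).trace := by
  rw [← Matrix.trace_conjTranspose, Matrix.conjTranspose_mul, hA.eq, Matrix.trace_mul_comm]

/-- A matrix annihilated by the left Perron vector cannot be an eigenvector of a positivity improving
map for an eigenvalue on or outside the Perron circle. -/
theorem eq_zero_of_eigenvector {T : Matrix n n ℂ →ₗ[ℂ] Matrix n n ℂ} (hT : IsImproving T)
    (hstar : ∀ x, T xᴴ = (T x)ᴴ) {A ρ : Matrix n n ℂ} {l : ℝ} (hl : 0 < l) (hA : A.PosDef)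
    (hρ : ρ.PosDef) (hρ0 : ρ ≠ 0) (hTρ : T ρ = (l : ℂ) • ρ) {x : Matrix n n ℂ} {μ : ℂ}
    (hx : T x = μ • x) (hμ : l ≤ ‖μ‖) (hAx : (A * x).trace = 0) : x = 0 := by
  have hμ0 : 0 < ‖μ‖ := hl.trans_le hμ
  have hμne : μ ≠ 0 := norm_pos_iff.1 hμ0
  have hTc : Continuous T := T.continuous_of_finiteDimensional
  obtain ⟨τ, hτ⟩ : ∃ τ : ℝ, (A * ρ).trace = (τ : ℂ) := by
    have := trace_mul_nonneg hA.posSemidef hρ.posSemidef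
    exact ⟨_, (Complex.eq_re_of_ofReal_le this)⟩
  have hτ0 : 0 < τ := by
    have : A ≠ 0 := by
      rintro rfl
      have := trace_mul_pos hρ.posSemidef hρ0 hA
      simp at this
    have := trace_mul_pos hA.posSemidef this hρ
    rw [hτ] at this
    exact_mod_cast this
  -- A minorization of Doeblin type: T a ≥ δ Tr(A a) ρ, uniform on density matrices by compactness
  -- and extended to the cone by scaling.
  obtain ⟨δ, hδ, hδT⟩ : ∃ δ : ℝ, 0 < δ ∧ ∀ a : Matrix n n ℂ, a.PosSemidef →
      (T a - ((δ : ℂ) * (A * a).trace) • ρ).PosSemidef := by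
    have hne : ∀ a ∈ stateSet n, a ≠ 0 := by
      rintro a ha rfl
      have := ha.2
      simp at this
    obtain ⟨δ, hδ, h⟩ := exists_posSemidef_sub_smul (isCompact_stateSet.image hTc)
      (isCompact_stateSet.image (f := fun a : Matrix n n ℂ => (A * a).trace • ρ) (by fun_prop))
      (by rintro _ ⟨a, ha, rfl⟩; exact hT a ha.1 (hne a ha))
      (by
        rintro _ ⟨a, ha, rfl⟩
        exact (hρ.posSemidef.smul (trace_mul_nonneg hA.posSemidef ha.1)).1)
    refine ⟨δ, hδ, fun a ha => ?_⟩
    by_cases ha0 : a = 0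
    · simpa [ha0] using Matrix.PosSemidef.zero
    have htr : 0 < a.trace :=
      lt_of_le_of_ne ha.trace_nonneg fun h => ha0 (ha.trace_eq_zero_iff.1 h.symm)
    have hmem : (a.trace)⁻¹ • a ∈ stateSet n :=
      ⟨ha.smul (inv_pos.2 htr).le, by
        rw [Matrix.trace_smul, smul_eq_mul, inv_mul_cancel₀ htr.ne']⟩
    have h1 := (h _ ⟨_, hmem, rfl⟩ _ ⟨_, hmem, rfl⟩).smul htr.le
    convert h1 using 1
    simp only [map_smul, mul_smul_comm, Matrix.trace_smul, smul_eq_mul, smul_sub, smul_smul]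
    rw [mul_inv_cancel₀ htr.ne', one_smul]
    congr 2
    field_simp
  have hlδ : 0 ≤ l - δ * τ := by
    have h1 := hδT ρ hρ.posSemidef
    rw [hTρ, hτ, ← sub_smul] at h1
    have h2 := h1.trace_nonneg
    have : Nonempty n := by
      by_contra hcon
      rw [not_nonempty_iff] at hcon
      exact hρ0 (Subsingleton.elim _ _)
    rw [Matrix.trace_smul, smul_eq_mul] at h2
    have h3 := (Complex.pos_iff.1 hρ.trace_pos).1
    have h4 := (Complex.nonneg_iff.1 h2).1
    have e : ((l : ℂ) - (δ : ℂ) * (τ : ℂ)) = ((l - δ * τ : ℝ) : ℂ) := by push_cast; rfl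
    rw [e, Complex.re_ofReal_mul] at h4
    exact nonneg_of_mul_nonneg_left h4 h3
  let q : ℝ := (l - δ * τ) / ‖μ‖
  have hq0 : 0 ≤ q := by positivity
  have hq1 : q < 1 := by
    rw [div_lt_one hμ0]
    have : 0 < δ * τ := by positivity
    linarith
  have hAh : ∀ u : ℂ, (A * hermPart x u).trace = 0 := by
    intro u
    rw [hermPart, mul_add, Matrix.trace_add, trace_mul_conjTranspose_eq hA.1, mul_smul_comm,
      Matrix.trace_smul, hAx]
    simp
  -- All phases of x are bounded at once in the order unit ρ. Since Tr(A x) = 0, applying T with the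
  -- minorization replaces the bound s by (l - δτ)s / |μ| = qs with q < 1.
  let P : ℝ → Prop := fun s => ∀ u : ℂ, ‖u‖ = 1 → ((s : ℂ) • ρ - hermPart x u).PosSemidef
  have hstep : ∀ s : ℝ, P s → P (q * s) := by
    intro s hs u hu
    -- The phase is chosen so that u' μ = |μ| u, which turns the action of T on the Hermitian part
    -- into multiplication by |μ|.
    let u' : ℂ := u * (‖μ‖ / μ)
    have hu' : ‖u'‖ = 1 := by
      simp only [u', norm_mul, norm_div, Complex.norm_real, norm_norm, hu]
      rw [div_self hμ0.ne', one_mul]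
    have h1 := hδT _ (hs u' hu')
    have hTh : T (hermPart x u') = (‖μ‖ : ℂ) • hermPart x u := by
      rw [hermPart, map_add, hstar, map_smul, hx, hermPart, smul_smul, smul_add]
      have e : u' * μ = ‖μ‖ * u := by
        simp only [u']; field_simp
      rw [e, mul_smul, Matrix.conjTranspose_smul (‖μ‖ : ℂ) (u • x), Complex.star_def,
        Complex.conj_ofReal]
    rw [map_sub, map_smul, hTρ, hTh, mul_sub, Matrix.trace_sub, hAh, mul_smul_comm,
      Matrix.trace_smul, hτ, sub_zero] at h1
    have h2 := h1.smul (a := ((‖μ‖⁻¹ : ℝ) : ℂ)) (by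
      have := (inv_pos.2 hμ0).le
      exact_mod_cast this)
    convert h2 using 1
    have hne : (‖μ‖ : ℂ) ≠ 0 := by exact_mod_cast hμ0.ne'
    simp only [q, smul_sub, smul_smul, smul_eq_mul]
    push_cast
    rw [inv_mul_cancel₀ hne, one_smul, sub_right_comm, ← sub_smul]
    congr 2
    field_simp
  obtain ⟨s₀, hs₀⟩ : ∃ s, P s := by
    obtain ⟨ε, hε, h⟩ := exists_posSemidef_sub_smul (isCompact_singleton (x := ρ))
      ((isCompact_sphere (0 : ℂ) 1).image (f := hermPart x) (by unfold hermPart; fun_prop))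
      (by rintro _ rfl; exact hρ) (by rintro _ ⟨u, -, rfl⟩; exact isHermitian_hermPart x u)
    refine ⟨ε⁻¹, fun u hu => ?_⟩
    have h1 := (h _ rfl _ ⟨u, by simpa using hu, rfl⟩).smul (a := ((ε⁻¹ : ℝ) : ℂ)) (by
      have := (inv_pos.2 hε).le
      exact_mod_cast this)
    convert h1 using 1
    have hne : (ε : ℂ) ≠ 0 := by exact_mod_cast hε.ne'
    rw [smul_sub, smul_smul]
    push_cast
    rw [inv_mul_cancel₀ hne, one_smul]
  have hiter : ∀ k : ℕ, P (q ^ k * s₀) := by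
    intro k
    induction k with
    | zero => simpa using hs₀
    | succ k ih => rw [pow_succ', mul_assoc]; exact hstep _ ih
  have hP0 : ∀ u : ℂ, ‖u‖ = 1 → (-hermPart x u).PosSemidef := by
    intro u hu
    have h1 : Tendsto (fun k : ℕ => (((q ^ k * s₀ : ℝ) : ℂ) • ρ - hermPart x u)) atTop
        (𝓝 (((0 * s₀ : ℝ) : ℂ) • ρ - hermPart x u)) := by
      refine Tendsto.sub_const (Tendsto.smul_const ?_ ρ) _
      exact (Complex.continuous_ofReal.tendsto _).comp
        ((tendsto_pow_atTop_nhds_zero_of_lt_one hq0 hq1).mul_const s₀)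
    have h2 := isClosed_posSemidef.mem_of_tendsto h1 (Eventually.of_forall fun k => hiter k u hu)
    simpa using h2
  have hzero : ∀ u : ℂ, ‖u‖ = 1 → hermPart x u = 0 := by
    intro u hu
    have h1 := hP0 u hu
    have h2 := hP0 (-u) (by rwa [norm_neg])
    have e : hermPart x (-u) = -hermPart x u := by
      simp only [hermPart, neg_smul, Matrix.conjTranspose_neg]; abel
    rw [e, neg_neg] at h2
    have h3 := h1.trace_nonneg
    rw [Matrix.trace_neg] at h3
    exact h2.trace_eq_zero_iff.1 (le_antisymm (neg_nonneg.1 h3) h2.trace_nonneg)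
  -- The phases 1 and i say that x is anti-Hermitian and that ix is anti-Hermitian, which together
  -- force x = 0.
  have h1 := hzero 1 (by simp)
  have hI := hzero Complex.I (by simp)
  simp only [hermPart, one_smul] at h1
  rw [hermPart, Matrix.conjTranspose_smul, Complex.star_def, Complex.conj_I,
    eq_neg_of_add_eq_zero_right h1, smul_neg, neg_smul, neg_neg, ← add_smul, smul_eq_zero] at hI
  refine hI.resolve_left ?_
  rw [← two_mul]
  simp

/-- The quadratic form of T' a at v is Tr(a T(v v^*)), the trace of a nonzero positive matrix
against a positive definite one. -/
theorem IsImproving.dual {T T' : Matrix n n ℂ →ₗ[ℂ] Matrix n n ℂ} (hT : IsImproving T)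
    (hstar : ∀ x, T xᴴ = (T x)ᴴ) (hdual : ∀ a b, (T' a * b).trace = (a * T b).trace) :
    IsImproving T' := by
  classical
  intro a ha ha0
  have hher : (T' a).IsHermitian := by
    have key : ∀ y, ((T' a)ᴴ * y).trace = (T' a * y).trace := by
      intro y
      have h1 : ((T' a)ᴴ * y).trace = star (T' a * yᴴ).trace := by
        rw [← Matrix.trace_conjTranspose, Matrix.conjTranspose_mul,
          Matrix.conjTranspose_conjTranspose, Matrix.trace_mul_comm]
      rw [h1, hdual, hstar, trace_mul_conjTranspose_eq ha.1, star_star, hdual]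
    ext i j
    simpa [Matrix.trace_mul_single] using key (Matrix.single j i 1)
  refine Matrix.PosDef.of_dotProduct_mulVec_pos hher fun v hv => ?_
  have h1 : star v ⬝ᵥ (T' a *ᵥ v) = (T' a * Matrix.vecMulVec v (star v)).trace := by
    rw [Matrix.mul_vecMulVec, Matrix.trace_vecMulVec, dotProduct_comm]
  rw [h1, hdual]
  refine trace_mul_pos ha ha0 (hT _ (Matrix.posSemidef_vecMulVec_self_star v) fun h => hv ?_)
  have h2 := congrArg Matrix.trace h
  rw [Matrix.trace_vecMulVec, Matrix.trace_zero, dotProduct_comm, dotProduct_star_self_eq_zero] at h2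
  exact h2

/-- Perron-Frobenius theorem for a generator of a positivity improving semigroup, with a Perron
eigenvector in a given invariant compact set of states. -/
theorem perron_frobenius [Nonempty n] {Λ T' : Matrix n n ℂ →ₗ[ℂ] Matrix n n ℂ}
    (hstar : ∀ x, Λ xᴴ = (Λ x)ᴴ) (hstarT : ∀ x, lexp Λ xᴴ = (lexp Λ x)ᴴ)
    (hT : IsImproving (lexp Λ)) (hdual : ∀ a b, (T' a * b).trace = (a * lexp Λ b).trace)
    {K : Set (Matrix n n ℂ)} (hKs : K ⊆ stateSet n) (hK : IsCompact K)
    (hne : K.Nonempty) (hinv : ∀ ρ ∈ K, ((lexp Λ ρ).trace)⁻¹ • lexp Λ ρ ∈ K) :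
    ∃ (e : ℝ), ∃ σ ∈ K, Module.End.eigenspace Λ (e : ℂ) = Submodule.span ℂ {σ} ∧
      ∀ μ : ℂ, Module.End.HasEigenvalue Λ μ → μ ≠ (e : ℂ) → μ.re < e := by
  let T : Matrix n n ℂ →ₗ[ℂ] Matrix n n ℂ := (lexp Λ).toLinearMap
  have hT' : IsImproving T' := IsImproving.dual (T := T) hT hstarT hdual
  have hnorm : ∀ {S : Matrix n n ℂ →ₗ[ℂ] Matrix n n ℂ}, IsImproving S →
      ∀ ρ ∈ stateSet n, ((S ρ).trace)⁻¹ • S ρ ∈ stateSet n := by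
    intro S hS ρ hρ
    have hρ0 : ρ ≠ 0 := by
      rintro rfl
      have := hρ.2
      simp at this
    have h1 := hS ρ hρ.1 hρ0
    exact ⟨h1.posSemidef.smul (inv_pos.2 h1.trace_pos).le, by
      rw [Matrix.trace_smul, smul_eq_mul, inv_mul_cancel₀ h1.trace_pos.ne']⟩
  obtain ⟨ρ, hρK, l, hl, hTρ⟩ := exists_eigenvector_mem (T := T) hT hKs hK hne hinv
  obtain ⟨A, hA, l', hl', hTA⟩ := exists_eigenvector_mem hT' subset_rfl isCompact_stateSet
    ⟨ρ, hKs hρK⟩ (hnorm hT')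
  have hpos : ∀ {S : Matrix n n ℂ →ₗ[ℂ] Matrix n n ℂ} {ρ : Matrix n n ℂ} {l : ℝ},
      IsImproving S → ρ ∈ stateSet n → 0 < l → S ρ = (l : ℂ) • ρ → ρ ≠ 0 ∧ ρ.PosDef := by
    intro S ρ l hS hρ hl h
    have hρ0 : ρ ≠ 0 := by
      rintro rfl
      have := hρ.2
      simp at this
    refine ⟨hρ0, ?_⟩
    have h1 := (hS ρ hρ.1 hρ0).smul (inv_pos.2 (show (0 : ℂ) < l by exact_mod_cast hl))
    rwa [h, smul_smul, inv_mul_cancel₀ (by exact_mod_cast hl.ne'), one_smul] at h1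
  obtain ⟨hρ0, hρ⟩ := hpos (S := T) hT (hKs hρK) hl hTρ
  obtain ⟨hA0, hAp⟩ := hpos hT' hA hl' hTA
  have htr : 0 < (A * ρ).trace := trace_mul_pos hA.1 hA0 hρ
  -- The eigenvalues of T and of its dual coincide: evaluating Tr(A T ρ) in two ways gives l = l',
  -- because Tr(A ρ) > 0.
  have hAT : ∀ y, (A * T y).trace = (l : ℂ) * (A * y).trace := by
    have h1 : ∀ y, (A * T y).trace = (l' : ℂ) * (A * y).trace := by
      intro y
      have h2 : (A * T y).trace = (T' A * y).trace := (hdual A y).symm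
      rw [h2, hTA, smul_mul_assoc, Matrix.trace_smul, smul_eq_mul]
    have h2 := h1 ρ
    rw [hTρ, mul_smul_comm, Matrix.trace_smul, smul_eq_mul] at h2
    rw [mul_right_cancel₀ htr.ne' h2]
    exact h1
  -- Either Tr(A x) = 0 and x vanishes, or μ = l and subtracting the component of x along ρ reduces
  -- to that case.
  have hsub : ∀ (x : Matrix n n ℂ) (μ : ℂ), T x = μ • x → l ≤ ‖μ‖ → ∃ c : ℂ, x = c • ρ := by
    intro x μ hx hμ
    by_cases h0 : (A * x).trace = 0
    · refine ⟨0, ?_⟩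
      rw [zero_smul]
      exact eq_zero_of_eigenvector (T := T) hT hstarT hl hAp hρ hρ0 hTρ hx hμ h0
    · have h1 := hAT x
      rw [hx, mul_smul_comm, Matrix.trace_smul, smul_eq_mul] at h1
      have hμl := mul_right_cancel₀ h0 h1
      subst hμl
      refine ⟨(A * x).trace / (A * ρ).trace, sub_eq_zero.1 ?_⟩
      refine eq_zero_of_eigenvector (T := T) hT hstarT hl hAp hρ hρ0 hTρ (μ := (l : ℂ)) ?_ hμ ?_
      · rw [map_sub, hx, map_smul, hTρ, smul_sub, smul_comm]
      · rw [mul_sub, Matrix.trace_sub, mul_smul_comm, Matrix.trace_smul, smul_eq_mul,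
          div_mul_cancel₀ _ htr.ne', sub_self]
  have hln : ‖(l : ℂ)‖ = l := by rw [Complex.norm_real, Real.norm_of_nonneg hl.le]
  -- The generator commutes with its exponential, so Λρ lies in the one-dimensional eigenspace of ρ.
  -- The scalar c is real because Λ respects adjoints.
  obtain ⟨c, hc⟩ := hsub (Λ ρ) l (by
    change lexp Λ (Λ ρ) = _
    rw [← lexp_comm]
    change Λ (T ρ) = _
    rw [hTρ, map_smul]) hln.ge
  have hcre : ((c.re : ℝ) : ℂ) = c := by
    have h1 := hstar ρ
    rw [hρ.1.eq, hc, Matrix.conjTranspose_smul, hρ.1.eq] at h1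
    exact Complex.conj_eq_iff_re.1 ((smul_left_injective ℂ hρ0 h1).symm)
  have hel : Real.exp c.re = l := by
    have h1 : T ρ = Complex.exp c • ρ := lexp_eigenvector hc
    have h2 := smul_left_injective ℂ hρ0 (h1.symm.trans hTρ)
    rw [← hcre] at h2
    exact_mod_cast h2
  have hexp : ∀ (x : Matrix n n ℂ) (μ : ℂ), Λ x = μ • x → c.re ≤ μ.re → ∃ d : ℂ, x = d • ρ := by
    intro x μ hx hμ
    refine hsub x (Complex.exp μ) (lexp_eigenvector hx) ?_
    rw [Complex.norm_exp, ← hel]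
    exact Real.exp_le_exp.2 hμ
  refine ⟨c.re, ρ, hρK, ?_, ?_⟩
  · ext x
    rw [Module.End.mem_eigenspace_iff, Submodule.mem_span_singleton]
    constructor
    · intro hx
      obtain ⟨d, hd⟩ := hexp x _ hx (by simp)
      exact ⟨d, hd.symm⟩
    · rintro ⟨d, rfl⟩
      rw [map_smul, hc, hcre, smul_comm]
  · intro μ hμ hne
    obtain ⟨x, hx⟩ := hμ.exists_hasEigenvector
    by_contra hcon
    obtain ⟨d, rfl⟩ := hexp x μ hx.apply_eq_smul (not_lt.1 hcon)
    have h1 := hx.apply_eq_smul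
    rw [map_smul, hc, smul_comm] at h1
    exact hne ((smul_left_injective ℂ hx.2 h1).symm.trans hcre.symm)

end Dominance

end QuasiFree
end

noncomputable section
namespace QuasiFree

/-! ### Quadratic generators and their relation to the ladder operator. -/

section Generator

variable {L : ℕ}

/-- The jump part `∑ k l, B_{kl} a_l^* Y a_k` of a quadratic generator. -/
def jumpIn {N : Type*} [Fintype N] [DecidableEq N] (B : PhaseMap L L)
    (a : Fin L ⊕ Fin L → Matrix N N ℂ) : Matrix N N ℂ →ₗ[ℂ] Matrix N N ℂ :=
  ∑ k, ∑ l, B k l • (LinearMap.mulLeft ℂ (a l.swap) ∘ₗ LinearMap.mulRight ℂ (a k))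

theorem jumpIn_apply {N : Type*} [Fintype N] [DecidableEq N] (B : PhaseMap L L)
    (a : Fin L ⊕ Fin L → Matrix N N ℂ) (Y : Matrix N N ℂ) :
    jumpIn B a Y = ∑ k, ∑ l, B k l • (a l.swap * Y * a k) := by
  simp [jumpIn, LinearMap.sum_apply, mul_assoc]

/-- The linear map `Y ↦ D Y + Y D' + ∑ k l, B_{kl} a_l^* Y a_k`. -/
def genIn {N : Type*} [Fintype N] [DecidableEq N] (D D' : Matrix N N ℂ) (B : PhaseMap L L)
    (a : Fin L ⊕ Fin L → Matrix N N ℂ) : Matrix N N ℂ →ₗ[ℂ] Matrix N N ℂ :=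
  (LinearMap.mulLeft ℂ D + LinearMap.mulRight ℂ D') + jumpIn B a

theorem genIn_apply {N : Type*} [Fintype N] [DecidableEq N] (D D' : Matrix N N ℂ)
    (B : PhaseMap L L) (a : Fin L ⊕ Fin L → Matrix N N ℂ) (Y : Matrix N N ℂ) :
    genIn D D' B a Y = D * Y + Y * D' + jumpIn B a Y := by
  simp [genIn]

/-- The generator `ρ ↦ D ρ + ρ D^* + ∑ k l, B_{kl} φ(e_l)^* ρ φ(e_k)`. -/
def gen (D : FockOp L) (B : PhaseMap L L) : SuperOp L := genIn D Dᴴ B field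

theorem gen_apply (D : FockOp L) (B : PhaseMap L L) (ρ : FockOp L) :
    gen D B ρ = D * ρ + ρ * Dᴴ + jumpIn B field ρ := genIn_apply _ _ _ _ _

/-- Writing B = R^* R puts the jump part in Kraus form, with one Kraus operator for each row of R.
-/
theorem isPSDMap_jump {B : PhaseMap L L} (hB : B.PosSemidef) : IsPSDMap (jumpIn B (field (L := L))) := by
  intro ρ hρ
  obtain ⟨R, rfl⟩ := exists_eq_conjTranspose_mul_self hB
  have h : jumpIn (Rᴴ * R) field ρ = ∑ j, (∑ l, R j l • (field l.swap : FockOp L)) * ρ *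
      (∑ l, R j l • (field l.swap : FockOp L))ᴴ := by
    rw [jumpIn_apply]
    simp only [Matrix.conjTranspose_sum, Matrix.conjTranspose_smul, field_conjTranspose,
      Sum.swap_swap, Finset.sum_mul, Finset.mul_sum, Matrix.mul_apply, Finset.sum_smul,
      Matrix.conjTranspose_apply, smul_mul_assoc, mul_smul_comm]
    have h1 : ∀ k, ∑ l, ∑ j, (star (R j k) * R j l) • ((field l.swap : FockOp L) * ρ * field k) =
        ∑ j, ∑ l, (star (R j k) * R j l) • ((field l.swap : FockOp L) * ρ * field k) :=
      fun k => Finset.sum_comm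
    rw [Finset.sum_congr rfl fun k _ => h1 k, Finset.sum_comm]
    refine Finset.sum_congr rfl fun j _ => Finset.sum_congr rfl fun k _ => ?_
    simp only [Finset.smul_sum, smul_smul]
  rw [h]
  exact Matrix.posSemidef_sum _ fun j _ => hρ.mul_mul_conjTranspose_same _

theorem jump_conjTranspose {B : PhaseMap L L} (hB : B.IsHermitian) (ρ : FockOp L) :
    jumpIn B field ρᴴ = (jumpIn B field ρ)ᴴ := by
  rw [jumpIn_apply, jumpIn_apply, Finset.sum_comm]
  simp only [Matrix.conjTranspose_sum, Matrix.conjTranspose_smul, Matrix.conjTranspose_mul,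
    field_conjTranspose, Sum.swap_swap, hB.apply, mul_assoc]

theorem gen_conjTranspose (D : FockOp L) {B : PhaseMap L L} (hB : B.IsHermitian) (ρ : FockOp L) :
    gen D B ρᴴ = (gen D B ρ)ᴴ := by
  rw [gen_apply, gen_apply, jump_conjTranspose hB]
  simp only [Matrix.conjTranspose_add, Matrix.conjTranspose_mul, Matrix.conjTranspose_conjTranspose]
  rw [add_comm (D * ρᴴ)]

/-- Conjugation with the parity operator. -/
def parityConj (L : ℕ) : SuperOp L :=
  LinearMap.mulLeft ℂ (parity L) ∘ₗ LinearMap.mulRight ℂ (parity L)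

theorem parityConj_apply (ρ : FockOp L) : parityConj L ρ = parity L * ρ * parity L := by
  simp [parityConj, mul_assoc]

theorem parityConj_mul (ρ σ : FockOp L) : parityConj L (ρ * σ) = parityConj L ρ * parityConj L σ := by
  simp only [parityConj_apply]
  calc parity L * (ρ * σ) * parity L = parity L * ρ * 1 * σ * parity L := by noncomm_ring
    _ = _ := by rw [← parity_mul_self]; noncomm_ring

theorem parityConj_field (k : Fin L ⊕ Fin L) : parityConj L (field k) = -field k := by
  rw [parityConj_apply, parity_mul_field, neg_mul, mul_assoc, parity_mul_self, mul_one]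

theorem gen_parityConj {D : FockOp L} (hD : parityConj L D = D) (B : PhaseMap L L) (ρ : FockOp L) :
    gen D B (parityConj L ρ) = parityConj L (gen D B ρ) := by
  have hD' : parityConj L Dᴴ = Dᴴ := by
    have := congrArg Matrix.conjTranspose hD
    rw [parityConj_apply] at this ⊢
    simpa [parity_conjTranspose, mul_assoc] using this
  rw [gen_apply, gen_apply, map_add, map_add, parityConj_mul, parityConj_mul, hD, hD',
    jumpIn_apply, jumpIn_apply]
  simp only [map_sum, map_smul, parityConj_mul, parityConj_field, neg_mul, mul_neg, neg_neg]

/-- `F^* E F` in terms of fields. -/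
theorem quadratic_eq (E : PhaseMap L L) :
    quadratic E = ∑ k, ∑ l, E k l • (field k * field l.swap : FockOp L) := by
  simp only [quadratic, field_conjTranspose]

theorem quadratic_conjTranspose (E : PhaseMap L L) : (quadratic E)ᴴ = quadratic Eᴴ := by
  rw [quadratic, quadratic, Finset.sum_comm]
  simp only [Matrix.conjTranspose_sum, Matrix.conjTranspose_smul, Matrix.conjTranspose_mul,
    Matrix.conjTranspose_conjTranspose, Matrix.conjTranspose_apply]

theorem quadratic_add (E E' : PhaseMap L L) : quadratic (E + E') = quadratic E + quadratic E' := by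
  simp only [quadratic, Matrix.add_apply, add_smul, Finset.sum_add_distrib]

theorem quadratic_smul (c : ℂ) (E : PhaseMap L L) : quadratic (c • E) = c • quadratic E := by
  simp only [quadratic, Matrix.smul_apply, smul_assoc, Finset.smul_sum]

theorem parityConj_quadratic (E : PhaseMap L L) : parityConj L (quadratic E) = quadratic E := by
  rw [quadratic_eq]
  simp only [map_sum, map_smul, parityConj_mul, parityConj_field, neg_mul, mul_neg, neg_neg]

theorem xiTranspose_apply (E : PhaseMap L L) (k l : Fin L ⊕ Fin L) :
    xiTranspose E k l = E l.swap k.swap := by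
  simp [xiTranspose, xiConj]

/-- `[F^* E F, φ(e_m)] = φ((E - E^T) e_m)`. -/
theorem quadratic_commutator (E : PhaseMap L L) (m : Fin L ⊕ Fin L) :
    quadratic E * field m - field m * quadratic E = ∑ k, (E - xiTranspose E) k m • field k := by
  have h : ∀ k l : Fin L ⊕ Fin L, (field k * field l.swap * field m -
      field m * (field k * field l.swap) : FockOp L) =
      (if l = m then field k else 0) - if k = m.swap then field l.swap else 0 := by
    intro k l
    have h1 := field_anticomm l.swap m
    have h2 := field_anticomm k m
    have h3 : (l.swap = m.swap) = (l = m) := propext Sum.swap_leftInverse.injective.eq_iff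
    simp only [h3] at h1
    calc (field k * field l.swap * field m - field m * (field k * field l.swap) : FockOp L)
        = field k * (field l.swap * field m + field m * field l.swap) -
          (field k * field m + field m * field k) * field l.swap := by noncomm_ring
      _ = _ := by
        rw [h1, h2]
        congr 1 <;> split_ifs <;> simp
  rw [quadratic_eq]
  simp only [Finset.sum_mul, Finset.mul_sum, smul_mul_assoc, mul_smul_comm,
    ← Finset.sum_sub_distrib, ← smul_sub, h]
  simp only [smul_sub, Finset.sum_sub_distrib, smul_ite, smul_zero, Finset.sum_ite_eq',
    Finset.mem_univ, if_true, Matrix.sub_apply, sub_smul, xiTranspose_apply]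
  congr 1
  rw [Finset.sum_comm]
  simp only [Finset.sum_ite_eq', Finset.mem_univ, if_true]
  exact Fintype.sum_equiv (Equiv.sumComm _ _) _ _ fun l => by simp

/-- The ladder operator anticommutes with a field of one copy up to the same field of the other
copy. The two copies commute here: no parity twist is inserted between the factors. -/
theorem ladder_mul_left (m : Fin L ⊕ Fin L) :
    ladder L * (field m ⊗ₖ (1 : FockOp L)) =
      ((1 : FockOp L) ⊗ₖ field m) - (field m ⊗ₖ (1 : FockOp L)) * ladder L := by
  have h : ∀ k : Fin L ⊕ Fin L, (field k ⊗ₖ field k.swap : Matrix _ _ ℂ) * (field m ⊗ₖ (1 : FockOp L)) =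
      (if k = m.swap then ((1 : FockOp L) ⊗ₖ field m) else 0) -
        (field m ⊗ₖ (1 : FockOp L)) * (field k ⊗ₖ field k.swap) := by
    intro k
    rw [← Matrix.mul_kronecker_mul, ← Matrix.mul_kronecker_mul, one_mul, mul_one,
      eq_sub_iff_add_eq, ← Matrix.add_kronecker, field_anticomm]
    split_ifs with hk
    · rw [hk, Sum.swap_swap]
    · simp
  rw [ladder, Finset.sum_mul, Finset.mul_sum, Finset.sum_congr rfl fun k _ => h k,
    Finset.sum_sub_distrib]
  simp

theorem ladder_mul_right (m : Fin L ⊕ Fin L) :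
    ladder L * ((1 : FockOp L) ⊗ₖ field m) =
      (field m ⊗ₖ (1 : FockOp L)) - ((1 : FockOp L) ⊗ₖ field m) * ladder L := by
  have h : ∀ k : Fin L ⊕ Fin L, (field k ⊗ₖ field k.swap : Matrix _ _ ℂ) * ((1 : FockOp L) ⊗ₖ field m) =
      (if k = m then (field m ⊗ₖ (1 : FockOp L)) else 0) -
        ((1 : FockOp L) ⊗ₖ field m) * (field k ⊗ₖ field k.swap) := by
    intro k
    have h3 : (k.swap = m.swap) = (k = m) := propext Sum.swap_leftInverse.injective.eq_iff
    rw [← Matrix.mul_kronecker_mul, ← Matrix.mul_kronecker_mul, one_mul, mul_one,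
      eq_sub_iff_add_eq, ← Matrix.kronecker_add, field_anticomm]
    simp only [h3]
    split_ifs with hk
    · rw [hk]
    · simp
  rw [ladder, Finset.sum_mul, Finset.mul_sum, Finset.sum_congr rfl fun k _ => h k,
    Finset.sum_sub_distrib]
  simp

/-- `D ⊗ 1 + 1 ⊗ D`. -/
def doubled (D : FockOp L) : Matrix (Finset (Fin L) × Finset (Fin L))
    (Finset (Fin L) × Finset (Fin L)) ℂ :=
  (D ⊗ₖ (1 : FockOp L)) + ((1 : FockOp L) ⊗ₖ D)

/-- The commutator acts on fields through E - E^T, which is antisymmetric for the pairing contracted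
in the ladder operator; the contributions of the two copies cancel. -/
theorem ladder_comm_doubled_quadratic (E : PhaseMap L L) :
    ladder L * doubled (quadratic E) = doubled (quadratic E) * ladder L := by
  set a : PhaseMap L L := E - xiTranspose E
  have ha : ∀ k l, a l.swap k.swap = -a k l := by
    intro k l
    simp only [a, Matrix.sub_apply, xiTranspose_apply, Sum.swap_swap]
    ring
  symm
  rw [← sub_eq_zero, doubled, ladder, Finset.mul_sum, Finset.sum_mul, ← Finset.sum_sub_distrib]
  have h : ∀ m : Fin L ⊕ Fin L, ((quadratic E ⊗ₖ (1 : FockOp L)) + ((1 : FockOp L) ⊗ₖ quadratic E)) *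
      (field m ⊗ₖ field m.swap) - (field m ⊗ₖ field m.swap) *
      ((quadratic E ⊗ₖ (1 : FockOp L)) + ((1 : FockOp L) ⊗ₖ quadratic E)) =
      ∑ k, (a k m • (field k ⊗ₖ field m.swap : Matrix _ _ ℂ)) +
        ∑ k, (a k m.swap • (field m ⊗ₖ field k : Matrix _ _ ℂ)) := by
    intro m
    simp only [add_mul, mul_add, ← Matrix.mul_kronecker_mul, one_mul, mul_one]
    have h1 : (quadratic E * field m) = field m * quadratic E + ∑ k, a k m • field k := by
      rw [← quadratic_commutator]; abel
    have h2 : (quadratic E * field m.swap) =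
        field m.swap * quadratic E + ∑ k, a k m.swap • field k := by
      rw [← quadratic_commutator]; abel
    have hl : (∑ k, a k m • field k) ⊗ₖ (field m.swap : FockOp L) =
        ∑ k, a k m • (field k ⊗ₖ field m.swap : Matrix _ _ ℂ) := by
      ext ⟨p, q⟩ ⟨r, s⟩
      simp only [Matrix.kroneckerMap_apply, Matrix.sum_apply, Matrix.smul_apply, smul_eq_mul,
        Finset.sum_mul, mul_assoc]
    have hr : (field m : FockOp L) ⊗ₖ (∑ k, a k m.swap • field k : FockOp L) =
        ∑ k, a k m.swap • (field m ⊗ₖ field k : Matrix _ _ ℂ) := by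
      ext ⟨p, q⟩ ⟨r, s⟩
      simp only [Matrix.kroneckerMap_apply, Matrix.sum_apply, Matrix.smul_apply, smul_eq_mul,
        Finset.mul_sum, mul_left_comm]
    rw [h1, h2, Matrix.add_kronecker, Matrix.kronecker_add, hl, hr]
    abel
  rw [Finset.sum_congr rfl fun m _ => h m, Finset.sum_add_distrib]
  have h2 : ∑ m, ∑ k, (a k (Sum.swap m) • (field m ⊗ₖ field k : Matrix _ _ ℂ)) =
      ∑ k, ∑ m, (a (Sum.swap m) (Sum.swap k) • (field k ⊗ₖ field m.swap : Matrix _ _ ℂ)) := by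
    refine Finset.sum_congr rfl fun k _ => ?_
    exact Fintype.sum_equiv (Equiv.sumComm _ _) _ _ fun l => by simp
  rw [h2, Finset.sum_comm, ← Finset.sum_add_distrib]
  refine Finset.sum_eq_zero fun k _ => ?_
  rw [← Finset.sum_add_distrib]
  refine Finset.sum_eq_zero fun l _ => ?_
  rw [ha, neg_smul, add_neg_cancel]

end Generator

end QuasiFree
end

noncomputable section
namespace QuasiFree

open Filter Topology

/-! ### Invariance of Gaussian operators and quasi-free states. -/

section GaussianFlow

open scoped Matrix.Norms.Operator

variable {L : ℕ}

/-- The generator acting on the first factor. -/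
def genLeft (D : FockOp L) (B : PhaseMap L L) :=
  genIn (D ⊗ₖ (1 : FockOp L)) (Dᴴ ⊗ₖ (1 : FockOp L)) B fun k => (field k ⊗ₖ (1 : FockOp L))

/-- The generator acting on the second factor. -/
def genRight (D : FockOp L) (B : PhaseMap L L) :=
  genIn ((1 : FockOp L) ⊗ₖ D) ((1 : FockOp L) ⊗ₖ Dᴴ) B fun k => ((1 : FockOp L) ⊗ₖ field k)

theorem sum_kronecker {ι : Type*} (s : Finset ι) (f : ι → FockOp L) (σ : FockOp L) :
    (∑ k ∈ s, f k) ⊗ₖ σ = ∑ k ∈ s, (f k ⊗ₖ σ) := by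
  ext ⟨p, q⟩ ⟨r, t⟩
  simp only [Matrix.kroneckerMap_apply, Matrix.sum_apply, Finset.sum_mul]

theorem kronecker_sum {ι : Type*} (s : Finset ι) (f : ι → FockOp L) (σ : FockOp L) :
    σ ⊗ₖ (∑ k ∈ s, f k) = ∑ k ∈ s, (σ ⊗ₖ f k) := by
  ext ⟨p, q⟩ ⟨r, t⟩
  simp only [Matrix.kroneckerMap_apply, Matrix.sum_apply, Finset.mul_sum]

theorem genLeft_kronecker (D : FockOp L) (B : PhaseMap L L) (ρ σ : FockOp L) :
    genLeft D B (ρ ⊗ₖ σ) = gen D B ρ ⊗ₖ σ := by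
  rw [genLeft, genIn_apply, gen_apply, jumpIn_apply, jumpIn_apply]
  simp only [← Matrix.mul_kronecker_mul, one_mul, mul_one, Matrix.add_kronecker, sum_kronecker,
    Matrix.smul_kronecker]

theorem genRight_kronecker (D : FockOp L) (B : PhaseMap L L) (ρ σ : FockOp L) :
    genRight D B (ρ ⊗ₖ σ) = ρ ⊗ₖ gen D B σ := by
  rw [genRight, genIn_apply, gen_apply, jumpIn_apply, jumpIn_apply]
  simp only [← Matrix.mul_kronecker_mul, one_mul, mul_one, Matrix.kronecker_add, kronecker_sum,
    Matrix.kronecker_smul]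

theorem linearMap_ext_kronecker {m n V : Type*} [Fintype m] [Fintype n] [DecidableEq m]
    [DecidableEq n] [AddCommMonoid V] [Module ℂ V] {f h : Matrix (m × n) (m × n) ℂ →ₗ[ℂ] V}
    (H : ∀ (a : Matrix m m ℂ) (b : Matrix n n ℂ), f (a ⊗ₖ b) = h (a ⊗ₖ b)) : f = h := by
  refine LinearMap.ext fun Y => ?_
  rw [Matrix.matrix_eq_sum_single Y, map_sum, map_sum]
  refine Finset.sum_congr rfl fun p _ => ?_
  rw [map_sum, map_sum]
  refine Finset.sum_congr rfl fun q _ => ?_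
  have := H (Matrix.single p.1 q.1 (Y p q)) (Matrix.single p.2 q.2 1)
  rwa [Matrix.single_kronecker_single, mul_one] at this

theorem genLeft_commute_genRight (D : FockOp L) (B : PhaseMap L L) :
    Commute (genLeft D B) (genRight D B) := by
  refine linearMap_ext_kronecker fun ρ σ => ?_
  simp only [Module.End.mul_apply, genLeft_kronecker, genRight_kronecker]

theorem lexp_kronecker (D : FockOp L) (B : PhaseMap L L) (t : ℂ) (ρ σ : FockOp L) :
    lexp (t • (genLeft D B + genRight D B)) (ρ ⊗ₖ σ) =
      lexp (t • gen D B) ρ ⊗ₖ lexp (t • gen D B) σ := by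
  have h1 : ∀ ρ σ : FockOp L, lexp (t • genLeft D B) (ρ ⊗ₖ σ) = lexp (t • gen D B) ρ ⊗ₖ σ := by
    intro ρ σ
    let ι : FockOp L →ₗ[ℂ] Matrix (Finset (Fin L) × Finset (Fin L)) _ ℂ :=
      { toFun := fun x => x ⊗ₖ σ
        map_add' := fun x y => Matrix.add_kronecker x y σ
        map_smul' := fun c x => Matrix.smul_kronecker c x σ }
    exact lexp_intertwine ι (fun x => by
      simp only [ι, LinearMap.coe_mk, AddHom.coe_mk, LinearMap.smul_apply, genLeft_kronecker,
        Matrix.smul_kronecker]) ρ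
  have h2 : ∀ ρ σ : FockOp L, lexp (t • genRight D B) (ρ ⊗ₖ σ) = ρ ⊗ₖ lexp (t • gen D B) σ := by
    intro ρ σ
    let ι : FockOp L →ₗ[ℂ] Matrix (Finset (Fin L) × Finset (Fin L)) _ ℂ :=
      { toFun := fun x => ρ ⊗ₖ x
        map_add' := fun x y => Matrix.kronecker_add ρ x y
        map_smul' := fun c x => Matrix.kronecker_smul c ρ x }
    exact lexp_intertwine ι (fun x => by
      simp only [ι, LinearMap.coe_mk, AddHom.coe_mk, LinearMap.smul_apply, genRight_kronecker,
        Matrix.kronecker_smul]) σ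
  rw [smul_add, lexp_add_apply (((genLeft_commute_genRight D B).smul_left t).smul_right t), h2, h1]

/-- The commutator with the ladder operator. -/
def ladderAd (L : ℕ) : Matrix (Finset (Fin L) × Finset (Fin L)) (Finset (Fin L) × Finset (Fin L)) ℂ →ₗ[ℂ]
    Matrix (Finset (Fin L) × Finset (Fin L)) (Finset (Fin L) × Finset (Fin L)) ℂ :=
  LinearMap.mulLeft ℂ (ladder L) - LinearMap.mulRight ℂ (ladder L)

theorem ladderAd_apply (Y) : ladderAd L Y = ladder L * Y - Y * ladder L := by simp [ladderAd]

/-- The map that intertwines the doubled generator through the commutator with the ladder operator. -/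
def genTwist (E : PhaseMap L L) (B : PhaseMap L L) :=
  LinearMap.mulLeft ℂ (doubled (quadratic E)) + LinearMap.mulRight ℂ (doubled (quadratic E)ᴴ) -
    (jumpIn B (fun k => (field k ⊗ₖ (1 : FockOp L))) + jumpIn B fun k => ((1 : FockOp L) ⊗ₖ field k))

/-- The drift commutes with the commutator by `ladder_comm_doubled_quadratic`. In the jump part,
exchanging copies creates cross terms that cancel once both copies are summed, leaving a sign
change. The target map is thus the drift minus the jumps. -/
theorem ladderAd_gen (E B : PhaseMap L L) (Y) :
    ladderAd L ((genLeft (quadratic E) B + genRight (quadratic E) B) Y) =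
      genTwist E B (ladderAd L Y) := by
  have hD := ladder_comm_doubled_quadratic E
  have hD' : ladder L * doubled (quadratic E)ᴴ = doubled (quadratic E)ᴴ * ladder L := by
    rw [quadratic_conjTranspose]; exact ladder_comm_doubled_quadratic _
  have hsum : (genLeft (quadratic E) B + genRight (quadratic E) B) Y =
      doubled (quadratic E) * Y + Y * doubled (quadratic E)ᴴ +
        (jumpIn B (fun k => (field k ⊗ₖ (1 : FockOp L))) Y +
          jumpIn B (fun k => ((1 : FockOp L) ⊗ₖ field k)) Y) := by
    rw [LinearMap.add_apply, genLeft, genRight, genIn_apply, genIn_apply, doubled, doubled]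
    noncomm_ring
  have hjump : ladderAd L (jumpIn B (fun k => (field k ⊗ₖ (1 : FockOp L))) Y +
      jumpIn B (fun k => ((1 : FockOp L) ⊗ₖ field k)) Y) =
      -(jumpIn B (fun k => (field k ⊗ₖ (1 : FockOp L))) (ladderAd L Y) +
        jumpIn B (fun k => ((1 : FockOp L) ⊗ₖ field k)) (ladderAd L Y)) := by
    simp only [jumpIn_apply, ← Finset.sum_add_distrib, ← smul_add, map_sum, map_smul,
      ← Finset.sum_neg_distrib, ← smul_neg]
    refine Finset.sum_congr rfl fun k _ => Finset.sum_congr rfl fun l _ => ?_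
    congr 1
    have hl := ladder_mul_left l.swap
    have hr := ladder_mul_right l.swap
    have hl' : (field k ⊗ₖ (1 : FockOp L)) * ladder L =
        ((1 : FockOp L) ⊗ₖ field k) - ladder L * (field k ⊗ₖ (1 : FockOp L)) := by
      rw [ladder_mul_left]; abel
    have hr' : ((1 : FockOp L) ⊗ₖ field k) * ladder L =
        (field k ⊗ₖ (1 : FockOp L)) - ladder L * ((1 : FockOp L) ⊗ₖ field k) := by
      rw [ladder_mul_right]; abel
    simp only [ladderAd_apply]
    generalize (field k ⊗ₖ (1 : FockOp L)) = a at *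
    generalize ((1 : FockOp L) ⊗ₖ field k) = b at *
    generalize (field l.swap ⊗ₖ (1 : FockOp L)) = c at *
    generalize ((1 : FockOp L) ⊗ₖ field l.swap) = d at *
    calc ladder L * (c * Y * a + d * Y * b) - (c * Y * a + d * Y * b) * ladder L
        = (ladder L * c) * Y * a + (ladder L * d) * Y * b - c * Y * (a * ladder L) -
            d * Y * (b * ladder L) := by noncomm_ring
      _ = -(c * (ladder L * Y - Y * ladder L) * a + d * (ladder L * Y - Y * ladder L) * b) := by
          rw [hl, hr, hl', hr']; noncomm_ring
  rw [hsum, map_add, hjump, genTwist, LinearMap.sub_apply, LinearMap.add_apply, LinearMap.add_apply,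
    LinearMap.mulLeft_apply, LinearMap.mulRight_apply, ← sub_eq_add_neg]
  congr 1
  simp only [ladderAd_apply]
  generalize doubled (quadratic E) = X at *
  generalize doubled (quadratic E)ᴴ = Z at *
  calc ladder L * (X * Y + Y * Z) - (X * Y + Y * Z) * ladder L
      = (ladder L * X) * Y + ladder L * Y * Z - X * Y * ladder L - Y * (Z * ladder L) := by
        noncomm_ring
    _ = X * (ladder L * Y - Y * ladder L) + (ladder L * Y - Y * ladder L) * Z := by
        rw [hD, ← hD']; noncomm_ring

/-- The infinitesimal form of the invariance, used to control the higher moments in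
`IsGaussian.gen_eq_smul`. -/
theorem ladderAd_gen_kronecker_eq_zero (E B : PhaseMap L L) {ρ : FockOp L}
    (h : ladder L * (ρ ⊗ₖ ρ) = (ρ ⊗ₖ ρ) * ladder L) :
    ladderAd L ((gen (quadratic E) B ρ ⊗ₖ ρ) + (ρ ⊗ₖ gen (quadratic E) B ρ)) = 0 := by
  rw [← genLeft_kronecker, ← genRight_kronecker, ← LinearMap.add_apply, ladderAd_gen,
    ladderAd_apply, h, sub_self, map_zero]

/-- Quadratic semigroups preserve Gaussian operators. -/
theorem IsGaussian.lexp_gen (E B : PhaseMap L L) {ρ : FockOp L} (h : IsGaussian ρ) (t : ℂ) :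
    IsGaussian (lexp (t • gen (quadratic E) B) ρ) := by
  constructor
  · rw [← parityConj_apply, ← lexp_intertwine (parityConj L) (Λ := t • gen (quadratic E) B), parityConj_apply,
      h.even]
    intro x
    rw [LinearMap.smul_apply, LinearMap.smul_apply, map_smul,
      gen_parityConj (parityConj_quadratic E)]
  · rw [← sub_eq_zero, ← ladderAd_apply, ← lexp_kronecker,
      ← lexp_intertwine (ladderAd L) (Λ' := t • genTwist E B), ladderAd_apply, h.ladder_comm,
      sub_self, map_zero]
    intro x
    rw [LinearMap.smul_apply, LinearMap.smul_apply, map_smul, ladderAd_gen]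

theorem IsGaussian.smul {ρ : FockOp L} (h : IsGaussian ρ) (c : ℂ) : IsGaussian (c • ρ) := by
  constructor
  · rw [mul_smul_comm, smul_mul_assoc, h.even]
  · rw [Matrix.smul_kronecker, Matrix.kronecker_smul, mul_smul_comm, mul_smul_comm, smul_mul_assoc,
      smul_mul_assoc, h.ladder_comm]

theorem isGaussian_one : IsGaussian (1 : FockOp L) := by
  constructor
  · rw [mul_one, parity_mul_self]
  · rw [Matrix.one_kronecker_one, mul_one, one_mul]

theorem isClosed_isGaussian : IsClosed {ρ : FockOp L | IsGaussian ρ} := by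
  have : {ρ : FockOp L | IsGaussian ρ} = {ρ | parity L * ρ * parity L = ρ} ∩
      {ρ | ladder L * (ρ ⊗ₖ ρ) = (ρ ⊗ₖ ρ) * ladder L} := by
    ext ρ
    exact ⟨fun h => ⟨h.1, h.2⟩, fun h => ⟨h.1, h.2⟩⟩
  have hk : Continuous fun ρ : FockOp L => (ρ ⊗ₖ ρ) := by
    refine continuous_matrix fun i j => ?_
    simp only [Matrix.kroneckerMap_apply]
    fun_prop
  rw [this]
  exact (isClosed_eq (by fun_prop) continuous_id).inter
    (isClosed_eq (continuous_const.mul hk) (hk.mul continuous_const))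

/-- The set of quasi-free states. -/
def quasiFreeSet (L : ℕ) : Set (FockOp L) := {ρ | IsQuasiFree ρ}

theorem quasiFreeSet_eq : quasiFreeSet L = stateSet (Finset (Fin L)) ∩ {ρ | IsGaussian ρ} := by
  ext ρ
  exact ⟨fun h => ⟨h.isState, h.isGaussian⟩, fun h => h.2.isQuasiFree h.1⟩

theorem isCompact_quasiFreeSet : IsCompact (quasiFreeSet L) := by
  rw [quasiFreeSet_eq]
  exact isCompact_stateSet.inter_right isClosed_isGaussian

theorem quasiFreeSet_nonempty : (quasiFreeSet L).Nonempty := by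
  have htr : (1 : FockOp L).trace ≠ 0 := by
    rw [Matrix.trace_one]; exact_mod_cast Fintype.card_ne_zero
  refine ⟨((1 : FockOp L).trace)⁻¹ • 1, IsGaussian.isQuasiFree ⟨?_, ?_⟩ (isGaussian_one.smul _)⟩
  · refine Matrix.PosSemidef.one.smul (inv_nonneg.2 ?_)
    exact Matrix.PosSemidef.one.trace_nonneg
  · rw [Matrix.trace_smul, smul_eq_mul, inv_mul_cancel₀ htr]

theorem isPSDMap_lexp_gen (D : FockOp L) {B : PhaseMap L L} (hB : B.PosSemidef) (t : ℝ)
    (ht : 0 ≤ t) : IsPSDMap (lexp ((t : ℂ) • gen D B)) :=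
  IsPSDMap.lexp_add (fun s _ => isPSDMap_lexp_mulLeft_add_mulRight D s) (isPSDMap_jump hB) t ht

/-- Quadratic semigroups map quasi-free states to positive multiples of quasi-free states. -/
theorem IsQuasiFree.lexp_gen (E : PhaseMap L L) {B : PhaseMap L L} (hB : B.PosSemidef)
    {ρ : FockOp L} (h : IsQuasiFree ρ) (t : ℝ) (ht : 0 ≤ t) :
    0 < (lexp ((t : ℂ) • gen (quadratic E) B) ρ).trace ∧
      IsQuasiFree ((lexp ((t : ℂ) • gen (quadratic E) B) ρ).trace⁻¹ •
        lexp ((t : ℂ) • gen (quadratic E) B) ρ) := by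
  have h1 := isPSDMap_lexp_gen (quadratic E) hB t ht ρ h.isState.1
  -- Exponentials are invertible, so the flow cannot annihilate a state; a nonzero positive matrix
  -- has positive trace.
  have h2 : lexp ((t : ℂ) • gen (quadratic E) B) ρ ≠ 0 := by
    intro h0
    have h3 := lexp_neg_lexp ((t : ℂ) • gen (quadratic E) B) ρ
    rw [h0, map_zero] at h3
    have h4 := h.isState.2
    rw [← h3] at h4
    simp at h4
  have h3 : 0 < (lexp ((t : ℂ) • gen (quadratic E) B) ρ).trace :=
    lt_of_le_of_ne h1.trace_nonneg fun h => h2 (h1.trace_eq_zero_iff.1 h.symm)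
  refine ⟨h3, IsGaussian.isQuasiFree ⟨h1.smul (inv_pos.2 h3).le, ?_⟩
    ((h.isGaussian.lexp_gen E B t).smul _)⟩
  rw [Matrix.trace_smul, smul_eq_mul, inv_mul_cancel₀ h3.ne']

end GaussianFlow

end QuasiFree
end

noncomputable section
namespace QuasiFree

/-! ### Evolution of the trace and of the covariance. -/

section Moments

variable {L : ℕ}

theorem cov_apply (ρ : FockOp L) (k l : Fin L ⊕ Fin L) :
    cov ρ k l = expect ρ (field k.swap * field l) := by
  rw [cov, Matrix.of_apply, field_conjTranspose, expect_apply]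

/-- The two-point function in terms of the covariance matrix. -/
theorem expect_field_mul_field_swap {ρ : FockOp L} (h1 : ρ.trace = 1) (k l : Fin L ⊕ Fin L) :
    expect ρ (field k * field l.swap) = (1 - cov ρ) l k := by
  have h := isAnticommFamily_field.mul_comm_sub k l.swap
  rw [h, map_sub, map_smul, ← cov_apply, expect_apply, mul_one, h1, Sum.swap_swap,
    Matrix.sub_apply, Matrix.one_apply]
  simp [eq_comm]

theorem sum_mul_mul (X E Y : PhaseMap L L) (a b : Fin L ⊕ Fin L) :
    ∑ k, ∑ l, E k l * (X a k * Y l b) = (X * E * Y) a b := by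
  simp only [Matrix.mul_apply, Finset.sum_mul]
  rw [Finset.sum_comm]
  exact Finset.sum_congr rfl fun k _ => Finset.sum_congr rfl fun l _ => by ring

theorem sum_swap_mul_mul (X E Y : PhaseMap L L) (a b : Fin L ⊕ Fin L) :
    ∑ k, ∑ l, E k l * (X a l.swap * Y k.swap b) = (X * xiTranspose E * Y) a b := by
  rw [← sum_mul_mul, Finset.sum_comm]
  refine Fintype.sum_equiv (Equiv.sumComm _ _) _ _ fun k => ?_
  refine Fintype.sum_equiv (Equiv.sumComm _ _) _ _ fun l => ?_
  simp [xiTranspose_apply]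

theorem sum_mul_eq_trace (E N : PhaseMap L L) : ∑ k, ∑ l, E k l * N l k = (E * N).trace := by
  simp only [Matrix.trace, Matrix.diag_apply, Matrix.mul_apply]

/-- The Wick formula for four fields. -/
theorem IsGaussian.four_point {ρ : FockOp L} (h : IsGaussian ρ) (h1 : ρ.trace = 1)
    (a b c d : Fin L ⊕ Fin L) :
    expect ρ (field a * field b * (field c * field d)) =
      expect ρ (field a * field b) * expect ρ (field c * field d) -
      expect ρ (field a * field c) * expect ρ (field b * field d) +
      expect ρ (field a * field d) * expect ρ (field b * field c) := by
  have hone : expect ρ 1 = 1 := by rw [expect_apply, mul_one]; exact h1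
  have h2 := isAnticommFamily_field.wick_recursion one_ne_zero hone
    (defect_field_eq_zero h.ladder_comm) a (n := 2) even_two ![b, c, d]
  rw [Fin.sum_univ_three] at h2
  simp only [orderedProd, List.ofFn_succ, List.ofFn_zero, List.prod_cons, List.prod_nil] at h2
  simp [Fin.succAbove, Fin.lt_def] at h2
  rw [mul_assoc, h2]
  ring

/-- The left-hand side of the algebraic Riccati equation in terms of the coefficients of a quadratic
generator. -/
def riccatiForm (E B M : PhaseMap L L) : PhaseMap L L :=
  (1 - M) * (xiTranspose Eᴴ - Eᴴ) * M + M * (xiTranspose E - E) * (1 - M) +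
    (1 - M) * B * (1 - M) - M * xiTranspose B * M

/-- The rate of change of the trace. -/
def traceRate (E B M : PhaseMap L L) : ℂ := ((E + Eᴴ + B) * (1 - M)).trace

theorem trace_gen_mul (E B : PhaseMap L L) (ρ x : FockOp L) :
    (gen (quadratic E) B ρ * x).trace = ∑ k, ∑ l, E k l * expect ρ (x * (field k * field l.swap)) +
      ∑ k, ∑ l, Eᴴ k l * expect ρ (field k * field l.swap * x) +
      ∑ k, ∑ l, B k l * expect ρ (field k * x * field l.swap) := by
  rw [gen_apply, add_mul, add_mul, Matrix.trace_add, Matrix.trace_add]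
  congr 1
  · congr 1
    · rw [mul_assoc, Matrix.trace_mul_comm, mul_assoc, ← expect_apply, quadratic_eq]
      simp only [Finset.mul_sum, mul_smul_comm, map_sum, map_smul, smul_eq_mul]
    · rw [mul_assoc, ← expect_apply, quadratic_conjTranspose, quadratic_eq]
      simp only [Finset.sum_mul, smul_mul_assoc, map_sum, map_smul, smul_eq_mul]
  · rw [jumpIn_apply]
    simp only [Finset.sum_mul, smul_mul_assoc, Matrix.trace_sum, Matrix.trace_smul, smul_eq_mul]
    refine Finset.sum_congr rfl fun k _ => Finset.sum_congr rfl fun l _ => ?_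
    rw [mul_assoc, mul_assoc, Matrix.trace_mul_comm, expect_apply]
    simp only [mul_assoc]

theorem trace_gen (E B : PhaseMap L L) {ρ : FockOp L} (h1 : ρ.trace = 1) :
    (gen (quadratic E) B ρ).trace = traceRate E B (cov ρ) := by
  have h := trace_gen_mul E B ρ 1
  simp only [mul_one, one_mul, expect_field_mul_field_swap h1, sum_mul_eq_trace] at h
  rw [h, traceRate, add_mul, add_mul, Matrix.trace_add, Matrix.trace_add]

/-- In the four-point Wick formula, contracting the observable with itself gives the trace rate
times M. The mixed contractions are matrix products and add up to the Riccati form. -/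
theorem IsGaussian.two_point_gen (E B : PhaseMap L L) {ρ : FockOp L} (h : IsGaussian ρ)
    (h1 : ρ.trace = 1) (a b : Fin L ⊕ Fin L) :
    (gen (quadratic E) B ρ * (field a.swap * field b)).trace =
      (traceRate E B (cov ρ) • cov ρ + riccatiForm E B (cov ρ)) a b := by
  have hN := fun k l => expect_field_mul_field_swap h1 k l
  have hN' : ∀ k l : Fin L ⊕ Fin L, expect ρ (field k * field l) = (1 - cov ρ) l.swap k := by
    intro k l
    have := hN k l.swap
    rwa [Sum.swap_swap] at this
  have hM : ∀ k l : Fin L ⊕ Fin L, expect ρ (field k.swap * field l) = cov ρ k l := fun k l =>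
    (cov_apply ρ k l).symm
  have hM' : ∀ k l : Fin L ⊕ Fin L, expect ρ (field k * field l) = cov ρ k.swap l := by
    intro k l
    rw [cov_apply, Sum.swap_swap]
  have e1 : ∀ k l : Fin L ⊕ Fin L,
      expect ρ (field k * field l.swap * (field a.swap * field b)) =
      (1 - cov ρ) l k * cov ρ a b - (1 - cov ρ) a k * cov ρ l b +
        (1 - cov ρ) a l.swap * cov ρ k.swap b := by
    intro k l
    rw [h.four_point h1, hN k l, hM a b, hN k a, hM l b, hM' k b, hN l.swap a]
    ring
  have e2 : ∀ k l : Fin L ⊕ Fin L,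
      expect ρ (field a.swap * field b * (field k * field l.swap)) =
      (1 - cov ρ) l k * cov ρ a b - cov ρ a k * (1 - cov ρ) l b +
        cov ρ a l.swap * (1 - cov ρ) k.swap b := by
    intro k l
    rw [h.four_point h1, hN k l, hM a b, hM a k, hN b l, hM a l.swap, hN' b k]
    ring
  have e3 : ∀ k l : Fin L ⊕ Fin L,
      expect ρ (field k * (field a.swap * field b) * field l.swap) =
      (1 - cov ρ) a k * (1 - cov ρ) l b - cov ρ a l.swap * cov ρ k.swap b +
        (1 - cov ρ) l k * cov ρ a b := by
    intro k l
    rw [← mul_assoc, mul_assoc (field k * field a.swap), h.four_point h1, hN k a, hN b l, hM' k b,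
      hM a l.swap, hN k l, hM a b]
    ring
  rw [trace_gen_mul]
  simp only [e1, e2, e3, mul_add, mul_sub, Finset.sum_add_distrib, Finset.sum_sub_distrib,
    sum_mul_mul, sum_swap_mul_mul]
  simp only [← mul_assoc, ← Finset.sum_mul, sum_mul_eq_trace]
  simp only [traceRate, riccatiForm, Matrix.add_apply, Matrix.sub_apply, Matrix.smul_apply,
    smul_eq_mul, add_mul, mul_sub, sub_mul, Matrix.trace_add, mul_one, one_mul, Matrix.trace_sub]
  ring

/-- A Gaussian state with a stationary covariance matrix is an eigenvector. -/
theorem IsGaussian.gen_eq_smul {E B : PhaseMap L L} {ρ : FockOp L} (h : IsGaussian ρ)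
    (h1 : ρ.trace = 1) (hR : riccatiForm E B (cov ρ) = 0) :
    gen (quadratic E) B ρ = traceRate E B (cov ρ) • ρ := by
  set c := traceRate E B (cov ρ)
  set η : FockOp L := gen (quadratic E) B ρ - c • ρ
  have hη1 : expect η 1 = 0 := by
    rw [expect_apply, mul_one, Matrix.trace_sub, Matrix.trace_smul, h1, trace_gen E B h1,
      smul_eq_mul, mul_one, sub_self]
  have hη2 : ∀ a b, expect η (field a * field b) = 0 := by
    intro a b
    have h2 := h.two_point_gen E B h1 a.swap b
    rw [hR, add_zero, Sum.swap_swap, Matrix.smul_apply, cov_apply, Sum.swap_swap] at h2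
    rw [expect_apply, sub_mul, Matrix.trace_sub, h2, smul_mul_assoc, Matrix.trace_smul,
      expect_apply, sub_self]
  have hηeven : parity L * η * parity L = η := by
    have hρ : parityConj L ρ = ρ := by rw [parityConj_apply, h.even]
    rw [← parityConj_apply, map_sub, map_smul, ← gen_parityConj (parityConj_quadratic E), hρ]
  -- The linearized ladder identity: replacing 𝒢(ρ) by η subtracts 2c ρ ⊗ ρ, which commutes with the
  -- ladder operator by itself.
  have hlad : (η ⊗ₖ ρ + ρ ⊗ₖ η) * ladder L - ladder L * (η ⊗ₖ ρ + ρ ⊗ₖ η) = 0 := by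
    have h2 := ladderAd_gen_kronecker_eq_zero E B h.ladder_comm
    rw [ladderAd_apply] at h2
    have h3 : η ⊗ₖ ρ + ρ ⊗ₖ η = (gen (quadratic E) B ρ ⊗ₖ ρ) + (ρ ⊗ₖ gen (quadratic E) B ρ) -
        (2 * c) • (ρ ⊗ₖ ρ) := by
      simp only [η, sub_eq_add_neg, Matrix.add_kronecker, Matrix.kronecker_add, ← neg_smul,
        Matrix.smul_kronecker, Matrix.kronecker_smul]
      module
    rw [h3, sub_mul, mul_sub, smul_mul_assoc, mul_smul_comm, h.ladder_comm, sub_sub_sub_cancel_right,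
      ← neg_sub, h2, neg_zero]
  have hdef : ∀ x y, IsAnticommFamily.defect field Sum.swap (expect η) (expect ρ) x y +
      IsAnticommFamily.defect field Sum.swap (expect ρ) (expect η) x y = 0 := by
    intro x y
    rw [← trace_kronecker_comm, ← trace_kronecker_comm, ← Matrix.trace_add, ← add_mul, ← ladder]
    have : (η ⊗ₖ ρ * ladder L - ladder L * η ⊗ₖ ρ) + (ρ ⊗ₖ η * ladder L - ladder L * ρ ⊗ₖ η) = 0 := by
      rw [← hlad]; noncomm_ring
    rw [this, zero_mul, Matrix.trace_zero]
  have hone : expect ρ 1 = 1 := by rw [expect_apply, mul_one]; exact h1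
  -- The linearized recursion expresses a moment of η through its moments of order 0 and 2 and the
  -- moment with two fields fewer, all of which vanish.
  have heven : ∀ (m : ℕ) (y : Fin (2 * m) → Fin L ⊕ Fin L), expect η (orderedProd field y) = 0 := by
    intro m
    induction m with
    | zero => intro y; rw [orderedProd_zero, hη1]
    | succ m ih =>
      intro y
      have h2 := hdef (field (y (0 : Fin (2 * m + 2))))
        (orderedProd field fun k : Fin (2 * m + 1) => y (Fin.succ k : Fin (2 * m + 2)))
      rw [isAnticommFamily_field.defect_gen_orderedProd _ _ _ (even_two_mul m),
        isAnticommFamily_field.defect_gen_orderedProd _ _ _ (even_two_mul m)] at h2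
      simp only [hη1, hη2, ih, hone, mul_zero, zero_mul, Finset.sum_const_zero, sub_zero, one_mul,
        zero_add] at h2
      exact (congrArg _ (orderedProd_succ field y)).trans h2
  have hzero : expect η = 0 := by
    refine LinearMap.ext_on (span_range_orderedProd _ adjoin_field_eq_top) ?_
    rintro _ ⟨n, y, rfl⟩
    rcases Nat.even_or_odd n with hn | hn
    · obtain ⟨m, rfl⟩ := (even_iff_exists_two_mul).1 hn
      exact heven m y
    · exact expect_orderedProd_odd parity_mul_field hηeven hn y
  have h0 : expect (0 : FockOp L) = 0 := by
    ext x; simp [expect_apply]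
  exact sub_eq_zero.1 (expect_injective (hzero.trans h0.symm))

end Moments

end QuasiFree
end

noncomputable section
namespace QuasiFree

/-! ### Matrix exponentials: intertwining and positivity. -/

section MatrixExp

open scoped Matrix.Norms.Operator

variable {m n : Type*} [Fintype m] [DecidableEq m] [Fintype n] [DecidableEq n]

theorem lexp_toLin' (A : Matrix n n ℂ) (v : n → ℂ) :
    lexp (Matrix.toLin' A) v = NormedSpace.exp A *ᵥ v := by
  have h := lexp_intertwine (Λ := LinearMap.mulLeft ℂ A) (Λ' := Matrix.toLin' A)
    ((Matrix.mulVecBilin ℂ ℂ).flip v) (fun x => by simp [Matrix.mulVec_mulVec]) 1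
  rw [lexp_mulLeft] at h
  simpa using h

/-- An intertwiner of two matrices intertwines their exponentials. -/
theorem mul_exp_of_intertwine {Θ : Matrix m n ℂ} {A : Matrix n n ℂ} {B : Matrix m m ℂ}
    (h : Θ * A = B * Θ) : Θ * NormedSpace.exp A = NormedSpace.exp B * Θ := by
  refine Matrix.toLin'.injective (LinearMap.ext fun v => ?_)
  have h1 := lexp_intertwine (Λ := Matrix.toLin' A) (Λ' := Matrix.toLin' B) (Matrix.toLin' Θ)
    (fun x => by simp [Matrix.mulVec_mulVec, h]) v
  rw [lexp_toLin', Matrix.toLin'_apply, lexp_toLin', Matrix.toLin'_apply] at h1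
  simp only [Matrix.toLin'_apply, ← Matrix.mulVec_mulVec]
  exact h1.symm

theorem posDef_exp {A : Matrix n n ℂ} (hA : A.IsHermitian) : (NormedSpace.exp A).PosDef := by
  set X := NormedSpace.exp ((1 / 2 : ℂ) • A)
  have hX : Xᴴ = X := by
    rw [← Matrix.exp_conjTranspose, Matrix.conjTranspose_smul, hA.eq]
    norm_num [X]
  have h : NormedSpace.exp A = Xᴴ * 1 * X := by
    rw [hX, mul_one, ← Matrix.exp_add_of_commute _ _ (Commute.refl _), ← add_smul]
    norm_num
  rw [h]
  refine Matrix.PosDef.conjTranspose_mul_mul_same Matrix.PosDef.one ?_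
  exact Matrix.mulVec_injective_of_isUnit (Matrix.isUnit_exp _)

theorem isUnit_one_add_exp {A : Matrix n n ℂ} (hA : A.IsHermitian) :
    IsUnit (1 + NormedSpace.exp A).det :=
  (Matrix.isUnit_iff_isUnit_det _).1 (Matrix.PosDef.one.add (posDef_exp hA)).isUnit

theorem lexp_mulLeft_sub_mulRight (K X : Matrix n n ℂ) :
    lexp (LinearMap.mulLeft ℂ K - LinearMap.mulRight ℂ K) X =
      NormedSpace.exp K * X * NormedSpace.exp (-K) := by
  have h : LinearMap.mulLeft ℂ K - LinearMap.mulRight ℂ K =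
      LinearMap.mulLeft ℂ K + LinearMap.mulRight ℂ (-K) := by
    ext1 x; simp [sub_eq_add_neg]
  rw [h, lexp_add_apply (LinearMap.commute_mulLeft_right K (-K)), lexp_mulRight, lexp_mulLeft,
    mul_assoc]

end MatrixExp

/-! ### Covariance of thermal states. -/

section Thermal

variable {L : ℕ}

theorem xiTranspose_smul (c : ℂ) (E : PhaseMap L L) : xiTranspose (c • E) = c • xiTranspose E := by
  ext k l; simp [xiTranspose_apply]

theorem xiTranspose_add (E E' : PhaseMap L L) :
    xiTranspose (E + E') = xiTranspose E + xiTranspose E' := by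
  ext k l; simp [xiTranspose_apply]

theorem xiTranspose_sum {ι : Type*} (s : Finset ι) (E : ι → PhaseMap L L) :
    xiTranspose (∑ i ∈ s, E i) = ∑ i ∈ s, xiTranspose (E i) := by
  ext k l; simp [xiTranspose_apply, Matrix.sum_apply]

theorem xiTranspose_mul (E E' : PhaseMap L L) :
    xiTranspose (E * E') = xiTranspose E' * xiTranspose E := by
  ext k l
  simp only [xiTranspose_apply, Matrix.mul_apply]
  exact Fintype.sum_equiv (Equiv.sumComm _ _) _ _ fun p => by simp [mul_comm]

theorem xiTranspose_one : xiTranspose (1 : PhaseMap L L) = 1 := by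
  ext k l
  rw [xiTranspose_apply, Matrix.one_apply, Matrix.one_apply]
  simp [Sum.swap_leftInverse.injective.eq_iff, eq_comm]

theorem trace_xiTranspose (E : PhaseMap L L) : (xiTranspose E).trace = E.trace := by
  simp only [Matrix.trace, Matrix.diag_apply, xiTranspose_apply]
  exact Fintype.sum_equiv (Equiv.sumComm _ _) _ _ fun p => by simp

theorem xiTranspose_of_xiConj {E : PhaseMap L L} (hE : Eᴴ = E) (h : xiConj E = -E) :
    xiTranspose E = -E := by
  rw [xiTranspose, hE, h]

-- The operation is the ordinary transpose followed by the relabelling of the basis by `Sum.swap`,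
-- an algebra automorphism.
open scoped Matrix.Norms.Operator in
theorem xiTranspose_exp (E : PhaseMap L L) :
    xiTranspose (NormedSpace.exp E) = NormedSpace.exp (xiTranspose E) := by
  set f := Matrix.reindexAlgEquiv ℂ ℂ (Equiv.sumComm (Fin L) (Fin L))
  have h : ∀ E : PhaseMap L L, xiTranspose E = f Eᵀ := by
    intro E
    ext k l
    rw [xiTranspose_apply]
    rfl
  have hf : Continuous f := f.toLinearMap.continuous_of_finiteDimensional
  rw [h, h, ← Matrix.exp_transpose]
  exact NormedSpace.map_exp f hf _

theorem dGamma_smul (c : ℂ) (E : PhaseMap L L) : dGamma (c • E) = c • dGamma E := by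
  rw [dGamma, quadratic_smul, smul_comm, dGamma]

theorem dGamma_isHermitian {E : PhaseMap L L} (hE : Eᴴ = E) : (dGamma E).IsHermitian := by
  rw [Matrix.IsHermitian, dGamma, Matrix.conjTranspose_smul, quadratic_conjTranspose, hE]
  norm_num

theorem dGamma_commutator {κ : PhaseMap L L} (hκ : xiTranspose κ = -κ) (l : Fin L ⊕ Fin L) :
    dGamma κ * field l - field l * dGamma κ = ∑ k, κ k l • (field k : FockOp L) := by
  rw [dGamma, smul_mul_assoc, mul_smul_comm, ← smul_sub, quadratic_commutator, hκ, sub_neg_eq_add,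
    ← two_smul ℂ κ, Finset.smul_sum]
  refine Finset.sum_congr rfl fun k _ => ?_
  rw [smul_smul, Matrix.smul_apply, smul_eq_mul]
  congr 1
  ring

/-- The field operator `φ` on the phase space. -/
def fieldMap (L : ℕ) : (Fin L ⊕ Fin L → ℂ) →ₗ[ℂ] FockOp L :=
  Fintype.linearCombination ℂ field

theorem fieldMap_apply (v : Fin L ⊕ Fin L → ℂ) : fieldMap L v = ∑ k, v k • field k :=
  Fintype.linearCombination_apply ℂ field v

open scoped Matrix.Norms.Operator in
/-- `e^{dΓ(κ)} φ(x) e^{-dΓ(κ)} = φ(e^κ x)`. -/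
theorem exp_dGamma_mul_field {κ : PhaseMap L L} (hκ : xiTranspose κ = -κ) (l : Fin L ⊕ Fin L) :
    NormedSpace.exp (dGamma κ) * field l * NormedSpace.exp (-dGamma κ) =
      ∑ k, NormedSpace.exp κ k l • (field k : FockOp L) := by
  -- The commutator with dΓ(κ) acts on the fields as κ acts on the phase space, and this relation
  -- passes to the exponentials.
  have hint : ∀ v, (LinearMap.mulLeft ℂ (dGamma κ) - LinearMap.mulRight ℂ (dGamma κ)) (fieldMap L v) =
      fieldMap L (Matrix.toLin' κ v) := by
    intro v
    have h1 : ∀ x, (LinearMap.mulLeft ℂ (dGamma κ) - LinearMap.mulRight ℂ (dGamma κ)) (field x) =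
        ∑ k, κ k x • (field k : FockOp L) := fun x => by
      rw [← dGamma_commutator hκ]; simp
    rw [fieldMap_apply, fieldMap_apply, map_sum]
    simp only [map_smul, h1, Finset.smul_sum, smul_smul, Matrix.toLin'_apply, Matrix.mulVec,
      dotProduct, Finset.sum_smul]
    rw [Finset.sum_comm]
    simp only [mul_comm]
  have h := lexp_intertwine (fieldMap L) hint (Pi.single l 1)
  rw [lexp_mulLeft_sub_mulRight, lexp_toLin', fieldMap_apply, fieldMap_apply] at h
  simpa [Pi.single_apply] using h

/-- The KMS condition determines the covariance of a Gibbs state. -/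
theorem cov_gibbs {κ : PhaseMap L L} (hκ : κᴴ = κ) (hξ : xiConj κ = -κ) (β : ℝ) :
    cov (gibbs β (dGamma κ)) = (1 + NormedSpace.exp (-(β : ℂ) • κ))⁻¹ := by
  set κ' : PhaseMap L L := -(β : ℂ) • κ with hκ'
  have hherm : κ'.IsHermitian := by
    rw [Matrix.IsHermitian, hκ', Matrix.conjTranspose_smul, hκ]; simp
  have hT : xiTranspose κ' = -κ' := by
    rw [hκ', xiTranspose_smul, xiTranspose_of_xiConj hκ hξ, smul_neg]
  set Z : FockOp L := NormedSpace.exp (dGamma κ') with hZ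
  have hgibbs : gibbs β (dGamma κ) = Z.trace⁻¹ • Z := by rw [gibbs, hZ, hκ', dGamma_smul]
  have hZ0 : Z.trace ≠ 0 := (posDef_exp (dGamma_isHermitian hherm)).trace_pos.ne'
  set X := NormedSpace.exp κ' with hX
  have hmul : ∀ l, Z * field l = (∑ k, X k l • field k) * Z := by
    intro l
    rw [← exp_dGamma_mul_field hT, mul_assoc, hZ, ← Matrix.exp_add_of_commute (-dGamma κ') _
      (Commute.refl _).neg_left, neg_add_cancel, NormedSpace.exp_zero, mul_one]
  have hXT : xiTranspose X * X = 1 := by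
    rw [hX, xiTranspose_exp, hT, ← Matrix.exp_add_of_commute (-κ') _ (Commute.refl _).neg_left,
      neg_add_cancel, NormedSpace.exp_zero]
  set N : PhaseMap L L := cov Z
  have hNa : ∀ k l, N k l = expect Z (field k.swap * field l) := cov_apply Z
  -- Move Z through the first field, use cyclicity of the trace, then anticommute the two fields.
  -- Multiplying by X = (X^T)⁻¹ gives (1 + X) N = Tr Z.
  have hN : N = Z.trace • xiTranspose X - xiTranspose X * N := by
    ext k l
    rw [Matrix.sub_apply, Matrix.smul_apply, Matrix.mul_apply, hNa, expect_apply, ← mul_assoc,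
      hmul]
    simp only [Finset.sum_mul, smul_mul_assoc, Matrix.trace_sum, Matrix.trace_smul]
    have h1 : ∀ p : Fin L ⊕ Fin L, (field p * Z * field l).trace =
        (if l = p.swap then Z.trace else 0) - N p.swap l := by
      intro p
      rw [mul_assoc, Matrix.trace_mul_comm, mul_assoc, eq_sub_iff_add_eq, hNa, Sum.swap_swap,
        expect_apply, ← Matrix.trace_add, ← mul_add, field_anticomm]
      split_ifs <;> simp
    simp only [h1, smul_sub, Finset.sum_sub_distrib]
    congr 1
    · rw [Finset.sum_eq_single l.swap]
      · simp [xiTranspose_apply, mul_comm]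
      · intro p _ hp
        rw [if_neg, smul_zero]
        rintro rfl
        exact hp (Sum.swap_swap p).symm
      · simp
    · exact Fintype.sum_equiv (Equiv.sumComm _ _) _ _ fun p => by simp [xiTranspose_apply]
  have hN' : (1 + X) * N = Z.trace • 1 := by
    have hXT' : X * xiTranspose X = 1 := mul_eq_one_comm.1 hXT
    calc (1 + X) * N = N + X * N := by rw [add_mul, one_mul]
      _ = N + X * (Z.trace • xiTranspose X - xiTranspose X * N) := by rw [← hN]
      _ = Z.trace • 1 := by
        rw [mul_sub, mul_smul_comm, ← mul_assoc, hXT', one_mul]; abel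
  have hcov : cov (gibbs β (dGamma κ)) = Z.trace⁻¹ • N := by
    ext k l
    rw [hgibbs, Matrix.smul_apply, cov_apply, hNa, expect_apply, expect_apply, smul_mul_assoc,
      Matrix.trace_smul]
  rw [hcov]
  symm
  refine Matrix.inv_eq_right_inv ?_
  rw [mul_smul_comm, hN', smul_smul, inv_mul_cancel₀ hZ0, one_smul]

end Thermal

end QuasiFree
end

noncomputable section
namespace QuasiFree

/-! ### Intertwining of Fermi-Dirac factors. -/

section OneAddInv

variable {m n : Type*} [Fintype m] [DecidableEq m] [Fintype n] [DecidableEq n]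

/-- An intertwiner of `Z` and `Z'` intertwines `(1 + Z)⁻¹` and `(1 + Z')⁻¹`. -/
theorem mul_one_add_inv {Y : Matrix m n ℂ} {Z : Matrix n n ℂ} {Z' : Matrix m m ℂ}
    (hZ : IsUnit (1 + Z).det) (hZ' : IsUnit (1 + Z').det) (h : Y * Z = Z' * Y) :
    Y * (1 + Z)⁻¹ = (1 + Z')⁻¹ * Y := by
  have h' : Y * (1 + Z) = (1 + Z') * Y := by
    rw [Matrix.mul_add, Matrix.mul_one, h, Matrix.add_mul, Matrix.one_mul]
  calc Y * (1 + Z)⁻¹ = (1 + Z')⁻¹ * ((1 + Z') * Y) * (1 + Z)⁻¹ := by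
        rw [← Matrix.mul_assoc, Matrix.nonsing_inv_mul _ hZ', Matrix.one_mul]
    _ = (1 + Z')⁻¹ * Y := by
        rw [← h', Matrix.mul_assoc, Matrix.mul_assoc, Matrix.mul_nonsing_inv _ hZ, Matrix.mul_one]

theorem exp_smul_mul_exp_smul (A : Matrix n n ℂ) (s t : ℂ) :
    NormedSpace.exp (s • A) * NormedSpace.exp (t • A) = NormedSpace.exp ((s + t) • A) := by
  rw [add_smul, Matrix.exp_add_of_commute]
  exact (Commute.refl A).smul_left s |>.smul_right t

end OneAddInv

/-! ### Partial traces of elementary tensors. -/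

section PartialTrace

variable {m n : Type*} [Fintype n]

theorem partialTraceRight_sum {ι : Type*} (s : Finset ι) (f : ι → Matrix (m × n) (m × n) ℂ) :
    partialTraceRight (∑ i ∈ s, f i) = ∑ i ∈ s, partialTraceRight (f i) := by
  ext a b
  simp only [partialTraceRight, Matrix.of_apply, Matrix.sum_apply]
  exact Finset.sum_comm

theorem partialTraceRight_smul (c : ℂ) (X : Matrix (m × n) (m × n) ℂ) :
    partialTraceRight (c • X) = c • partialTraceRight X := by
  ext a b
  simp [partialTraceRight, Finset.mul_sum]

theorem partialTraceRight_kronecker (X : Matrix m m ℂ) (Y : Matrix n n ℂ) :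
    partialTraceRight (X ⊗ₖ Y) = Y.trace • X := by
  ext a b
  simp [partialTraceRight, Matrix.trace, ← Finset.mul_sum, mul_comm]

end PartialTrace

/-! ### Evaluation of the maps Φ_i. -/

namespace ThermalModel

variable {n : ℕ} (m : ThermalModel n)

/-- The covariance of the thermal state of the `i`-th bath. -/
def bathCov (i : Fin n) : PhaseMap (m.LB i) (m.LB i) :=
  (1 + NormedSpace.exp (-(m.β i : ℂ) • m.κB i))⁻¹

theorem cov_bathState (i : Fin n) : cov (m.bathState i) = m.bathCov i :=
  cov_gibbs (m.κB_selfAdjoint i) (m.κB_xi i) _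

theorem isHermitian_smul_κB (s : ℝ) (i : Fin n) : ((s : ℂ) • m.κB i).IsHermitian := by
  rw [Matrix.IsHermitian, Matrix.conjTranspose_smul, m.κB_selfAdjoint]; simp

theorem isHermitian_smul_κS (s : ℝ) : ((s : ℂ) • m.κS).IsHermitian := by
  rw [Matrix.IsHermitian, Matrix.conjTranspose_smul, m.κS_selfAdjoint]; simp

theorem isUnit_bath (i : Fin n) : IsUnit (1 + NormedSpace.exp (-(m.β i : ℂ) • m.κB i)).det := by
  rw [← Complex.ofReal_neg]
  exact isUnit_one_add_exp (m.isHermitian_smul_κB _ i)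

theorem isUnit_system (i : Fin n) : IsUnit (1 + NormedSpace.exp (-(m.β i : ℂ) • m.κS)).det := by
  rw [← Complex.ofReal_neg]
  exact isUnit_one_add_exp (m.isHermitian_smul_κS _)

theorem Θ_mul_exp (i : Fin n) (s : ℂ) :
    m.Θ i * NormedSpace.exp (s • m.κB i) = NormedSpace.exp (s • m.κS) * m.Θ i :=
  mul_exp_of_intertwine (by rw [Matrix.mul_smul, m.Θ_mul_κB, Matrix.smul_mul])

/-- Conservation of the pseudo-energy by the interaction trades functions of κ_i for functions of
κ_S. -/
theorem Θ_mul_bathCov (i : Fin n) : m.Θ i * m.bathCov i = m.Mβ i * m.Θ i :=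
  mul_one_add_inv (m.isUnit_bath i) (m.isUnit_system i) (m.Θ_mul_exp i _)

/-- The coefficient matrix of `Φ_i`. -/
def X (i : Fin n) : PhaseMap m.LS m.LS := m.Mβ i * m.ΘΘ i

theorem X_eq (i : Fin n) : m.X i = m.Θ i * m.bathCov i * (m.Θ i)ᴴ := by
  rw [X, ΘΘ, Θ_mul_bathCov, Matrix.mul_assoc]

theorem ΘΘ_conjTranspose (i : Fin n) : (m.ΘΘ i)ᴴ = m.ΘΘ i := by simp [ΘΘ]

theorem ΘΘ_mul_κS (i : Fin n) : m.ΘΘ i * m.κS = m.κS * m.ΘΘ i := by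
  have h := congrArg Matrix.conjTranspose (m.Θ_mul_κB i)
  rw [Matrix.conjTranspose_mul, Matrix.conjTranspose_mul, m.κB_selfAdjoint, m.κS_selfAdjoint] at h
  rw [ΘΘ, Matrix.mul_assoc, ← h, ← Matrix.mul_assoc, m.Θ_mul_κB, Matrix.mul_assoc]

theorem ΘΘ_mul_exp (i : Fin n) (s : ℂ) :
    m.ΘΘ i * NormedSpace.exp (s • m.κS) = NormedSpace.exp (s • m.κS) * m.ΘΘ i :=
  mul_exp_of_intertwine (by rw [mul_smul_comm, ΘΘ_mul_κS, smul_mul_assoc])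

theorem ΘΘ_mul_Mβ (i : Fin n) : m.ΘΘ i * m.Mβ i = m.Mβ i * m.ΘΘ i :=
  mul_one_add_inv (m.isUnit_system i) (m.isUnit_system i) (m.ΘΘ_mul_exp i _)

theorem exp_mul_Mβ (i : Fin n) (s : ℂ) : NormedSpace.exp (s • m.κS) * m.Mβ i =
    m.Mβ i * NormedSpace.exp (s • m.κS) :=
  mul_one_add_inv (m.isUnit_system i) (m.isUnit_system i)
    (by rw [exp_smul_mul_exp_smul, exp_smul_mul_exp_smul, add_comm])

theorem Mβ_conjTranspose (i : Fin n) : (m.Mβ i)ᴴ = m.Mβ i := by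
  have h := (m.isHermitian_smul_κS (-(m.β i))).exp
  rw [Complex.ofReal_neg] at h
  rw [Mβ, Matrix.conjTranspose_nonsing_inv, Matrix.conjTranspose_add, Matrix.conjTranspose_one, h.eq]

theorem X_conjTranspose (i : Fin n) : (m.X i)ᴴ = m.X i := by
  rw [X, Matrix.conjTranspose_mul, ΘΘ_conjTranspose, Mβ_conjTranspose, ΘΘ_mul_Mβ]

theorem HSB_eq (i : Fin n) : m.HSB i = ∑ k, ∑ l, m.Θ i k l •
    ((field k : FockOp m.LS) ⊗ₖ (parity (m.LB i) * field l.swap)) := by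
  simp only [HSB, ← Matrix.mul_kronecker_mul, mul_one, field_conjTranspose]

/-- Self-adjointness of the interaction: the sign from ξΘξ = -Θ compensates the one from exchanging
the bath field with the parity. -/
theorem HSB_eq' (i : Fin n) : m.HSB i = ∑ k, ∑ l, star (m.Θ i k l) •
    ((field k.swap : FockOp m.LS) ⊗ₖ (field l * parity (m.LB i))) := by
  rw [HSB_eq]
  refine Fintype.sum_equiv (Equiv.sumComm _ _) _ _ fun k => ?_
  refine Fintype.sum_equiv (Equiv.sumComm _ _) _ _ fun l => ?_
  have h := congrFun (congrFun (m.Θ_xi i) k) l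
  simp only [xiConj, Matrix.submatrix_apply, Matrix.map_apply, Matrix.neg_apply] at h
  have h2 : field l.swap * parity (m.LB i) = -(parity (m.LB i) * field l.swap) := by
    rw [parity_mul_field, neg_neg]
  simp only [Equiv.sumComm_apply, Sum.swap_swap, h2]
  rw [← Complex.star_def] at h
  rw [h]
  ext ⟨a, b⟩ ⟨c, d⟩
  simp

/-- Expanding one interaction factor directly and the other in its adjoint form, the parities cancel
under the bath trace. What remains is the bath covariance sandwiched as Θ M Θ^*. -/
theorem Φ_apply (i : Fin n) (A : FockOp m.LS) :
    m.Φ i A = ∑ k, ∑ l, m.X i k l • (field k * A * field l.swap) := by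
  have hcov : ∀ a b : Fin (m.LB i) ⊕ Fin (m.LB i), (m.bathState i *
      (parity (m.LB i) * field a.swap * (field b * parity (m.LB i)))).trace = m.bathCov i a b := by
    intro a b
    rw [← cov_bathState, cov_apply, expect_apply]
    congr 2
    calc _ = parity (m.LB i) * field a.swap * field b * parity (m.LB i) := by noncomm_ring
      _ = field a.swap * field b * (parity (m.LB i) * parity (m.LB i)) := by
        rw [parity_mul_field, neg_mul, mul_assoc (field a.swap), parity_mul_field]; noncomm_ring
      _ = _ := by rw [parity_mul_self, mul_one]
  have h : m.Φ i A = ∑ k, ∑ l, ∑ b, ∑ a, (m.Θ i k a * star (m.Θ i l b) * m.bathCov i a b) •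
      (field k * A * field l.swap) := by
    rw [Φ, LinearMap.coe_mk, AddHom.coe_mk]
    nth_rewrite 2 [HSB_eq' m i]
    rw [HSB_eq]
    simp only [Finset.mul_sum, Finset.sum_mul, mul_smul_comm, smul_mul_assoc,
      ← Matrix.mul_kronecker_mul, one_mul, mul_one, partialTraceRight_sum, partialTraceRight_smul,
      partialTraceRight_kronecker, mul_assoc]
    simp only [← mul_assoc] at hcov
    simp only [← mul_assoc, hcov, Finset.smul_sum, smul_smul]
    rw [Finset.sum_congr rfl fun l _ => Finset.sum_comm, Finset.sum_comm]
    refine Finset.sum_congr rfl fun k _ => Finset.sum_congr rfl fun l _ =>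
      Finset.sum_congr rfl fun b _ => Finset.sum_congr rfl fun a _ => ?_
    congr 1
    ring
  rw [h]
  refine Finset.sum_congr rfl fun k _ => Finset.sum_congr rfl fun l _ => ?_
  simp only [← Finset.sum_smul]
  congr 1
  rw [X_eq, Matrix.mul_apply]
  simp only [Matrix.mul_apply, Finset.sum_mul, Matrix.conjTranspose_apply]
  exact Finset.sum_congr rfl fun b _ => Finset.sum_congr rfl fun a _ => by ring

end ThermalModel

end QuasiFree
end

/-! ### The deformed dual generator in quadratic form. -/

noncomputable section
namespace QuasiFree

theorem eq_of_trace_mul_eq {n : Type*} [Fintype n] [DecidableEq n] {X Y : Matrix n n ℂ}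
    (h : ∀ A, (X * A).trace = (Y * A).trace) : X = Y := by
  ext a b
  have := h (Matrix.single b a 1)
  simpa [Matrix.trace_mul_single] using this

theorem traceDual_eq {L : ℕ} {Λ Λ' : SuperOp L}
    (h : ∀ ρ A, (Λ' ρ * A).trace = (ρ * Λ A).trace) : traceDual Λ = Λ' :=
  LinearMap.ext fun ρ => eq_of_trace_mul_eq fun A => by rw [trace_traceDual_mul, h]

theorem trace_jumpIn_mul {L : ℕ} (B : PhaseMap L L) (ρ A : FockOp L) :
    (jumpIn B field ρ * A).trace = (ρ * ∑ k, ∑ l, B k l • (field k * A * field l.swap)).trace := by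
  rw [jumpIn_apply]
  simp only [Finset.sum_mul, Finset.mul_sum, smul_mul_assoc, mul_smul_comm, Matrix.trace_sum,
    Matrix.trace_smul]
  refine Finset.sum_congr rfl fun k _ => Finset.sum_congr rfl fun l _ => ?_
  congr 1
  rw [mul_assoc, mul_assoc, Matrix.trace_mul_comm]
  simp only [mul_assoc]

theorem trace_gen_mul_eq {L : ℕ} (D : FockOp L) (B : PhaseMap L L) (ρ A : FockOp L) :
    (gen D B ρ * A).trace =
      (ρ * (Dᴴ * A + A * D + ∑ k, ∑ l, B k l • (field k * A * field l.swap))).trace := by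
  rw [gen_apply, add_mul, mul_add, Matrix.trace_add, Matrix.trace_add, trace_jumpIn_mul, add_mul,
    mul_add, Matrix.trace_add, Matrix.trace_add, add_comm (D * ρ * A).trace, mul_assoc ρ,
    mul_assoc D, Matrix.trace_mul_comm D, mul_assoc ρ]

namespace ThermalModel

variable {n : ℕ} (m : ThermalModel n)

theorem Φ_one (i : Fin n) : m.Φ i 1 = quadratic (m.X i) := by
  rw [Φ_apply, quadratic_eq]
  simp only [mul_one]

/-- The drift of the model on the phase space. -/
def E : PhaseMap m.LS m.LS := -(1 / 2 : ℂ) • (Complex.I • m.TS + ∑ i, m.X i)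

theorem quadratic_sum {L : ℕ} {ι : Type*} (s : Finset ι) (T : ι → PhaseMap L L) :
    quadratic (∑ i ∈ s, T i) = ∑ i ∈ s, quadratic (T i) := by
  classical
  induction s using Finset.induction_on with
  | empty => simp [quadratic]
  | insert a s ha ih => rw [Finset.sum_insert ha, Finset.sum_insert ha, quadratic_add, ih]

theorem driftOp_eq : m.driftOp = quadratic m.E := by
  simp only [driftOp, HS, dGamma, E, Φ_one, quadratic_smul, quadratic_add, quadratic_sum]
  module

theorem expκ_comm (α : Fin n → ℝ) (i : Fin n) : m.expκ α i * m.Mβ i * m.ΘΘ i = m.X i * m.expκ α i := by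
  rw [X, expκ, exp_mul_Mβ, mul_assoc, ← ΘΘ_mul_exp, mul_assoc]

theorem xiTranspose_κS : xiTranspose m.κS = -m.κS := xiTranspose_of_xiConj m.κS_selfAdjoint m.κS_xi

/-- Both exponentials sit to the right of A, on either side of the second field. Conjugating that
field by e^{-α_i K_S} transforms it linearly and multiplies the coefficient matrix by e^{α_i κ_S}.
-/
theorem Φ_deformed_apply (α : Fin n → ℝ) (i : Fin n) (A : FockOp m.LS) :
    m.Φ i (A * NormedSpace.exp (-(α i : ℂ) • m.KS)) * NormedSpace.exp ((α i : ℂ) • m.KS) =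
      ∑ k, ∑ l, (m.expκ α i * m.Mβ i * m.ΘΘ i) k l • (field k * A * field l.swap) := by
  set κ := -(α i : ℂ) • m.κS
  have hκ : xiTranspose κ = -κ := by rw [xiTranspose_smul, xiTranspose_κS, smul_neg]
  have hexp : m.expκ α i = xiTranspose (NormedSpace.exp κ) := by
    rw [xiTranspose_exp, hκ, expκ]
    simp [κ]
  have h1 : -(α i : ℂ) • m.KS = dGamma κ := (dGamma_smul _ _).symm
  have h2 : (α i : ℂ) • m.KS = -dGamma κ := by rw [← h1, neg_smul, neg_neg]
  rw [Φ_apply, h1, h2, expκ_comm, Finset.sum_mul]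
  refine Finset.sum_congr rfl fun k _ => ?_
  have h3 : ∀ l : Fin m.LS ⊕ Fin m.LS, field k * (A * NormedSpace.exp (dGamma κ)) * field l.swap *
      NormedSpace.exp (-dGamma κ) = ∑ p, m.expκ α i l p • (field k * A * field p.swap) := by
    intro l
    have h4 : field k * (A * NormedSpace.exp (dGamma κ)) * field l.swap * NormedSpace.exp (-dGamma κ) =
      field k * A * (NormedSpace.exp (dGamma κ) * field l.swap * NormedSpace.exp (-dGamma κ)) := by
      simp only [mul_assoc]
    rw [h4, exp_dGamma_mul_field hκ, Finset.mul_sum, hexp]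
    exact Fintype.sum_equiv (Equiv.sumComm _ _) _ _ fun p => by simp [xiTranspose_apply]
  simp only [Finset.sum_mul, smul_mul_assoc, h3, Finset.smul_sum, smul_smul]
  rw [Finset.sum_comm]
  simp only [← Finset.sum_smul, ← Matrix.mul_apply]

theorem deformed_apply (α : Fin n → ℝ) (A : FockOp m.LS) :
    m.deformed α A = (quadratic m.E)ᴴ * A + A * quadratic m.E +
      ∑ k, ∑ l, m.B α k l • (field k * A * field l.swap) := by
  have h : ∑ k, ∑ l, m.B α k l • (field k * A * field l.swap : FockOp m.LS) =
      ∑ i, ∑ k, ∑ l, (m.expκ α i * m.Mβ i * m.ΘΘ i) k l • (field k * A * field l.swap) := by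
    simp only [B, Matrix.sum_apply, Finset.sum_smul]
    rw [Finset.sum_comm' (s := (Finset.univ : Finset (Fin n)))
      (t' := (Finset.univ : Finset (Fin m.LS ⊕ Fin m.LS))) (s' := fun _ => Finset.univ) (by simp)]
    exact Finset.sum_congr rfl fun k _ => Finset.sum_comm
  rw [h, ← driftOp_eq]
  simp only [← Φ_deformed_apply]
  simp [deformed, LinearMap.sum_apply]

theorem deformedDual_eq (α : Fin n → ℝ) : m.deformedDual α = gen (quadratic m.E) (m.B α) :=
  traceDual_eq fun ρ A => by rw [trace_gen_mul_eq, deformed_apply]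

/-- Through this identification the positivity hypothesis enters as a statement about the deformed
family at α = 0. It rests on the self-adjointness of H_S and Φ_i(1). -/
theorem lindbladian_eq : m.lindbladian = m.deformed 0 := by
  have hΦ : ∀ i, (m.Φ i 1)ᴴ = m.Φ i 1 := fun i => by
    rw [Φ_one, quadratic_conjTranspose, X_conjTranspose]
  have hH : m.HSᴴ = m.HS := dGamma_isHermitian m.TS_selfAdjoint
  have hD : m.driftOpᴴ = Complex.I • m.HS - (1 / 2 : ℂ) • ∑ i, m.Φ i 1 := by
    simp [driftOp, Matrix.conjTranspose_sub, Matrix.conjTranspose_smul, Matrix.conjTranspose_sum, hΦ,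
      hH]
  refine LinearMap.ext fun A => ?_
  simp only [lindbladian, deformed, hD, LinearMap.add_apply, LinearMap.sum_apply, LinearMap.smul_apply,
    LinearMap.sub_apply, LinearMap.mulLeft_apply, LinearMap.mulRight_apply, LinearMap.comp_apply]
  simp only [Pi.zero_apply, Complex.ofReal_zero, neg_zero, zero_smul, NormedSpace.exp_zero, mul_one,
    driftOp, Finset.sum_sub_distrib, ← Finset.smul_sum, Finset.sum_add_distrib, ← Finset.sum_mul,
    ← Finset.mul_sum, sub_mul, mul_sub, smul_mul_assoc, mul_smul_comm]
  module

/-- The exponential commutes with the covariance, so splitting it into two halves exhibits the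
product as a congruence of a positive definite matrix. -/
theorem posDef_bath (i : Fin n) (s : ℝ) :
    (NormedSpace.exp ((s : ℂ) • m.κB i) * m.bathCov i).PosDef := by
  set W := NormedSpace.exp (((s / 2 : ℝ) : ℂ) • m.κB i)
  have hW : Wᴴ = W := (m.isHermitian_smul_κB (s / 2) i).exp
  have hM : (m.bathCov i).PosDef := by
    rw [bathCov, ← Complex.ofReal_neg]
    exact (Matrix.PosDef.one.add (posDef_exp (m.isHermitian_smul_κB _ i))).inv
  have h1 : W * m.bathCov i = m.bathCov i * W :=
    mul_one_add_inv (m.isUnit_bath i) (m.isUnit_bath i)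
      (by rw [exp_smul_mul_exp_smul, exp_smul_mul_exp_smul, add_comm])
  have h2 : NormedSpace.exp ((s : ℂ) • m.κB i) = W * W := by
    rw [exp_smul_mul_exp_smul]
    push_cast
    ring_nf
  have h3 : NormedSpace.exp ((s : ℂ) • m.κB i) * m.bathCov i = Wᴴ * m.bathCov i * W := by
    rw [h2, hW, mul_assoc, mul_assoc, h1]
  rw [h3]
  exact hM.conjTranspose_mul_mul_same (Matrix.mulVec_injective_of_isUnit (Matrix.isUnit_exp _))

/-- The coefficient matrix of the jumps caused by one bath, in terms of the phase space of the bath. -/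
theorem expκ_mul_eq (α : Fin n → ℝ) (i : Fin n) : m.expκ α i * m.Mβ i * m.ΘΘ i =
    m.Θ i * (NormedSpace.exp ((α i : ℂ) • m.κB i) * m.bathCov i) * (m.Θ i)ᴴ := by
  rw [ΘΘ, ← Matrix.mul_assoc (m.Θ i), Θ_mul_exp, Matrix.mul_assoc _ (m.Θ i), Θ_mul_bathCov, expκ]
  simp only [Matrix.mul_assoc]

theorem B_posSemidef (α : Fin n → ℝ) : (m.B α).PosSemidef := by
  rw [B]
  refine Matrix.posSemidef_sum _ fun i _ => ?_
  rw [expκ_mul_eq]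
  exact (m.posDef_bath i (α i)).posSemidef.mul_mul_conjTranspose_same _

/-- The jumps of the deformed generator dominate a multiple of the undeformed ones. -/
theorem exists_B_sub_smul_posSemidef (α : Fin n → ℝ) :
    ∃ c : ℝ, 0 < c ∧ (m.B α - (c : ℂ) • m.B 0).PosSemidef := by
  have h : ∀ i, ∃ c : ℝ, 0 < c ∧ (NormedSpace.exp ((α i : ℂ) • m.κB i) * m.bathCov i -
      (c : ℂ) • m.bathCov i).PosSemidef := by
    intro i
    have h0 := m.posDef_bath i 0
    rw [Complex.ofReal_zero, zero_smul, NormedSpace.exp_zero, one_mul] at h0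
    obtain ⟨c, hc, h⟩ := exists_posSemidef_sub_smul (isCompact_singleton
      (x := NormedSpace.exp ((α i : ℂ) • m.κB i) * m.bathCov i))
      (isCompact_singleton (x := m.bathCov i))
      (by rintro _ rfl; exact m.posDef_bath i _) (by rintro _ rfl; exact h0.isHermitian)
    exact ⟨c, hc, h _ rfl _ rfl⟩
  choose c hc h using h
  -- One constant must serve all baths: the minimum of the c i, or 1 when there is no bath.
  obtain ⟨d, hd, hdc⟩ : ∃ d : ℝ, 0 < d ∧ ∀ i, d ≤ c i := by
    by_cases hn : Nonempty (Fin n)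
    · obtain ⟨i, hi⟩ := Finite.exists_min c
      exact ⟨c i, hc i, hi⟩
    · exact ⟨1, one_pos, fun i => (hn ⟨i⟩).elim⟩
  refine ⟨d, hd, ?_⟩
  simp only [B, Finset.smul_sum, ← Finset.sum_sub_distrib, expκ_mul_eq]
  refine Matrix.posSemidef_sum _ fun i _ => ?_
  have h0 := m.posDef_bath i 0
  rw [Complex.ofReal_zero, zero_smul, NormedSpace.exp_zero, one_mul] at h0
  have h1 := ((h i).add (h0.posSemidef.smul (a := ((c i - d : ℝ) : ℂ))
    (by exact_mod_cast sub_nonneg.2 (hdc i)))).mul_mul_conjTranspose_same (m.Θ i)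
  have h2 : NormedSpace.exp ((α i : ℂ) • m.κB i) * m.bathCov i - (c i : ℂ) • m.bathCov i +
      ((c i - d : ℝ) : ℂ) • m.bathCov i =
      NormedSpace.exp ((α i : ℂ) • m.κB i) * m.bathCov i - (d : ℂ) • m.bathCov i := by
    push_cast
    module
  rw [h2, Matrix.mul_sub, Matrix.sub_mul, Matrix.mul_smul, Matrix.smul_mul] at h1
  simpa only [Pi.zero_apply, Complex.ofReal_zero, zero_smul, NormedSpace.exp_zero, one_mul] using h1

end ThermalModel

end QuasiFree
end

noncomputable section
namespace QuasiFree

/-! ### Identification with the Riccati equation and the eigenvalue formulas. -/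

section Algebra

variable {L : ℕ}

theorem xiConj_mul {L₁ L₂ L₃ : ℕ} (S : PhaseMap L₁ L₂) (T : PhaseMap L₂ L₃) :
    xiConj (S * T) = xiConj S * xiConj T := by
  ext k l
  simp only [xiConj, Matrix.submatrix_apply, Matrix.map_apply, Matrix.mul_apply, map_sum, map_mul]
  exact Fintype.sum_equiv (Equiv.sumComm _ _) _ _ fun p => by simp

theorem xiConj_conjTranspose {L₁ L₂ : ℕ} (T : PhaseMap L₁ L₂) : xiConj Tᴴ = (xiConj T)ᴴ := by
  ext k l
  simp [xiConj]

theorem xiTranspose_cov {ρ : FockOp L} (h1 : ρ.trace = 1) : xiTranspose (cov ρ) = 1 - cov ρ := by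
  ext k l
  rw [xiTranspose_apply, cov_apply, Sum.swap_swap, expect_field_mul_field_swap h1]

end Algebra

namespace ThermalModel

variable {n : ℕ} (m : ThermalModel n)

theorem xiTranspose_ΘΘ (i : Fin n) : xiTranspose (m.ΘΘ i) = m.ΘΘ i := by
  rw [xiTranspose, ΘΘ_conjTranspose, ΘΘ, xiConj_mul, xiConj_conjTranspose, m.Θ_xi,
    Matrix.conjTranspose_neg, Matrix.neg_mul, Matrix.mul_neg, neg_neg]

/-- The operation sends κ_S to -κ_S, and the Fermi function satisfies 1/(1 + e^x) + 1/(1 + e^{-x}) =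
1. -/
theorem xiTranspose_Mβ (i : Fin n) : xiTranspose (m.Mβ i) = 1 - m.Mβ i := by
  set e := NormedSpace.exp (-(m.β i : ℂ) • m.κS) with he
  set f := NormedSpace.exp ((m.β i : ℂ) • m.κS) with hf
  have hfe : f * e = 1 := by rw [hf, he, exp_smul_mul_exp_smul]; simp
  have heT : xiTranspose e = f := by
    rw [he, xiTranspose_exp, xiTranspose_smul, xiTranspose_κS, smul_neg, neg_smul, neg_neg]
  have h1 : (1 + e) * m.Mβ i = 1 := Matrix.mul_nonsing_inv _ (m.isUnit_system i)
  have h2 : xiTranspose (m.Mβ i) * (1 + f) = 1 := by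
    rw [← heT, ← xiTranspose_one, ← xiTranspose_add, ← xiTranspose_mul, h1]
  have h3 : xiTranspose (m.Mβ i) * (1 + e) = e := by
    calc xiTranspose (m.Mβ i) * (1 + e) = xiTranspose (m.Mβ i) * (1 + f) * e := by
          rw [mul_assoc, add_mul, one_mul, hfe, add_comm]
      _ = e := by rw [h2, one_mul]
  calc xiTranspose (m.Mβ i) = xiTranspose (m.Mβ i) * ((1 + e) * m.Mβ i) := by rw [h1, mul_one]
    _ = (1 + e) * m.Mβ i - m.Mβ i := by rw [← mul_assoc, h3, add_mul, one_mul]; abel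
    _ = 1 - m.Mβ i := by rw [h1]

theorem X_add_xiTranspose_X (i : Fin n) : m.X i + xiTranspose (m.X i) = m.ΘΘ i := by
  rw [X, xiTranspose_mul, xiTranspose_ΘΘ, xiTranspose_Mβ, mul_sub, mul_one, ΘΘ_mul_Mβ]
  abel

theorem B_eq (α : Fin n → ℝ) : m.B α = m.Q α + ∑ i, m.X i := by
  rw [B, Q, ← Finset.sum_add_distrib]
  refine Finset.sum_congr rfl fun i _ => ?_
  rw [expκ_comm, X, mul_sub, mul_one, ΘΘ_mul_Mβ]
  abel

theorem Q_conjTranspose (α : Fin n → ℝ) : (m.Q α)ᴴ = m.Q α := by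
  have h : m.Q α = m.B α - ∑ i, m.X i := by rw [B_eq]; abel
  rw [h, Matrix.conjTranspose_sub, (m.B_posSemidef α).1.eq, Matrix.conjTranspose_sum]
  simp only [X_conjTranspose]

theorem E_conjTranspose : m.Eᴴ = -(1 / 2 : ℂ) • (-Complex.I • m.TS + ∑ i, m.X i) := by
  simp [E, Matrix.conjTranspose_sum, X_conjTranspose, m.TS_selfAdjoint]

theorem xiTranspose_TS : xiTranspose m.TS = -m.TS := xiTranspose_of_xiConj m.TS_selfAdjoint m.TS_xi

/-- With X = ∑ X_i, the relations ∑ Θ_i Θ_i^* = X + X^T and B = Q + X eliminate the baths. The rest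
is an identity in the noncommuting symbols X, X^T, Q, Q^T, T_S and M. -/
theorem riccatiForm_eq (α : Fin n → ℝ) (M : PhaseMap m.LS m.LS) :
    riccatiForm m.E (m.B α) M = m.G α * M + M * (m.G α)ᴴ + M * m.C α * M + m.B α := by
  have hP : ∑ i, m.ΘΘ i = ∑ i, m.X i + xiTranspose (∑ i, m.X i) := by
    rw [xiTranspose_sum, ← Finset.sum_add_distrib]
    exact Finset.sum_congr rfl fun i _ => (m.X_add_xiTranspose_X i).symm
  have hG : (m.G α)ᴴ = Complex.I • m.TS - (1 / 2 : ℂ) • ∑ i, m.ΘΘ i - m.Q α := by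
    simp [G, Matrix.conjTranspose_sub, Matrix.conjTranspose_smul, Matrix.conjTranspose_sum,
      ΘΘ_conjTranspose, Q_conjTranspose, m.TS_selfAdjoint]
  rw [hG, riccatiForm, E_conjTranspose, G, C, hP, B_eq]
  simp only [E, xiTranspose_smul, xiTranspose_add, xiTranspose_TS]
  generalize ∑ i, m.X i = X
  generalize xiTranspose X = X'
  generalize m.Q α = Q
  generalize xiTranspose Q = Q'
  generalize m.TS = T
  simp only [mul_add, add_mul, mul_sub, sub_mul, smul_mul_assoc, mul_smul_comm, smul_add, smul_sub,
    smul_neg, neg_smul, neg_mul, mul_neg, mul_one, one_mul, neg_neg, smul_smul, mul_assoc]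
  module

/-- In E + E^* the Hamiltonian part drops out and -∑ X_i remains, which turns B into Q. -/
theorem traceRate_eq (α : Fin n → ℝ) (M : PhaseMap m.LS m.LS) :
    traceRate m.E (m.B α) M = (m.Q α * (1 - M)).trace := by
  rw [traceRate]
  congr 2
  rw [E_conjTranspose, B_eq, E]
  module

theorem trace_xiTranspose_Q_mul {M : PhaseMap m.LS m.LS} (hM : xiTranspose M = 1 - M)
    (α : Fin n → ℝ) : (xiTranspose (m.Q α) * M).trace = (m.Q α * (1 - M)).trace := by
  rw [← hM, ← trace_xiTranspose, xiTranspose_mul, Matrix.trace_mul_comm]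
  congr 2
  ext k l
  simp [xiTranspose_apply]

theorem trace_C_mul {M : PhaseMap m.LS m.LS} (hM : xiTranspose M = 1 - M) (α : Fin n → ℝ) :
    -(1 / 2) * (m.C α * M).trace + (1 / 2) * (m.Q α).trace = (m.Q α * (1 - M)).trace := by
  have h := m.trace_xiTranspose_Q_mul hM α
  rw [mul_sub, mul_one, Matrix.trace_sub] at h ⊢
  rw [C, sub_mul, Matrix.trace_sub, h]
  ring

end ThermalModel

/-! ### Semigroups of the model and their dominant eigenvector. -/

section Semigroup

open scoped Matrix.Norms.Operator

variable {L : ℕ}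

theorem expSemigroup_eq (Λ : SuperOp L) (t : ℝ) (A : FockOp L) :
    expSemigroup Λ t A = lexp ((t : ℂ) • Λ) A := by
  rw [← (hasSum_lexp ((t : ℂ) • Λ) A).tsum_eq, expSemigroup]
  refine tsum_congr fun k => ?_
  rw [smul_pow, LinearMap.smul_apply, smul_smul, div_eq_inv_mul]

theorem trace_lexp_mul {Λ Λ' : SuperOp L} (h : ∀ ρ A, (Λ' ρ * A).trace = (ρ * Λ A).trace)
    (ρ A : FockOp L) : (lexp Λ' ρ * A).trace = (ρ * lexp Λ A).trace := by
  have hpow : ∀ (k : ℕ) (ρ A : FockOp L), ((Λ' ^ k) ρ * A).trace = (ρ * (Λ ^ k) A).trace := by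
    intro k
    induction k with
    | zero => simp
    | succ k ih =>
      intro ρ A
      rw [pow_succ, pow_succ', Module.End.mul_apply, Module.End.mul_apply, ih, h]
  have h1 := (hasSum_lexp Λ' ρ).mapL
    (LinearMap.toContinuousLinearMap (Matrix.traceLinearMap _ ℂ ℂ ∘ₗ LinearMap.mulRight ℂ A))
  have h2 := (hasSum_lexp Λ A).mapL
    (LinearMap.toContinuousLinearMap (Matrix.traceLinearMap _ ℂ ℂ ∘ₗ LinearMap.mulLeft ℂ ρ))
  refine h1.unique (h2.congr_fun fun k => ?_)
  simp [hpow]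

theorem lexp_conjTranspose {Λ : SuperOp L} (h : ∀ A, Λ Aᴴ = (Λ A)ᴴ) (A : FockOp L) :
    lexp Λ Aᴴ = (lexp Λ A)ᴴ := by
  have hpow : ∀ (k : ℕ) (A : FockOp L), (Λ ^ k) Aᴴ = ((Λ ^ k) A)ᴴ := by
    intro k
    induction k with
    | zero => simp
    | succ k ih => intro A; rw [pow_succ, Module.End.mul_apply, Module.End.mul_apply, h, ih]
  refine (hasSum_lexp Λ Aᴴ).unique ((hasSum_lexp Λ A).matrix_conjTranspose.congr_fun fun k => ?_)
  simp [hpow, Matrix.conjTranspose_smul]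

theorem jumpIn_sub (B B' : PhaseMap L L) (c : ℂ) :
    jumpIn (B - c • B') (field (L := L)) = jumpIn B field - c • jumpIn B' field := by
  refine LinearMap.ext fun A => ?_
  simp only [jumpIn_apply, LinearMap.sub_apply, LinearMap.smul_apply, Matrix.sub_apply,
    Matrix.smul_apply, sub_smul, smul_assoc, Finset.sum_sub_distrib, Finset.smul_sum]

namespace ThermalModel

variable {n : ℕ} (m : ThermalModel n)

theorem trace_deformedDual_mul (α : Fin n → ℝ) (ρ A : FockOp m.LS) :
    (m.deformedDual α ρ * A).trace = (ρ * m.deformed α A).trace :=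
  trace_traceDual_mul _ _ _

theorem deformed_conjTranspose (α : Fin n → ℝ) (A : FockOp m.LS) :
    m.deformed α Aᴴ = (m.deformed α A)ᴴ := by
  rw [deformed_apply, deformed_apply]
  have h : ∑ k, ∑ l, m.B α k l • (field k * Aᴴ * field l.swap : FockOp m.LS) =
      (∑ k, ∑ l, m.B α k l • (field k * A * field l.swap : FockOp m.LS))ᴴ := by
    rw [Finset.sum_comm]
    simp only [Matrix.conjTranspose_sum, Matrix.conjTranspose_smul, Matrix.conjTranspose_mul,
      field_conjTranspose, Sum.swap_swap, (m.B_posSemidef α).1.apply, mul_assoc]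
  rw [h, Matrix.conjTranspose_add, Matrix.conjTranspose_add, Matrix.conjTranspose_mul,
    Matrix.conjTranspose_mul, Matrix.conjTranspose_conjTranspose, add_comm (_ * Aᴴ)]

theorem deformedDual_conjTranspose (α : Fin n → ℝ) (ρ : FockOp m.LS) :
    m.deformedDual α ρᴴ = (m.deformedDual α ρ)ᴴ := by
  rw [deformedDual_eq, gen_conjTranspose _ (m.B_posSemidef α).1]

/-- If the semigroup is positivity improving, then so are the dual deformed semigroups. -/
theorem isImproving_lexp_deformedDual (hm : IsPositivityImproving m.lindbladian) (α : Fin n → ℝ) :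
    IsImproving (lexp (m.deformedDual α)) := by
  have h0 : IsImproving (lexp (m.deformed 0)).toLinearMap := by
    intro A hA hA0
    have h := hm 1 one_pos A hA hA0
    rwa [expSemigroup_eq, Complex.ofReal_one, one_smul, lindbladian_eq] at h
  have h1 : IsImproving (lexp (m.deformedDual 0)).toLinearMap :=
    IsImproving.dual h0 (lexp_conjTranspose (m.deformed_conjTranspose 0))
      (trace_lexp_mul (m.trace_deformedDual_mul 0))
  obtain ⟨c, hc, hB⟩ := m.exists_B_sub_smul_posSemidef α
  intro A hA hA0
  have h2 := h1 A hA hA0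
  rw [deformedDual_eq] at h2 ⊢
  -- The drift does not depend on α, so the generators at 0 and at α differ only in their jump
  -- parts, which are compared through B_α ≥ c B_0.
  refine posDef_lexp_of_posDef_lexp
    (fun t _ => isPSDMap_lexp_mulLeft_add_mulRight (quadratic m.E) t)
    (isPSDMap_jump (m.B_posSemidef 0)) hc ?_ hA h2
  rw [← jumpIn_sub]
  exact isPSDMap_jump hB

theorem lexp_deformedDual_quasiFree (α : Fin n → ℝ) {ρ : FockOp m.LS} (hρ : IsQuasiFree ρ) {t : ℝ}
    (ht : 0 ≤ t) : 0 < (lexp ((t : ℂ) • m.deformedDual α) ρ).trace ∧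
      IsQuasiFree ((lexp ((t : ℂ) • m.deformedDual α) ρ).trace⁻¹ •
        lexp ((t : ℂ) • m.deformedDual α) ρ) := by
  rw [deformedDual_eq]
  exact hρ.lexp_gen m.E (m.B_posSemidef α) t ht

theorem expSemigroup_deformedDual_quasiFree (α : Fin n → ℝ) {ρ : FockOp m.LS} (hρ : IsQuasiFree ρ)
    {t : ℝ} (ht : 0 ≤ t) : ∃ (c : ℝ) (σ : FockOp m.LS), 0 < c ∧ IsQuasiFree σ ∧
      expSemigroup (m.deformedDual α) t ρ = (c : ℂ) • σ := by
  obtain ⟨h1, h2⟩ := m.lexp_deformedDual_quasiFree α hρ ht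
  obtain ⟨c, hc, hc'⟩ : ∃ c : ℝ, 0 < c ∧ (c : ℂ) = (lexp ((t : ℂ) • m.deformedDual α) ρ).trace := by
    obtain ⟨hre, him⟩ := Complex.pos_iff.1 h1
    exact ⟨_, hre, Complex.ext rfl him⟩
  refine ⟨c, _, hc, h2, ?_⟩
  rw [expSemigroup_eq, hc', smul_smul, mul_inv_cancel₀ h1.ne', one_smul]

theorem expSemigroup_deformedDual_mem_span (α : Fin n → ℝ) {t : ℝ} (ht : 0 ≤ t) {X : FockOp m.LS}
    (hX : X ∈ Submodule.span ℂ {ρ : FockOp m.LS | IsQuasiFree ρ}) :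
    expSemigroup (m.deformedDual α) t X ∈ Submodule.span ℂ {ρ : FockOp m.LS | IsQuasiFree ρ} := by
  induction hX using Submodule.span_induction with
  | mem ρ hρ =>
    obtain ⟨c, σ, -, hσ, h⟩ := m.expSemigroup_deformedDual_quasiFree α hρ ht
    rw [h]
    exact Submodule.smul_mem _ _ (Submodule.subset_span hσ)
  | zero => rw [expSemigroup_eq, map_zero]; exact Submodule.zero_mem _
  | add x y _ _ hx hy =>
    rw [expSemigroup_eq] at hx hy ⊢
    rw [map_add]
    exact Submodule.add_mem _ hx hy
  | smul c x _ hx =>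
    rw [expSemigroup_eq] at hx ⊢
    rw [map_smul]
    exact Submodule.smul_mem _ c hx

/-- The Perron-Frobenius theorem is applied at time 1 with the quasi-free states as the invariant
compact set, so the Perron eigenvector found there is itself quasi-free. -/
theorem exists_dominant_eigenvalue (hm : IsPositivityImproving m.lindbladian) (α : Fin n → ℝ) :
    ∃ (e : ℝ) (σ : FockOp m.LS), IsQuasiFree σ ∧
      Module.End.eigenspace (m.deformedDual α) (e : ℂ) = Submodule.span ℂ {σ} ∧
      ∀ μ : ℂ, Module.End.HasEigenvalue (m.deformedDual α) μ → μ ≠ (e : ℂ) → μ.re < e := by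
  have hst := lexp_conjTranspose (m.deformedDual_conjTranspose α)
  have hinv : ∀ ρ ∈ quasiFreeSet m.LS, ((lexp (m.deformedDual α) ρ).trace)⁻¹ •
      lexp (m.deformedDual α) ρ ∈ quasiFreeSet m.LS := by
    intro ρ hρ
    have h := (m.lexp_deformedDual_quasiFree α hρ zero_le_one).2
    rwa [Complex.ofReal_one, one_smul] at h
  obtain ⟨e, σ, hσ, h⟩ := perron_frobenius (T' := (lexp (m.deformed α)).toLinearMap)
    (m.deformedDual_conjTranspose α) hst (m.isImproving_lexp_deformedDual hm α)
    (fun a b => by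
      rw [Matrix.trace_mul_comm, Matrix.trace_mul_comm a]
      exact (trace_lexp_mul (m.trace_deformedDual_mul α) b a).symm)
    (fun ρ hρ => hρ.isState) isCompact_quasiFreeSet quasiFreeSet_nonempty hinv
  exact ⟨e, σ, hσ, h⟩

theorem eigenvector_quasiFree (α : Fin n → ℝ) {ρ : FockOp m.LS} (hρ : IsQuasiFree ρ) {μ : ℂ}
    (h : Module.End.HasEigenvector (m.deformedDual α) μ ρ) :
    μ = (m.Q α * (1 - cov ρ)).trace ∧ m.SolvesRiccati α (cov ρ) := by
  have h1 := hρ.isState.2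
  have h2 := h.apply_eq_smul
  rw [deformedDual_eq] at h2
  -- Since Tr ρ = 1, the trace of the eigenvalue equation identifies μ with the trace rate. Testing
  -- against two fields then leaves only the Riccati form, which must vanish.
  have h3 := trace_gen m.E (m.B α) h1
  rw [h2, Matrix.trace_smul, h1, smul_eq_mul, mul_one] at h3
  refine ⟨h3.trans (m.traceRate_eq α _), ?_⟩
  rw [SolvesRiccati, ← riccatiForm_eq]
  ext a b
  have h4 := hρ.isGaussian.two_point_gen m.E (m.B α) h1 a b
  rw [h2, ← h3, smul_mul_assoc, Matrix.trace_smul, ← expect_apply, ← cov_apply, Matrix.add_apply,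
    Matrix.smul_apply] at h4
  simpa using h4

theorem hasEigenvector_of_solvesRiccati (α : Fin n → ℝ) {ρ : FockOp m.LS} (hρ : IsQuasiFree ρ)
    (h : m.SolvesRiccati α (cov ρ)) :
    ∃ μ : ℂ, Module.End.HasEigenvector (m.deformedDual α) μ ρ := by
  have h1 := hρ.isState.2
  rw [SolvesRiccati, ← riccatiForm_eq] at h
  refine ⟨traceRate m.E (m.B α) (cov ρ), Module.End.mem_eigenspace_iff.2 ?_, ?_⟩
  · rw [deformedDual_eq]
    exact hρ.isGaussian.gen_eq_smul h1 h
  · rintro rfl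
    simp at h1

end ThermalModel

end Semigroup

end QuasiFree
end

/-! ### The proposition. -/

theorem mainTheorem4 {n : ℕ} (m : QuasiFree.ThermalModel n)
    (hm : QuasiFree.IsPositivityImproving m.lindbladian) (α : Fin n → ℝ) :
    -- the deformed semigroup preserves the span of the quasi-free states
    (∀ t : ℝ, 0 ≤ t →
      ∀ X ∈ Submodule.span ℂ {ρ : QuasiFree.FockOp m.LS | QuasiFree.IsQuasiFree ρ},
        QuasiFree.expSemigroup (m.deformedDual α) t X ∈
          Submodule.span ℂ {ρ : QuasiFree.FockOp m.LS | QuasiFree.IsQuasiFree ρ}) ∧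
    -- it even maps quasi-free states to positive multiples of quasi-free states
    (∀ t : ℝ, 0 ≤ t → ∀ ρ : QuasiFree.FockOp m.LS, QuasiFree.IsQuasiFree ρ →
      ∃ (c : ℝ) (σ : QuasiFree.FockOp m.LS), 0 < c ∧ QuasiFree.IsQuasiFree σ ∧
        QuasiFree.expSemigroup (m.deformedDual α) t ρ = (c : ℂ) • σ) ∧
    -- the dominant eigenvalue is real, and its eigenspace is the line of a quasi-free state
    (∃ (e : ℝ) (σ : QuasiFree.FockOp m.LS),
      QuasiFree.IsQuasiFree σ ∧
      Module.End.eigenspace (m.deformedDual α) (e : ℂ) = Submodule.span ℂ {σ} ∧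
      ∀ μ : ℂ, Module.End.HasEigenvalue (m.deformedDual α) μ → μ ≠ (e : ℂ) → μ.re < e) ∧
    -- quasi-free eigenvectors are the quasi-free states whose covariance solves the equation
    (∀ ρ : QuasiFree.FockOp m.LS, QuasiFree.IsQuasiFree ρ →
      ((∃ μ : ℂ, Module.End.HasEigenvector (m.deformedDual α) μ ρ) ↔
        m.SolvesRiccati α (QuasiFree.cov ρ)) ∧
      ∀ μ : ℂ, Module.End.HasEigenvector (m.deformedDual α) μ ρ →
        μ = (QuasiFree.xiTranspose (m.Q α) * QuasiFree.cov ρ).trace ∧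
        μ = -(1 / 2) * (m.C α * QuasiFree.cov ρ).trace + (1 / 2) * (m.Q α).trace) := by
  refine ⟨fun t ht X hX => m.expSemigroup_deformedDual_mem_span α ht hX,
    fun t ht ρ hρ => m.expSemigroup_deformedDual_quasiFree α hρ ht,
    m.exists_dominant_eigenvalue hm α, fun ρ hρ => ⟨⟨?_, m.hasEigenvector_of_solvesRiccati α hρ⟩, ?_⟩⟩
  · rintro ⟨μ, h⟩
    exact (m.eigenvector_quasiFree α hρ h).2
  · intro μ h
    -- The anticommutation relations give M^T = 1 - M, so both trace formulas equal tr(Q(1 - M)).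
    have hM := QuasiFree.xiTranspose_cov hρ.isState.2
    rw [m.trace_xiTranspose_Q_mul hM, m.trace_C_mul hM]
    exact ⟨(m.eigenvector_quasiFree α hρ h).1, (m.eigenvector_quasiFree α hρ h).1⟩
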